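/- Let $n>2$, and for $z,w\in\mathbb C^n$ put $q(z)=\sum_i z_i^2$ and $h(z,w)=1-2\sum_i z_i\overline{w_i}+q(z)\overline{q(w)}$. Let $$\mathscr D=\{z\in\mathbb C^n : 1-2|z|^2+|q(z)|^2>0,\ |z|<1\},\qquad \mathscr X=\mathscr D\cap\mathbb R^n .$$ Let $SO(2,n)$ be the group of real matrices $g=\begin{pmatrix}A&B\\C&D\end{pmatrix}$ of determinant $1$ preserving the quadratic form $x_1^2+x_2^2-x_3^2-\dots-x_{n+2}^2$. It acts by $Z\mapsto (C+DZ)(A+BZ)^{-1}$ on the set of real $n\times2$ matrices $Z$ with $I_2-Z^tZ$ positive definite, and hence acts on $\mathscr D$ through the Hua bijection $$z\longmapsto Z=2\left(\begin{pmatrix} q(z)+1& i(q(z)-1)\\ \overline{q(z)}+1&-i(\overline{q(z)}-1)\end{pmatrix}^{-1}\begin{pmatrix} z\\ \bar z\end{pmatrix}\right)^{t}$$ from $\mathscr D$ onto this set, where $z$ and $\bar z$ are row vectors. Let $G=SO_0(2,n)$ be the identity component, $K$ the isotropy group of $0\in\mathscr D$ in $G$, $H$ the identity component of $\{g\in G: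 g(\mathscr X)\subseteq\mathscr X\}$, and $L=H\cap K$. Let $\nu\in\{0,\tfrac{n-2}{2}\}\cup(\tfrac{n-2}{2},\infty)$, and let $\mathscr H_\nu$ be the Hilbert space of functions on $\mathscr D$ with reproducing kernel $h(z,w)^{-\nu}$, where the power is the continuous branch on $\mathscr D\times\mathscr D$ that equals $1$ at $(0,0)$. (For these $\nu$ the kernel is positive semidefinite.) For $g\in G$ and a function $f$ on $\mathscr D$ put $$(\pi_\nu(g)f)(z)=J_{g^{-1}}(z)^{\nu/n}f(g^{-1}z),$$ where $J_g(z)$ is the complex Jacobian determinant at $z$ of the transformation $g$ of $\mathscr D$, and $J_{g}^{\nu/n}=\exp(\tfrac{\nu}{n}\log J_{g})$ with the continuous logarithm of $J_{g}$ on $\mathscr D$ that has the principal value at $0$. Then the constant function $1$ belongs to $\mathscr H_\nu$; the restriction of $\pi_\nu$ to $H$ is a strongly continuous unitary representation $\pi_\nu:H\to\mathscr U(\mathscr H_\nu)$; the function $1$ is $L$-invariant, i.e. $\pi_\nu(l)1=1$ for all $l\in L$; and $1$ is cyclic for this representation, i.e. the linear span of $\{\pi_\nu(h)1: h\in H\}$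 is dense in $\mathscr H_\nu$. -/

import Mathlib

open scoped ComplexConjugate

section Positivity
open Complex MeasureTheory
open scoped ComplexOrder Matrix

theorem posSemidef_rankOne {X : Type*} (f : X → ℂ) :
    (Matrix.of fun x y => f x * conj (f y) : Matrix X X ℂ).PosSemidef := by
  refine ⟨?_, fun c => ?_⟩
  · ext x y
    simp [Matrix.conjTranspose_apply, mul_comm]
  · have : (c.sum fun i xi => c.sum fun j xj =>
        star xi * (Matrix.of fun x y => f x * conj (f y) : Matrix X X ℂ) i j * xj)
        = star (c.sum fun j xj => conj (f j) * xj) * (c.sum fun j xj => conj (f j) * xj) := by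
      simp only [Finsupp.sum, Matrix.of_apply, star_sum, Finset.sum_mul_sum]
      refine Finset.sum_congr rfl fun i _ => Finset.sum_congr rfl fun j _ => ?_
      simp
      ring
    rw [this]
    exact star_mul_self_nonneg _

theorem posSemidef_integral {X T : Type*} [MeasurableSpace T] (μ : Measure T)
    (M : T → Matrix X X ℂ) (hM : ∀ᵐ t ∂μ, (M t).PosSemidef)
    (hint : ∀ x y, Integrable (fun t => M t x y) μ) :
    (Matrix.of fun x y => ∫ t, M t x y ∂μ : Matrix X X ℂ).PosSemidef := by
  refine ⟨?_, fun c => ?_⟩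
  · ext x y
    simp only [Matrix.conjTranspose_apply, Matrix.of_apply, RCLike.star_def]
    rw [← integral_conj]
    refine integral_congr_ae ?_
    filter_upwards [hM] with t ht
    exact ht.isHermitian.apply x y
  · have : (c.sum fun i xi => c.sum fun j xj =>
        star xi * (Matrix.of fun x y => ∫ t, M t x y ∂μ : Matrix X X ℂ) i j * xj)
        = ∫ t, (c.sum fun i xi => c.sum fun j xj => star xi * M t i j * xj) ∂μ := by
      simp only [Finsupp.sum, Matrix.of_apply]
      rw [integral_finsetSum]
      · refine Finset.sum_congr rfl fun i _ => ?_
        rw [integral_finsetSum]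
        · refine Finset.sum_congr rfl fun j _ => ?_
          rw [integral_mul_const, integral_const_mul]
        · exact fun j _ => ((hint i j).const_mul _).mul_const _
      · exact fun i _ => integrable_finsetSum _ fun j _ => ((hint i j).const_mul _).mul_const _
    rw [this]
    refine integral_nonneg_of_ae ?_
    filter_upwards [hM] with t ht
    exact ht.2 c

/-- The Gamma integral `∫_0^∞ t^(s-1) e^(-rt) dt` for a complex `r` with positive real part. -/
theorem gamma_integral_complex {s : ℝ} (hs : 0 < s) {r : ℂ} (hr : 0 < r.re) :
    Integrable (fun t : ℝ => ((t ^ (s - 1) : ℝ) : ℂ) * cexp (-(t * r)))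
      (volume.restrict (Set.Ioi 0)) ∧
    ∫ t in Set.Ioi (0 : ℝ), ((t ^ (s - 1) : ℝ) : ℂ) * cexp (-(t * r))
      = (Real.Gamma s : ℂ) * r ^ (-(s : ℂ)) := by
  have hintR : ∀ {ρ : ℝ}, 0 < ρ →
      IntegrableOn (fun t : ℝ => t ^ (s - 1) * Real.exp (-(t * ρ))) (Set.Ioi 0) := by
    intro ρ hρ
    have := integrableOn_rpow_mul_exp_neg_mul_rpow (s := s - 1) (p := 1) (b := ρ)
      (by linarith) one_pos hρ
    refine this.congr_fun (fun t _ => ?_) measurableSet_Ioi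
    simp [mul_comm]
  have hmeas : ∀ w : ℂ, AEStronglyMeasurable
      (fun t : ℝ => ((t ^ (s - 1) : ℝ) : ℂ) * cexp (-(t * w))) (volume.restrict (Set.Ioi 0)) := by
    intro w
    exact (by fun_prop : Measurable
      (fun t : ℝ => ((t ^ (s - 1) : ℝ) : ℂ) * cexp (-(t * w)))).aestronglyMeasurable
  have hintC : ∀ {w : ℂ}, 0 < w.re → Integrable
      (fun t : ℝ => ((t ^ (s - 1) : ℝ) : ℂ) * cexp (-(t * w))) (volume.restrict (Set.Ioi 0)) := by
    intro w hw
    refine Integrable.mono (hintR hw) (hmeas w) ?_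
    filter_upwards with t
    simp [Complex.norm_exp]
  refine ⟨hintC hr, ?_⟩
  set U : Set ℂ := {w | 0 < w.re} with hU
  have hUo : IsOpen U := isOpen_lt continuous_const continuous_re
  have hUc : IsPreconnected U := (convex_halfSpace_re_gt 0).isPreconnected
  set F : ℂ → ℂ := fun w => ∫ t in Set.Ioi (0 : ℝ), ((t ^ (s - 1) : ℝ) : ℂ) * cexp (-(t * w))
  have hF : DifferentiableOn ℂ F U := by
    intro w hw
    have hw' : 0 < w.re := hw
    refine DifferentiableAt.differentiableWithinAt ?_
    have hε : 0 < w.re / 2 := by linarith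
    have hs2 : IntegrableOn (fun t : ℝ => t ^ s * Real.exp (-(t * (w.re / 2)))) (Set.Ioi 0) := by
      have := integrableOn_rpow_mul_exp_neg_mul_rpow (s := s) (p := 1) (b := w.re / 2)
        (by linarith) one_pos hε
      refine this.congr_fun (fun t _ => ?_) measurableSet_Ioi
      simp [mul_comm]
    refine (hasDerivAt_integral_of_dominated_loc_of_deriv_le (s := Metric.ball w (w.re / 2))
      (F := fun (w : ℂ) (t : ℝ) => ((t ^ (s - 1) : ℝ) : ℂ) * cexp (-(t * w)))
      (F' := fun (w : ℂ) (t : ℝ) => ((t ^ (s - 1) : ℝ) : ℂ) * (cexp (-(t * w)) * (-t)))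
      (bound := fun t : ℝ => t ^ s * Real.exp (-(t * (w.re / 2))))
      (Metric.ball_mem_nhds _ hε) (Filter.Eventually.of_forall hmeas) (hintC hw') ?_ ?_ hs2
      ?_).2.differentiableAt
    · exact (by fun_prop : Measurable
        (fun t : ℝ => ((t ^ (s - 1) : ℝ) : ℂ) * (cexp (-(t * w)) * (-t)))).aestronglyMeasurable
    · refine (ae_restrict_iff' measurableSet_Ioi).2 (Filter.Eventually.of_forall ?_)
      intro t ht v hv
      have ht : 0 < t := ht
      have hv' : w.re / 2 ≤ v.re := by
        have h1 := (Complex.abs_re_le_norm (v - w)).trans (le_of_lt (by simpa [dist_eq_norm] using hv))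
        rw [abs_le] at h1
        simp at h1
        linarith [h1.1]
      have h2 : t ^ s = t ^ (s - 1) * t := by
        rw [Real.rpow_sub_one ht.ne']; field_simp
      rw [norm_mul, norm_mul, Complex.norm_exp, h2]
      simp only [norm_real, Real.norm_eq_abs, norm_neg, neg_re, re_ofReal_mul]
      rw [abs_of_pos (Real.rpow_pos_of_pos ht _), abs_of_pos ht]
      have : Real.exp (-(t * v.re)) ≤ Real.exp (-(t * (w.re / 2))) := by
        apply Real.exp_le_exp.2; nlinarith
      have h3 := Real.rpow_pos_of_pos ht (s - 1)
      calc _ = t ^ (s - 1) * t * Real.exp (-(t * v.re)) := by ring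
        _ ≤ _ := by gcongr
    · refine Filter.Eventually.of_forall ?_
      intro t v _
      have : HasDerivAt (fun w : ℂ => -((t : ℂ) * w)) (-(t : ℂ)) v := by
        have h0 := ((hasDerivAt_id v).const_mul (t : ℂ)).neg
        rw [mul_one] at h0
        exact h0
      exact (this.cexp).const_mul _
  have hG : DifferentiableOn ℂ (fun w : ℂ => (Real.Gamma s : ℂ) * w ^ (-(s : ℂ))) U := by
    intro w hw
    refine DifferentiableAt.differentiableWithinAt ?_
    refine DifferentiableAt.const_mul ?_ _
    exact (differentiableAt_id).cpow_const (Or.inl hw)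
  have key := (hF.analyticOnNhd hUo).eqOn_of_preconnected_of_frequently_eq
    (hG.analyticOnNhd hUo) hUc (z₀ := 1) (by simp [hU]) ?_
  · exact key hr
  · have hreal : ∀ ρ : ℝ, 0 < ρ → F ρ = (Real.Gamma s : ℂ) * (ρ : ℂ) ^ (-(s : ℂ)) := by
      intro ρ hρ
      have := integral_cpow_mul_exp_neg_mul_Ioi (a := s) (r := ρ) (by simpa using hs) hρ
      rw [one_div, Complex.inv_cpow _ _ (by simp [Complex.arg_ofReal_of_nonneg hρ.le, Real.pi_ne_zero.symm]),
        ← Complex.cpow_neg, mul_comm, Complex.Gamma_ofReal] at this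
      rw [← this]
      refine setIntegral_congr_fun measurableSet_Ioi fun t ht => ?_
      have ht : 0 < t := ht
      rw [Complex.ofReal_cpow ht.le]
      push_cast
      ring_nf
    have : Filter.Tendsto (fun k : ℕ => (((1 + 1 / ((k : ℝ) + 1) : ℝ)) : ℂ)) Filter.atTop
        (nhdsWithin 1 {1}ᶜ) := by
      rw [tendsto_nhdsWithin_iff]
      constructor
      · have := (tendsto_one_div_add_atTop_nhds_zero_nat (𝕜 := ℝ)).const_add 1
        rw [add_zero] at this
        exact_mod_cast (Complex.continuous_ofReal.tendsto 1).comp this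
      · refine Filter.Eventually.of_forall fun k => ?_
        simp only [Set.mem_compl_iff, Set.mem_singleton_iff]
        norm_cast
        have : (0 : ℝ) < 1 / ((k : ℝ) + 1) := by positivity
        intro h
        norm_num at h
        norm_cast at h
    refine this.frequently (Filter.Eventually.frequently (Filter.Eventually.of_forall fun k => ?_))
    exact hreal _ (by positivity)

theorem posSemidef_mul_cpow {X : Type*} (g k : X → X → ℂ) (hk : ∀ x y, 0 < (k x y).re)
    (h : ∀ a : ℝ, 0 < a → (Matrix.of fun x y => g x y * cexp (-(a * k x y))).PosSemidef)
    {s : ℝ} (hs : 0 < s) :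
    (Matrix.of fun x y => g x y * k x y ^ (-(s : ℂ))).PosSemidef := by
  have h1 := posSemidef_integral (volume.restrict (Set.Ioi (0 : ℝ)))
    (fun t => (t ^ (s - 1) : ℝ) • Matrix.of fun x y => g x y * cexp (-(t * k x y))) ?_ ?_
  · have h2 := h1.smul (a := (Real.Gamma s)⁻¹) (inv_nonneg.2 (Real.Gamma_pos_of_pos hs).le)
    convert h2 using 1
    ext x y
    have := (gamma_integral_complex hs (hk x y)).2
    simp only [Matrix.of_apply, Matrix.smul_apply, Complex.real_smul]
    have e : ∀ t : ℝ, ((t ^ (s - 1) : ℝ) : ℂ) * (g x y * cexp (-(t * k x y)))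
        = g x y * (((t ^ (s - 1) : ℝ) : ℂ) * cexp (-(t * k x y))) := fun t => by ring
    simp_rw [e]
    rw [integral_const_mul, this]
    have : (Real.Gamma s : ℂ) ≠ 0 := by exact_mod_cast (Real.Gamma_pos_of_pos hs).ne'
    push_cast
    field_simp
  · refine (ae_restrict_iff' measurableSet_Ioi).2 (Filter.Eventually.of_forall fun t ht => ?_)
    exact (h t ht).smul (Real.rpow_nonneg (le_of_lt ht) _)
  · intro x y
    have := (gamma_integral_complex hs (hk x y)).1.const_mul (g x y)
    refine this.congr (Filter.Eventually.of_forall fun t => ?_)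
    simp only [Matrix.of_apply, Matrix.smul_apply, Complex.real_smul]
    ring

theorem posSemidef_gaussian {X : Type*} (τ r : X → ℂ) (hτ : ∀ x, 0 < (τ x).re)
    {a : ℝ} (ha : 0 ≤ a) :
    (Matrix.of fun x y => (τ x + conj (τ y)) ^ (-(1 / 2 : ℂ)) *
      cexp (a * ((r x + conj (r y)) ^ 2 / (τ x + conj (τ y))))).PosSemidef := by
  have hre : ∀ x y, 0 < (τ x + conj (τ y)).re := fun x y => by
    simpa using add_pos (hτ x) (hτ y)
  have h1 := posSemidef_integral (volume : Measure ℝ)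
    (fun t => Matrix.of fun x y => cexp (-(τ x + conj (τ y)) * (t : ℂ) ^ 2
      + (2 * √a * (r x + conj (r y))) * t + 0)) ?_ ?_
  · have h2 := h1.smul (a := (√Real.pi)⁻¹) (inv_nonneg.2 (Real.sqrt_nonneg _))
    convert h2 using 1
    ext x y
    simp only [Matrix.of_apply, Matrix.smul_apply, Complex.real_smul]
    have hb : (-(τ x + conj (τ y))).re < 0 := by
      rw [neg_re]; linarith [hre x y]
    rw [integral_cexp_quadratic hb]
    have hne : τ x + conj (τ y) ≠ 0 := fun h0 => by
      have := hre x y; rw [h0] at this; simp at this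
    have hsq : ((√a : ℝ) : ℂ) ^ 2 = a := by norm_cast; exact Real.sq_sqrt ha
    have hpi : ((Real.pi : ℂ) / - -(τ x + conj (τ y))) ^ (1 / 2 : ℂ)
        = (√Real.pi : ℝ) * (τ x + conj (τ y)) ^ (-(1 / 2 : ℂ)) := by
      have hln : (τ x + conj (τ y)).arg ≠ Real.pi := fun h0 => by
        have := (Complex.arg_eq_pi_iff.1 h0).1
        linarith [hre x y]
      rw [neg_neg, div_eq_mul_inv, Complex.cpow_def_of_ne_zero (by simp [hne, Real.pi_ne_zero]),
        Complex.log_ofReal_mul Real.pi_pos (inv_ne_zero hne), Complex.log_inv _ hln,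
        Complex.cpow_def_of_ne_zero hne, Real.sqrt_eq_rpow, Real.rpow_def_of_pos Real.pi_pos,
        Complex.ofReal_exp, ← Complex.exp_add]
      congr 1
      push_cast
      ring
    rw [hpi]
    have hpi0 : ((√Real.pi : ℝ) : ℂ) ≠ 0 := by
      exact_mod_cast (Real.sqrt_pos.2 Real.pi_pos).ne'
    push_cast
    have e : (0 : ℂ) - (2 * ((√a : ℝ) : ℂ) * (r x + conj (r y))) ^ 2 / (4 * -(τ x + conj (τ y)))
        = a * ((r x + conj (r y)) ^ 2 / (τ x + conj (τ y))) := by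
      rw [← hsq]; field_simp; ring
    rw [e]
    field_simp
  · refine Filter.Eventually.of_forall fun t => ?_
    convert posSemidef_rankOne (fun x => cexp (-τ x * (t : ℂ) ^ 2 + 2 * √a * r x * t)) using 1
    ext x y
    simp only [Matrix.of_apply]
    rw [← Complex.exp_conj, ← Complex.exp_add]
    congr 1
    simp only [map_add, map_mul, map_neg, map_pow, conj_ofReal, map_ofNat]
    ring
  · intro x y
    have := integrable_cexp_quadratic (b := τ x + conj (τ y)) (hre x y)
      (2 * √a * (r x + conj (r y))) 0
    exact this
end Positivity

noncomputable section LieBall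
open Complex

/-- The complex quadratic form `q(z) = z z^t = z_1^2 + ⋯ + z_n^2` on `ℂ^n`. -/
def quadForm {n : ℕ} (z : EuclideanSpace ℂ (Fin n)) : ℂ := ∑ i, z i ^ 2

/-- The Lie ball `𝒟 = {z ∈ ℂ^n : 1 - 2⟨z,z⟩ + |z z^t|^2 > 0, |z| < 1}`. -/
def lieBall (n : ℕ) : Set (EuclideanSpace ℂ (Fin n)) :=
  {z | 0 < 1 - 2 * ‖z‖ ^ 2 + ‖quadForm z‖ ^ 2 ∧ ‖z‖ < 1}

/-- The polynomial `h(z,w) = 1 - 2⟨z,w⟩ + (z z^t) \overline{(w w^t)}`. -/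
def hPoly {n : ℕ} (z w : EuclideanSpace ℂ (Fin n)) : ℂ :=
  1 - 2 * ∑ i, z i * conj (w i) + quadForm z * conj (quadForm w)

/-- The set `{0, (n-2)/2} ∪ ((n-2)/2, ∞)`. -/
def wallachSet (n : ℕ) : Set ℝ :=
  {0, ((n : ℝ) - 2) / 2} ∪ Set.Ioi (((n : ℝ) - 2) / 2)

theorem norm_quadForm_le {n : ℕ} (z : EuclideanSpace ℂ (Fin n)) : ‖quadForm z‖ ≤ ‖z‖ ^ 2 := by
  rw [EuclideanSpace.norm_sq_eq]
  refine (norm_sum_le _ _).trans (le_of_eq ?_)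
  simp

theorem quadForm_smul {n : ℕ} (s : ℂ) (z : EuclideanSpace ℂ (Fin n)) :
    quadForm (s • z) = s ^ 2 * quadForm z := by
  simp [quadForm, Finset.mul_sum, mul_pow]

theorem continuous_quadForm {n : ℕ} : Continuous (quadForm (n := n)) := by
  unfold quadForm; fun_prop

theorem hPoly_self {n : ℕ} (z : EuclideanSpace ℂ (Fin n)) :
    hPoly z z = ((1 - 2 * ‖z‖ ^ 2 + ‖quadForm z‖ ^ 2 : ℝ) : ℂ) := by
  have : ∑ i, z i * conj (z i) = ((‖z‖ ^ 2 : ℝ) : ℂ) := by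
    rw [EuclideanSpace.norm_sq_eq]
    push_cast
    simp [Complex.mul_conj']
  rw [hPoly, this, Complex.mul_conj']
  push_cast
  ring

theorem smul_mem_lieBall {n : ℕ} {z : EuclideanSpace ℂ (Fin n)} (hz : z ∈ lieBall n) {s : ℂ}
    (hs : ‖s‖ ≤ 1) : s • z ∈ lieBall n := by
  obtain ⟨h1, h2⟩ := hz
  have hq := norm_quadForm_le z
  have hs0 := norm_nonneg s
  have hz0 := norm_nonneg z
  have hq0 := norm_nonneg (quadForm z)
  have hz2 : ‖z‖ ^ 2 < 1 := by nlinarith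
  have hs2 : ‖s‖ ^ 2 ≤ 1 := by nlinarith
  have hs20 : 0 ≤ ‖s‖ ^ 2 := by positivity
  refine ⟨?_, ?_⟩
  · rw [quadForm_smul, norm_smul, norm_mul, norm_pow]
    have e : 1 - 2 * (‖s‖ * ‖z‖) ^ 2 + (‖s‖ ^ 2 * ‖quadForm z‖) ^ 2
        = (1 - 2 * ‖z‖ ^ 2 + ‖quadForm z‖ ^ 2)
          + (1 - ‖s‖ ^ 2) * (2 * ‖z‖ ^ 2 - (1 + ‖s‖ ^ 2) * ‖quadForm z‖ ^ 2) := by ring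
    rw [e]
    have : ‖quadForm z‖ ^ 2 ≤ ‖z‖ ^ 2 := by nlinarith
    have : 0 ≤ 2 * ‖z‖ ^ 2 - (1 + ‖s‖ ^ 2) * ‖quadForm z‖ ^ 2 := by nlinarith [sq_nonneg ‖quadForm z‖]
    nlinarith
  · rw [norm_smul]; nlinarith

theorem norm_quadForm_lt_one {n : ℕ} {z : EuclideanSpace ℂ (Fin n)} (hz : z ∈ lieBall n) :
    ‖quadForm z‖ < 1 := by
  have := norm_quadForm_le z
  have := norm_nonneg z
  nlinarith [hz.2]

theorem zero_mem_lieBall (n : ℕ) : (0 : EuclideanSpace ℂ (Fin n)) ∈ lieBall n := by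
  simp [lieBall, quadForm]

/-- A quadratic polynomial with constant term `1` without zeros in the closed unit disc takes a
value in the slit plane at `1`. -/
theorem mem_slitPlane_of_quadratic (b c : ℂ)
    (h : ∀ s : ℂ, ‖s‖ ≤ 1 → 1 + b * s + c * s ^ 2 ≠ 0) : 1 + b + c ∈ slitPlane := by
  obtain ⟨d, hd⟩ := IsAlgClosed.exists_pow_nat_eq (b ^ 2 - 4 * c) two_pos
  have key : ∀ μ : ℂ, μ ^ 2 + b * μ + c = 0 → ‖μ‖ < 1 := by
    intro μ hμ
    by_contra! hle
    have hμ0 : μ ≠ 0 := fun h0 => by rw [h0] at hle; simp at hle; linarith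
    refine h μ⁻¹ (by rw [norm_inv]; exact inv_le_one_of_one_le₀ hle) ?_
    field_simp
    linear_combination hμ
  have h1 := key ((-b + d) / 2) (by linear_combination hd / 4)
  have h2 := key ((-b - d) / 2) (by linear_combination hd / 4)
  set μ := (-b + d) / 2
  set η := (-b - d) / 2
  have e : 1 + b + c = (1 - μ) * (1 - η) := by
    simp only [μ, η]; linear_combination hd / 4
  have r1 : 0 < (1 - μ).re := by
    have := (Complex.re_le_norm μ); simp; linarith
  have r2 : 0 < (1 - η).re := by
    have := (Complex.re_le_norm η); simp; linarith
  rw [e]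
  generalize 1 - μ = u at *
  generalize 1 - η = v at *
  rw [mem_slitPlane_iff]
  by_contra! hcon
  obtain ⟨c1, c2⟩ := hcon
  rw [mul_re] at c1
  rw [mul_im] at c2
  have e2 : v.re * (u.re ^ 2 + u.im ^ 2)
      = u.re * (u.re * v.re - u.im * v.im) + u.im * (u.re * v.im + u.im * v.re) := by ring
  rw [c2, mul_zero, add_zero] at e2
  have : u.re * (u.re * v.re - u.im * v.im) ≤ 0 := mul_nonpos_of_nonneg_of_nonpos r1.le c1
  nlinarith [mul_pos r2 (pow_pos r1 2), mul_nonneg r2.le (sq_nonneg u.im)]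

/-- The denominator of the Cayley transform with respect to the coordinate `k`. -/
def cayleyDen {n : ℕ} (k : Fin n) (z : EuclideanSpace ℂ (Fin n)) : ℂ := 1 - 2 * z k + quadForm z

theorem cayleyDen_ne_zero {n : ℕ} (k : Fin n) {z : EuclideanSpace ℂ (Fin n)} (hz : z ∈ lieBall n) :
    cayleyDen k z ≠ 0 := by
  intro h0
  have h1 := hz.1
  have hn : ‖z‖ ^ 2 = ‖z k‖ ^ 2 + ∑ i ∈ Finset.univ.erase k, ‖z i‖ ^ 2 := by
    rw [EuclideanSpace.norm_sq_eq, Finset.add_sum_erase _ (fun i => ‖z i‖ ^ 2) (Finset.mem_univ k)]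
  have hq : quadForm z = z k ^ 2 + ∑ i ∈ Finset.univ.erase k, z i ^ 2 := by
    rw [quadForm, Finset.add_sum_erase _ (fun i => z i ^ 2) (Finset.mem_univ k)]
  set S := ∑ i ∈ Finset.univ.erase k, ‖z i‖ ^ 2
  set s := ∑ i ∈ Finset.univ.erase k, z i ^ 2
  have hs : ‖s‖ ≤ S := by
    refine (norm_sum_le _ _).trans (le_of_eq ?_)
    simp [S]
  set v := z k - 1 with hv
  have hzk : z k = 1 + v := by rw [hv]; ring
  have hsv : s = - v ^ 2 := by
    rw [cayleyDen, hq, hzk] at h0; linear_combination h0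
  have hq' : quadForm z = 1 + 2 * v := by
    rw [cayleyDen, hzk] at h0; linear_combination h0
  have hS : ‖v‖ ^ 2 ≤ S := by rw [hsv] at hs; simpa using hs
  have n1 : ‖z k‖ ^ 2 = 1 + 2 * v.re + ‖v‖ ^ 2 := by
    rw [hzk, Complex.sq_norm, Complex.sq_norm, normSq_apply, normSq_apply]; simp; ring
  have n2 : ‖quadForm z‖ ^ 2 = 1 + 4 * v.re + 4 * ‖v‖ ^ 2 := by
    rw [hq', Complex.sq_norm, Complex.sq_norm, normSq_apply, normSq_apply]; simp; ring
  rw [hn, n1, n2] at h1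
  linarith

def cayleyS {n : ℕ} (k : Fin n) (z : EuclideanSpace ℂ (Fin n)) : ℂ :=
  (1 - quadForm z) / cayleyDen k z

def cayleyR {n : ℕ} (k j : Fin n) (z : EuclideanSpace ℂ (Fin n)) : ℂ :=
  2 * I * z j / cayleyDen k z

theorem four_mul_hPoly {n : ℕ} {k l : Fin n} (hkl : l ≠ k) {z w : EuclideanSpace ℂ (Fin n)}
    (hz : z ∈ lieBall n) (hw : w ∈ lieBall n) :
    4 * hPoly z w = cayleyDen k z * conj (cayleyDen k w) *
      (((cayleyS k z - cayleyR k l z) + conj (cayleyS k w - cayleyR k l w)) *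
        ((cayleyS k z + cayleyR k l z) + conj (cayleyS k w + cayleyR k l w)) -
        ∑ j ∈ (Finset.univ.erase k).erase l, (cayleyR k j z + conj (cayleyR k j w)) ^ 2) := by
  have hz0 := cayleyDen_ne_zero k hz
  have hw0 := cayleyDen_ne_zero k hw
  have hw0' : conj (cayleyDen k w) ≠ 0 := by simpa using hw0
  have split : ∀ f : Fin n → ℂ, ∑ i, f i = f k + (f l + ∑ i ∈ (Finset.univ.erase k).erase l, f i) := by
    intro f
    rw [Finset.add_sum_erase _ f (by simp [hkl]), Finset.add_sum_erase _ f (Finset.mem_univ k)]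
  have hS : ∑ j ∈ (Finset.univ.erase k).erase l, (cayleyR k j z + conj (cayleyR k j w)) ^ 2
      = -4 * ((∑ j ∈ (Finset.univ.erase k).erase l, z j ^ 2) / cayleyDen k z ^ 2
        + (conj (∑ j ∈ (Finset.univ.erase k).erase l, w j ^ 2)) / conj (cayleyDen k w) ^ 2
        - 2 * (∑ j ∈ (Finset.univ.erase k).erase l, z j * conj (w j))
          / (cayleyDen k z * conj (cayleyDen k w))) := by
    rw [map_sum, Finset.sum_div, Finset.sum_div, Finset.mul_sum, Finset.sum_div,
      ← Finset.sum_add_distrib, ← Finset.sum_sub_distrib, Finset.mul_sum]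
    refine Finset.sum_congr rfl fun j _ => ?_
    simp only [cayleyR, map_div₀, map_mul, conj_I, map_ofNat, map_pow]
    field_simp
    ring_nf
    simp only [I_sq]
    ring
  rw [hS, hPoly, split (fun i => z i * conj (w i))]
  have dz : cayleyDen k z = 1 - 2 * z k + quadForm z := rfl
  have dw : conj (cayleyDen k w) = 1 - 2 * conj (w k) + conj (quadForm w) := by
    simp only [cayleyDen, map_add, map_sub, map_mul, map_one, map_ofNat]
  have qz := split (fun i => z i ^ 2)
  have qw := congrArg conj (split (fun i => w i ^ 2))
  change quadForm z = _ at qz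
  change conj (quadForm w) = _ at qw
  simp only [map_add, map_pow] at qw
  simp only [cayleyS, cayleyR, map_div₀, map_mul, conj_I, map_ofNat, map_sub, map_one, map_add]
  have ez : ∑ j ∈ (Finset.univ.erase k).erase l, z j ^ 2 = quadForm z - z k ^ 2 - z l ^ 2 := by
    rw [qz]; ring
  have ew : conj (∑ j ∈ (Finset.univ.erase k).erase l, w j ^ 2)
      = conj (quadForm w) - conj (w k) ^ 2 - conj (w l) ^ 2 := by
    rw [qw]; ring
  rw [ez, ew]
  generalize conj (quadForm w) = Qw at *
  generalize conj (cayleyDen k w) = Dw at *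
  generalize quadForm z = Qz at *
  generalize cayleyDen k z = Dz at *
  generalize ∑ j ∈ (Finset.univ.erase k).erase l, z j * conj (w j) = T at *
  have e2 : I ^ 2 = -1 := I_sq
  field_simp
  ring_nf
  simp only [I_sq]
  subst dz dw
  ring


theorem cayley_re_mul_pos {n : ℕ} {k l : Fin n} (hkl : l ≠ k) {z : EuclideanSpace ℂ (Fin n)}
    (hz : z ∈ lieBall n) :
    ∑ j ∈ (Finset.univ.erase k).erase l, (cayleyR k j z).re ^ 2
      < (cayleyS k z - cayleyR k l z).re * (cayleyS k z + cayleyR k l z).re := by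
  have h := four_mul_hPoly hkl hz hz
  have hpos := hz.1
  rw [hPoly_self] at h
  simp only [Complex.add_conj, Complex.mul_conj] at h
  have hD : 0 < normSq (cayleyDen k z) := normSq_pos.2 (cayleyDen_ne_zero k hz)
  norm_cast at h
  have e : ∑ j ∈ (Finset.univ.erase k).erase l, (2 * (cayleyR k j z).re) ^ 2
      = 4 * ∑ j ∈ (Finset.univ.erase k).erase l, (cayleyR k j z).re ^ 2 := by
    rw [Finset.mul_sum]; exact Finset.sum_congr rfl fun j _ => by ring
  rw [e] at h
  have h2 : 0 < normSq (cayleyDen k z) * (2 * (cayleyS k z - cayleyR k l z).re *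
      (2 * (cayleyS k z + cayleyR k l z).re) -
        4 * ∑ j ∈ (Finset.univ.erase k).erase l, (cayleyR k j z).re ^ 2) := by
    rw [← h]; linarith
  have h3 := (pos_iff_pos_of_mul_pos h2).1 hD
  linarith

theorem continuousOn_cayleyDen_inv {n : ℕ} (k : Fin n) {z : EuclideanSpace ℂ (Fin n)}
    (hz : z ∈ lieBall n) :
    ContinuousOn (fun t : ℝ => (cayleyDen k ((t : ℂ) • z))⁻¹) (Set.Icc 0 1) := by
  have : Continuous fun t : ℝ => cayleyDen k ((t : ℂ) • z) := by
    have := continuous_quadForm (n := n)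
    unfold cayleyDen
    fun_prop
  refine this.continuousOn.inv₀ fun t ht => cayleyDen_ne_zero k (smul_mem_lieBall hz ?_)
  simpa [abs_of_nonneg ht.1] using ht.2

theorem smul_mem_lieBall_of_mem_Icc {n : ℕ} {z : EuclideanSpace ℂ (Fin n)}
    (hz : z ∈ lieBall n) {t : ℝ} (ht : t ∈ Set.Icc (0 : ℝ) 1) : (t : ℂ) • z ∈ lieBall n :=
  smul_mem_lieBall hz (by simpa [abs_of_nonneg ht.1] using ht.2)

theorem continuousOn_cayleyS {n : ℕ} (k : Fin n) {z : EuclideanSpace ℂ (Fin n)}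
    (hz : z ∈ lieBall n) :
    ContinuousOn (fun t : ℝ => cayleyS k ((t : ℂ) • z)) (Set.Icc 0 1) := by
  have h1 : Continuous fun t : ℝ => (1 - quadForm ((t : ℂ) • z)) := by
    have := continuous_quadForm (n := n)
    fun_prop
  exact (h1.continuousOn.mul (continuousOn_cayleyDen_inv k hz)).congr fun t _ => div_eq_mul_inv _ _

theorem continuousOn_cayleyR {n : ℕ} (k j : Fin n) {z : EuclideanSpace ℂ (Fin n)}
    (hz : z ∈ lieBall n) :
    ContinuousOn (fun t : ℝ => cayleyR k j ((t : ℂ) • z)) (Set.Icc 0 1) := by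
  have h1 : Continuous fun t : ℝ => 2 * I * ((t : ℂ) • z) j := by
    fun_prop
  exact (h1.continuousOn.mul (continuousOn_cayleyDen_inv k hz)).congr fun t _ => div_eq_mul_inv _ _

theorem pos_of_continuousOn_ne_zero {f : ℝ → ℝ} (hf : ContinuousOn f (Set.Icc 0 1))
    (h0 : 0 < f 0) (hne : ∀ t ∈ Set.Icc (0 : ℝ) 1, f t ≠ 0) : 0 < f 1 := by
  by_contra! hle
  obtain ⟨t, ht, htz⟩ := intermediate_value_Icc' zero_le_one hf ⟨hle, h0.le⟩
  exact hne t ht htz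

theorem cayley_re_pos {n : ℕ} {k l : Fin n} (hkl : l ≠ k) {z : EuclideanSpace ℂ (Fin n)}
    (hz : z ∈ lieBall n) :
    0 < (cayleyS k z - cayleyR k l z).re ∧ 0 < (cayleyS k z + cayleyR k l z).re := by
  have hm : ∀ t ∈ Set.Icc (0 : ℝ) 1, 0 < (cayleyS k ((t : ℂ) • z) - cayleyR k l ((t : ℂ) • z)).re
      * (cayleyS k ((t : ℂ) • z) + cayleyR k l ((t : ℂ) • z)).re := fun t ht =>
    lt_of_le_of_lt (Finset.sum_nonneg fun j _ => sq_nonneg _)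
      (cayley_re_mul_pos hkl (smul_mem_lieBall_of_mem_Icc hz ht))
  have hS := continuousOn_cayleyS k hz
  have hR := continuousOn_cayleyR k l hz
  constructor
  · have := pos_of_continuousOn_ne_zero
      (Complex.continuous_re.comp_continuousOn (hS.sub hR)) (by
        simp [cayleyS, cayleyR, cayleyDen, quadForm])
      (fun t ht h0 => (left_ne_zero_of_mul (hm t ht).ne') h0)
    simpa using this
  · have := pos_of_continuousOn_ne_zero
      (Complex.continuous_re.comp_continuousOn (hS.add hR)) (by
        simp [cayleyS, cayleyR, cayleyDen, quadForm])
      (fun t ht h0 => (right_ne_zero_of_mul (hm t ht).ne') h0)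
    simpa using this

theorem re_sq_div_le (w y : ℂ) (hy : 0 < y.re) : (w ^ 2 / y).re ≤ w.re ^ 2 / y.re := by
  have hN : 0 < normSq y := normSq_pos.2 fun h => by simp [h] at hy
  rw [Complex.div_re, ← add_div, div_le_div_iff₀ hN hy, normSq_apply]
  simp only [sq, mul_re, mul_im]
  nlinarith [sq_nonneg (w.im * y.re - w.re * y.im)]

theorem titu (a b p q : ℝ) (hp : 0 < p) (hq : 0 < q) :
    (a + b) ^ 2 / (p + q) ≤ a ^ 2 / p + b ^ 2 / q := by
  rw [div_add_div _ _ hp.ne' hq.ne', div_le_div_iff₀ (by positivity) (by positivity)]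
  nlinarith [sq_nonneg (a * q - b * p), mul_pos hp hq]

/-- The Schur complement that appears in the factorisation of `h`. -/
def cayleyY {n : ℕ} (k l : Fin n) (z w : EuclideanSpace ℂ (Fin n)) : ℂ :=
  ((cayleyS k z - cayleyR k l z) + conj (cayleyS k w - cayleyR k l w)) -
    ∑ j ∈ (Finset.univ.erase k).erase l, (cayleyR k j z + conj (cayleyR k j w)) ^ 2 /
      ((cayleyS k z + cayleyR k l z) + conj (cayleyS k w + cayleyR k l w))

def cayleyT {n : ℕ} (k l : Fin n) (z w : EuclideanSpace ℂ (Fin n)) : ℂ :=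
  (cayleyS k z + cayleyR k l z) + conj (cayleyS k w + cayleyR k l w)

theorem cayleyT_re_pos {n : ℕ} {k l : Fin n} (hkl : l ≠ k) {z w : EuclideanSpace ℂ (Fin n)}
    (hz : z ∈ lieBall n) (hw : w ∈ lieBall n) : 0 < (cayleyT k l z w).re := by
  rw [cayleyT, add_re (_ + _), conj_re]
  exact add_pos (cayley_re_pos hkl hz).2 (cayley_re_pos hkl hw).2

theorem cayleyY_re_pos {n : ℕ} {k l : Fin n} (hkl : l ≠ k) {z w : EuclideanSpace ℂ (Fin n)}
    (hz : z ∈ lieBall n) (hw : w ∈ lieBall n) : 0 < (cayleyY k l z w).re := by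
  have hz1 := cayley_re_pos hkl hz
  have hw1 := cayley_re_pos hkl hw
  have hz2 := cayley_re_mul_pos hkl hz
  have hw2 := cayley_re_mul_pos hkl hw
  have hT := cayleyT_re_pos hkl hz hw
  rw [← div_lt_iff₀ hz1.2, Finset.sum_div] at hz2
  rw [← div_lt_iff₀ hw1.2, Finset.sum_div] at hw2
  rw [cayleyY, sub_re, re_sum, add_re (_ - _), conj_re, sub_pos]
  refine lt_of_le_of_lt ?_ (add_lt_add hz2 hw2)
  rw [← Finset.sum_add_distrib]
  refine Finset.sum_le_sum fun j _ => ?_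
  refine (re_sq_div_le _ _ hT).trans ?_
  rw [cayleyT, add_re (_ + _), conj_re, add_re (cayleyR k j z), conj_re]
  exact titu _ _ _ _ hz1.2 hw1.2

theorem four_mul_hPoly' {n : ℕ} {k l : Fin n} (hkl : l ≠ k) {z w : EuclideanSpace ℂ (Fin n)}
    (hz : z ∈ lieBall n) (hw : w ∈ lieBall n) :
    4 * hPoly z w = cayleyDen k z * conj (cayleyDen k w) * (cayleyT k l z w * cayleyY k l z w) := by
  have hT : cayleyT k l z w ≠ 0 := fun h0 => by
    have := cayleyT_re_pos hkl hz hw; rw [h0] at this; simp at this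
  rw [four_mul_hPoly hkl hz hw, cayleyY, ← Finset.sum_div]
  congr 1
  change _ * cayleyT k l z w - _ = cayleyT k l z w * (_ - _ / cayleyT k l z w)
  field_simp

theorem hPoly_ne_zero {n : ℕ} (hn : 2 ≤ n) {z w : EuclideanSpace ℂ (Fin n)}
    (hz : z ∈ lieBall n) (hw : w ∈ lieBall n) : hPoly z w ≠ 0 := by
  have hkl : (⟨1, hn⟩ : Fin n) ≠ ⟨0, by omega⟩ := by simp
  have hT := cayleyT_re_pos hkl hz hw
  have hY := cayleyY_re_pos hkl hz hw
  intro h0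
  have h := four_mul_hPoly' hkl hz hw
  rw [h0, mul_zero] at h
  have h1 := cayleyDen_ne_zero ⟨0, by omega⟩ hz
  have h2 := cayleyDen_ne_zero ⟨0, by omega⟩ hw
  have h3 := h.symm
  simp only [mul_eq_zero, map_eq_zero, h1, h2, false_or] at h3
  rcases h3 with h3 | h3
  · rw [h3] at hT; simp at hT
  · rw [h3] at hY; simp at hY

/-- On the Lie ball `h(z,w)` avoids the non-positive real axis, so that the principal power of
`h(z,w)` is its continuous branch with value `1` at `(0,0)`. -/
theorem hPoly_mem_slitPlane {n : ℕ} (hn : 2 ≤ n) {z w : EuclideanSpace ℂ (Fin n)}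
    (hz : z ∈ lieBall n) (hw : w ∈ lieBall n) : hPoly z w ∈ slitPlane := by
  have := mem_slitPlane_of_quadratic (-(2 * ∑ i, z i * conj (w i)))
    (quadForm z * conj (quadForm w)) ?_
  · simpa only [hPoly, sub_eq_add_neg] using this
  · intro s hs
    have h := hPoly_ne_zero hn (smul_mem_lieBall hz hs) hw
    convert h using 1
    rw [hPoly, quadForm_smul]
    simp only [PiLp.smul_apply, smul_eq_mul, mul_assoc, ← Finset.mul_sum]
    ring

theorem cayleyDen_mem_slitPlane {n : ℕ} (k : Fin n) {z : EuclideanSpace ℂ (Fin n)}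
    (hz : z ∈ lieBall n) : cayleyDen k z ∈ slitPlane := by
  have := mem_slitPlane_of_quadratic (-(2 * z k)) (quadForm z) ?_
  · simpa only [cayleyDen, sub_eq_add_neg] using this
  · intro s hs
    have h := cayleyDen_ne_zero k (smul_mem_lieBall hz hs)
    convert h using 1
    rw [cayleyDen, quadForm_smul]
    simp only [PiLp.smul_apply, smul_eq_mul]
    ring

theorem mem_slitPlane_of_re_pos {y : ℂ} (h : 0 < y.re) : y ∈ slitPlane := Or.inl h

theorem conj_mem_slitPlane {y : ℂ} (h : y ∈ slitPlane) : conj y ∈ slitPlane := by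
  simpa [mem_slitPlane_iff] using h

theorem continuous_hPoly {n : ℕ} :
    Continuous fun p : EuclideanSpace ℂ (Fin n) × EuclideanSpace ℂ (Fin n) => hPoly p.1 p.2 := by
  have h := continuous_quadForm (n := n)
  unfold hPoly
  have h1 : Continuous fun p : EuclideanSpace ℂ (Fin n) × EuclideanSpace ℂ (Fin n) =>
      quadForm p.1 * conj (quadForm p.2) :=
    (h.comp continuous_fst).mul (Complex.continuous_conj.comp (h.comp continuous_snd))
  have h2 : Continuous fun p : EuclideanSpace ℂ (Fin n) × EuclideanSpace ℂ (Fin n) =>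
      ∑ i, p.1 i * conj (p.2 i) := by
    refine continuous_finsetSum _ fun i _ => Continuous.mul (by fun_prop) ?_
    exact Complex.continuous_conj.comp (by fun_prop)
  exact (continuous_const.sub (continuous_const.mul h2)).add h1

theorem log_hPoly {n : ℕ} {k l : Fin n} (hkl : l ≠ k) {z w : EuclideanSpace ℂ (Fin n)}
    (hz : z ∈ lieBall n) (hw : w ∈ lieBall n) :
    log (hPoly z w) = log (cayleyDen k z) + conj (log (cayleyDen k w)) +
      (log (cayleyT k l z w / 2) + log (cayleyY k l z w / 2)) := by
  have hn : 2 ≤ n := by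
    have h1 := k.2; have h2 := l.2
    have : (l : ℕ) ≠ k := fun h => hkl (Fin.ext h)
    omega
  set F : ℝ → ℂ := fun t => log (hPoly ((t : ℂ) • z) ((t : ℂ) • w)) -
    (log (cayleyDen k ((t : ℂ) • z)) + conj (log (cayleyDen k ((t : ℂ) • w))) +
      (log (cayleyT k l ((t : ℂ) • z) ((t : ℂ) • w) / 2)
        + log (cayleyY k l ((t : ℂ) • z) ((t : ℂ) • w) / 2))) with hFdef
  have hcS := continuousOn_cayleyS k hz
  have hcR := fun j => continuousOn_cayleyR k j hz
  have hcS' := continuousOn_cayleyS k hw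
  have hcR' := fun j => continuousOn_cayleyR k j hw
  have hconj : ∀ {f : ℝ → ℂ}, ContinuousOn f (Set.Icc 0 1) →
      ContinuousOn (fun t => conj (f t)) (Set.Icc 0 1) := fun hf =>
    Complex.continuous_conj.comp_continuousOn hf
  have hmz := fun t ht => smul_mem_lieBall_of_mem_Icc hz (t := t) ht
  have hmw := fun t ht => smul_mem_lieBall_of_mem_Icc hw (t := t) ht
  have hT0 : ∀ t ∈ Set.Icc (0 : ℝ) 1, 0 < (cayleyT k l ((t : ℂ) • z) ((t : ℂ) • w)).re :=
    fun t ht => cayleyT_re_pos hkl (hmz t ht) (hmw t ht)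
  have hY0 : ∀ t ∈ Set.Icc (0 : ℝ) 1, 0 < (cayleyY k l ((t : ℂ) • z) ((t : ℂ) • w)).re :=
    fun t ht => cayleyY_re_pos hkl (hmz t ht) (hmw t ht)
  have hcT : ContinuousOn (fun t : ℝ => cayleyT k l ((t : ℂ) • z) ((t : ℂ) • w)) (Set.Icc 0 1) :=
    (hcS.add (hcR l)).add (hconj (hcS'.add (hcR' l)))
  have hcY : ContinuousOn (fun t : ℝ => cayleyY k l ((t : ℂ) • z) ((t : ℂ) • w)) (Set.Icc 0 1) := by
    refine ((hcS.sub (hcR l)).add (hconj (hcS'.sub (hcR' l)))).sub ?_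
    refine continuousOn_finsetSum _ fun j _ => ?_
    refine (((hcR j).add (hconj (hcR' j))).pow 2).div hcT fun t ht h0 => ?_
    have := hT0 t ht
    change cayleyT k l _ _ = 0 at h0
    rw [h0] at this
    simp at this
  have hcD : ∀ v : EuclideanSpace ℂ (Fin n), Continuous fun t : ℝ => cayleyDen k ((t : ℂ) • v) := by
    intro v
    have := continuous_quadForm (n := n)
    unfold cayleyDen
    fun_prop
  have hhalf : ∀ y : ℂ, 0 < y.re → 0 < (y / 2).re := fun y hy => by
    have : (y / 2).re = y.re / 2 := by simp
    rw [this]; linarith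
  have hF : ContinuousOn F (Set.Icc 0 1) := by
    refine ContinuousOn.sub ?_ (ContinuousOn.add (ContinuousOn.add ?_ ?_) (ContinuousOn.add ?_ ?_))
    · refine ContinuousOn.clog ?_ fun t ht => hPoly_mem_slitPlane hn (hmz t ht) (hmw t ht)
      exact (continuous_hPoly.comp (by fun_prop : Continuous fun t : ℝ =>
        (((t : ℂ) • z, (t : ℂ) • w) : EuclideanSpace ℂ (Fin n) × EuclideanSpace ℂ (Fin n)))).continuousOn
    · exact (hcD z).continuousOn.clog fun t ht => cayleyDen_mem_slitPlane k (hmz t ht)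
    · exact hconj ((hcD w).continuousOn.clog fun t ht => cayleyDen_mem_slitPlane k (hmw t ht))
    · exact (hcT.div_const 2).clog fun t ht => mem_slitPlane_of_re_pos (hhalf _ (hT0 t ht))
    · exact (hcY.div_const 2).clog fun t ht => mem_slitPlane_of_re_pos (hhalf _ (hY0 t ht))
  have hexp : ∀ t ∈ Set.Icc (0 : ℝ) 1, cexp (F t) = 1 := by
    intro t ht
    have h1 := four_mul_hPoly' hkl (hmz t ht) (hmw t ht)
    have a1 := hPoly_ne_zero hn (hmz t ht) (hmw t ht)
    have a2 := cayleyDen_ne_zero k (hmz t ht)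
    have a3 := cayleyDen_ne_zero k (hmw t ht)
    have a4 := slitPlane_ne_zero (mem_slitPlane_of_re_pos (hhalf _ (hT0 t ht)))
    have a5 := slitPlane_ne_zero (mem_slitPlane_of_re_pos (hhalf _ (hY0 t ht)))
    rw [hFdef]
    simp only
    rw [Complex.exp_sub, Complex.exp_add, Complex.exp_add, Complex.exp_add, Complex.exp_conj,
      Complex.exp_log a1, Complex.exp_log a2, Complex.exp_log a3, Complex.exp_log a4,
      Complex.exp_log a5, div_eq_one_iff_eq (mul_ne_zero (mul_ne_zero a2 (by simpa using a3))
        (mul_ne_zero a4 a5))]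
    linear_combination h1 / 4
  have hF0 : F 0 = 0 := by
    simp [hFdef, hPoly, cayleyDen, cayleyT, cayleyY, cayleyS, cayleyR, quadForm]
  -- the imaginary part of `F` is a continuous function with values in `2πℤ`
  have hre : ∀ t ∈ Set.Icc (0 : ℝ) 1, (F t).re = 0 ∧ Real.cos ((F t).im) = 1 := by
    intro t ht
    have h1 := hexp t ht
    have h2 := congrArg norm h1
    rw [Complex.norm_exp, norm_one, Real.exp_eq_one_iff] at h2
    refine ⟨h2, ?_⟩
    have h3 := congrArg re h1
    rw [Complex.exp_re, h2] at h3
    simpa using h3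
  have him : (F 1).im = 0 := by
    by_contra hne
    have hc : ContinuousOn (fun t => |(F t).im|) (Set.Icc 0 1) :=
      (Complex.continuous_im.comp_continuousOn hF).abs
    have hpos : 0 < |(F 1).im| := abs_pos.2 hne
    obtain ⟨t, ht, hval⟩ := intermediate_value_Icc zero_le_one hc
      (show min (|(F 1).im|) Real.pi ∈ Set.Icc (|(F 0).im|) (|(F 1).im|) by
        rw [hF0]
        exact ⟨by simpa using Real.pi_pos.le, min_le_left _ _⟩)
    have h1 := (hre t ht).2
    rw [← Real.cos_abs] at h1
    simp only at hval
    rw [hval] at h1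
    have h2 : 0 < min (|(F 1).im|) Real.pi := lt_min hpos Real.pi_pos
    have h3 : min (|(F 1).im|) Real.pi ≤ Real.pi := min_le_right _ _
    have := (Real.cos_eq_one_iff_of_lt_of_lt (by linarith) (by linarith [Real.pi_pos])).1 h1
    linarith
  have hF1 : F 1 = 0 := Complex.ext (hre 1 (by simp)).1 him
  simpa [hFdef, sub_eq_zero] using hF1


/-- The kernel `K_ν(z,w) = h(z,w)^{-ν}` on `𝒟`, acting on `ℂ` by multiplication. The power is the
principal one, see `hPoly_mem_slitPlane`. -/
def lieBallKernel (n : ℕ) (ν : ℝ) : Matrix (lieBall n) (lieBall n) (ℂ →L[ℂ] ℂ) :=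
  Matrix.of fun z w => (hPoly (z : EuclideanSpace ℂ (Fin n)) w ^ (-(ν : ℂ))) •
    ContinuousLinearMap.id ℂ ℂ

section
open scoped ComplexOrder Matrix

theorem posSemidef_hadamard' {X : Type*} {f g : X → X → ℂ}
    (hf : (Matrix.of fun x y => f x y : Matrix X X ℂ).PosSemidef)
    (hg : (Matrix.of fun x y => g x y : Matrix X X ℂ).PosSemidef) :
    (Matrix.of fun x y => f x y * g x y : Matrix X X ℂ).PosSemidef :=
  Matrix.PosSemidef.hadamard hf hg

theorem posSemidef_hadamard_prod {X ι : Type*} (s : Finset ι) (M : ι → X → X → ℂ)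
    (h : ∀ i ∈ s, (Matrix.of (M i)).PosSemidef) :
    (Matrix.of fun x y => ∏ i ∈ s, M i x y : Matrix X X ℂ).PosSemidef := by
  classical
  induction s using Finset.induction_on with
  | empty => simpa using posSemidef_rankOne (fun _ : X => (1 : ℂ))
  | insert i s hi ih =>
    have := posSemidef_hadamard' (h i (by simp)) (ih fun j hj => h j (by simp [hj]))
    simpa only [Finset.prod_insert hi] using this

theorem posSemidef_hPoly_cpow {n : ℕ} (hn : 2 ≤ n) {ν : ℝ} (hν : ν ∈ wallachSet n) :
    (Matrix.of fun z w : lieBall n =>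
      hPoly (z : EuclideanSpace ℂ (Fin n)) w ^ (-(ν : ℂ))).PosSemidef := by
  have hn' : (2 : ℝ) ≤ n := by exact_mod_cast hn
  rcases eq_or_ne ν 0 with rfl | hν0
  · simpa using posSemidef_rankOne (fun _ : lieBall n => (1 : ℂ))
  have hge : ((n : ℝ) - 2) / 2 ≤ ν := by
    rcases hν with (h | h) | h
    · exact absurd h hν0
    · exact h.ge
    · exact le_of_lt h
  have hpos : 0 < ν := lt_of_le_of_ne (le_trans (by linarith) hge) hν0.symm
  set k : Fin n := ⟨0, by omega⟩ with hk
  set l : Fin n := ⟨1, hn⟩ with hl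
  have hkl : l ≠ k := by simp [hk, hl]
  have hTre : ∀ z w : lieBall n, 0 < (cayleyT k l (z : EuclideanSpace ℂ (Fin n)) w).re :=
    fun z w => cayleyT_re_pos hkl z.2 w.2
  have hYre : ∀ z w : lieBall n, 0 < (cayleyY k l (z : EuclideanSpace ℂ (Fin n)) w).re :=
    fun z w => cayleyY_re_pos hkl z.2 w.2
  have hTne : ∀ z w : lieBall n, cayleyT k l (z : EuclideanSpace ℂ (Fin n)) w ≠ 0 := fun z w =>
    slitPlane_ne_zero (mem_slitPlane_of_re_pos (hTre z w))
  -- the power of `T` that is left over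
  have h1 : (Matrix.of fun z w : lieBall n =>
      cayleyT k l (z : EuclideanSpace ℂ (Fin n)) w ^ (-((ν - ((n : ℝ) - 2) / 2 : ℝ) : ℂ))).PosSemidef := by
    rcases eq_or_lt_of_le hge with heq | hlt
    · rw [heq, sub_self]
      simpa using posSemidef_rankOne (fun _ : lieBall n => (1 : ℂ))
    · have := posSemidef_mul_cpow (fun _ _ : lieBall n => (1 : ℂ))
        (fun z w : lieBall n => cayleyT k l (z : EuclideanSpace ℂ (Fin n)) w) hTre ?_
        (sub_pos.2 hlt)
      · simpa using this
      · intro a _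
        convert posSemidef_rankOne (fun z : lieBall n =>
          cexp (-(a * (cayleyS k (z : EuclideanSpace ℂ (Fin n)) + cayleyR k l z)))) using 1
        ext z w
        simp only [Matrix.of_apply, one_mul, cayleyT]
        rw [← Complex.exp_conj, ← Complex.exp_add]
        congr 1
        simp only [map_add, map_mul, map_neg, conj_ofReal]
        ring
  have h2 : ∀ a : ℝ, 0 < a → (Matrix.of fun z w : lieBall n =>
      cayleyT k l (z : EuclideanSpace ℂ (Fin n)) w ^ (-(ν : ℂ)) *
        cexp (-(a * cayleyY k l (z : EuclideanSpace ℂ (Fin n)) w))).PosSemidef := by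
    intro a ha
    have g1 := posSemidef_hadamard_prod ((Finset.univ.erase k).erase l)
      (fun j (z w : lieBall n) => (cayleyT k l (z : EuclideanSpace ℂ (Fin n)) w) ^ (-(1 / 2 : ℂ)) *
        cexp (a * ((cayleyR k j (z : EuclideanSpace ℂ (Fin n)) + conj (cayleyR k j w)) ^ 2 /
          cayleyT k l (z : EuclideanSpace ℂ (Fin n)) w)))
      (fun j _ => posSemidef_gaussian
        (fun z : lieBall n => cayleyS k (z : EuclideanSpace ℂ (Fin n)) + cayleyR k l z)
        (fun z : lieBall n => cayleyR k j (z : EuclideanSpace ℂ (Fin n)))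
        (fun z => (cayley_re_pos hkl z.2).2) ha.le)
    have g2 := posSemidef_rankOne (fun z : lieBall n =>
      cexp (-(a * (cayleyS k (z : EuclideanSpace ℂ (Fin n)) - cayleyR k l z))))
    convert posSemidef_hadamard' (posSemidef_hadamard' h1 g1) g2 using 1
    ext z w
    simp only [Matrix.of_apply]
    have hcard : ((Finset.univ.erase k).erase l).card = n - 2 := by
      rw [Finset.card_erase_of_mem (by simp [hkl]), Finset.card_erase_of_mem (Finset.mem_univ k)]
      simp
      omega
    rw [Finset.prod_mul_distrib, Finset.prod_const, hcard, ← Complex.exp_sum, ← Complex.exp_conj]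
    have e1 : cayleyT k l (z : EuclideanSpace ℂ (Fin n)) w ^ (-(ν : ℂ))
        = cayleyT k l (z : EuclideanSpace ℂ (Fin n)) w ^ (-((ν - ((n : ℝ) - 2) / 2 : ℝ) : ℂ)) *
          (cayleyT k l (z : EuclideanSpace ℂ (Fin n)) w ^ (-(1 / 2 : ℂ))) ^ (n - 2) := by
      rw [← Complex.cpow_nat_mul, ← Complex.cpow_add _ _ (hTne z w)]
      congr 1
      rw [Nat.cast_sub hn]
      push_cast
      ring
    rw [e1, mul_assoc, mul_assoc, mul_assoc, ← Complex.exp_add, ← Complex.exp_add]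
    congr 3
    rw [cayleyY, ← Finset.mul_sum]
    simp only [map_add, map_mul, map_neg, map_sub, conj_ofReal, cayleyT]
    ring
  have h3 := posSemidef_mul_cpow _ _ hYre h2 hpos
  have h4 := posSemidef_rankOne (fun z : lieBall n =>
    cexp (-ν * log (cayleyDen k (z : EuclideanSpace ℂ (Fin n))) + ν * (Real.log 2 : ℝ)))
  convert posSemidef_hadamard' h3 h4 using 1
  ext z w
  have hhalf : ∀ y : ℂ, y ≠ 0 → log (y / 2) = log y - (Real.log 2 : ℝ) := fun y hy => by
    have := Complex.log_mul_ofReal (1 / 2) (by norm_num) y hy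
    rw [Real.log_div one_ne_zero two_ne_zero, Real.log_one] at this
    push_cast at this ⊢
    rw [div_eq_mul_one_div, this]
    ring
  have hYne := slitPlane_ne_zero (mem_slitPlane_of_re_pos (hYre z w))
  simp only [Matrix.of_apply]
  rw [Complex.cpow_def_of_ne_zero (hPoly_ne_zero hn z.2 w.2), log_hPoly hkl z.2 w.2,
    hhalf _ (hTne z w), hhalf _ hYne, Complex.cpow_def_of_ne_zero (hTne z w),
    Complex.cpow_def_of_ne_zero hYne, ← Complex.exp_conj, ← Complex.exp_add, ← Complex.exp_add,
    ← Complex.exp_add]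
  congr 1
  simp only [map_add, map_mul, map_neg, conj_ofReal]
  ring

theorem lieBallKernel_posSemidef {n : ℕ} (hn : 2 ≤ n) {ν : ℝ} (hν : ν ∈ wallachSet n) :
    (lieBallKernel n ν).PosSemidef := by
  have h := posSemidef_hPoly_cpow hn hν
  have hH : (lieBallKernel n ν).IsHermitian := by
    ext z w
    have h1 := h.isHermitian.apply z w
    simp only [Matrix.of_apply, RCLike.star_def] at h1
    have h2 : star (ContinuousLinearMap.id ℂ ℂ) = ContinuousLinearMap.id ℂ ℂ := star_one _
    simp [lieBallKernel, Matrix.conjTranspose_apply, ← h1, h2]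
  have T := (RKHS.posSemidef_tfae (K := lieBallKernel n ν)).out 0 2
  rw [T]
  refine ⟨hH, fun v => (Complex.nonneg_iff.1 (h.2 v)).1.trans (le_of_eq ?_)⟩
  refine congrArg Complex.re ?_
  refine Finset.sum_congr rfl fun z _ => Finset.sum_congr rfl fun w _ => ?_
  have h1 := h.isHermitian.apply z w
  simp only [Matrix.of_apply, RCLike.star_def] at h1
  simp only [Matrix.of_apply, lieBallKernel, ← h1]
  simp
  ring
end

end LieBall

noncomputable section Group
open Complex Matrix

/-- The Gram matrix of the form `(x|y) = x_1 y_1 + x_2 y_2 - x_3 y_3 - ⋯ - x_{n+2} y_{n+2}` on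
`ℝ^2 ⊕ ℝ^n`. -/
def formMatrix (n : ℕ) : Matrix (Fin 2 ⊕ Fin n) (Fin 2 ⊕ Fin n) ℝ := Matrix.fromBlocks 1 0 0 (-1)

/-- The group `SO(2,n)`. -/
def indefiniteSO (n : ℕ) : Subgroup (SpecialLinearGroup (Fin 2 ⊕ Fin n) ℝ) where
  carrier := {g | (g : Matrix _ _ ℝ)ᵀ * formMatrix n * (g : Matrix _ _ ℝ) = formMatrix n}
  one_mem' := by simp
  mul_mem' := by
    intro a b ha hb
    have ha : a.1ᵀ * formMatrix n * a.1 = formMatrix n := ha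
    have hb : b.1ᵀ * formMatrix n * b.1 = formMatrix n := hb
    change (a.1 * b.1)ᵀ * formMatrix n * (a.1 * b.1) = formMatrix n
    calc (a.1 * b.1)ᵀ * formMatrix n * (a.1 * b.1)
        = b.1ᵀ * (a.1ᵀ * formMatrix n * a.1) * b.1 := by
          simp only [transpose_mul, Matrix.mul_assoc]
      _ = _ := by rw [ha, hb]
  inv_mem' := by
    intro a ha
    have ha : a.1ᵀ * formMatrix n * a.1 = formMatrix n := ha
    change (a⁻¹).1ᵀ * formMatrix n * (a⁻¹).1 = formMatrix n
    have h1 : a.1 * (a⁻¹).1 = 1 := congrArg Subtype.val (mul_inv_cancel a)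
    have h2 := congrArg Matrix.transpose h1
    rw [transpose_mul, transpose_one] at h2
    calc (a⁻¹).1ᵀ * formMatrix n * (a⁻¹).1
        = (a⁻¹).1ᵀ * (a.1ᵀ * formMatrix n * a.1) * (a⁻¹).1 := by rw [ha]
      _ = ((a⁻¹).1ᵀ * a.1ᵀ) * formMatrix n * (a.1 * (a⁻¹).1) := by
        simp only [Matrix.mul_assoc]
      _ = formMatrix n := by rw [h1, h2, Matrix.one_mul, Matrix.mul_one]

/-- The matrix ball `M = {Z ∈ M_{n2}(ℝ) : Z^t Z < I_2}`. -/
def matrixBall (n : ℕ) : Set (Matrix (Fin n) (Fin 2) ℝ) := {Z | (1 - Zᵀ * Z).PosDef}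

/-- The fractional linear action `Z ↦ (C + D Z)(A + B Z)⁻¹` of a block matrix. -/
def moebius {n : ℕ} (g : Matrix (Fin 2 ⊕ Fin n) (Fin 2 ⊕ Fin n) ℝ) (Z : Matrix (Fin n) (Fin 2) ℝ) :
    Matrix (Fin n) (Fin 2) ℝ :=
  (g.toBlocks₂₁ + g.toBlocks₂₂ * Z) * (g.toBlocks₁₁ + g.toBlocks₁₂ * Z)⁻¹

theorem quad_eq {n : ℕ} (Z : Matrix (Fin n) (Fin 2) ℝ) (v : Fin 2 → ℝ) :
    v ⬝ᵥ ((1 - Zᵀ * Z) *ᵥ v) = v ⬝ᵥ v - (Z *ᵥ v) ⬝ᵥ (Z *ᵥ v) := by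
  rw [sub_mulVec, one_mulVec, dotProduct_sub, ← mulVec_mulVec, dotProduct_mulVec v Zᵀ,
    vecMul_transpose]

theorem mem_matrixBall_iff {n : ℕ} (Z : Matrix (Fin n) (Fin 2) ℝ) :
    Z ∈ matrixBall n ↔ ∀ v : Fin 2 → ℝ, v ≠ 0 → (Z *ᵥ v) ⬝ᵥ (Z *ᵥ v) < v ⬝ᵥ v := by
  constructor
  · intro h v hv
    have := Matrix.PosDef.dotProduct_mulVec_pos h hv
    rw [star_trivial, quad_eq] at this
    linarith
  · intro h
    refine Matrix.PosDef.of_dotProduct_mulVec_pos ?_ fun v hv => ?_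
    · rw [Matrix.IsHermitian, conjTranspose_eq_transpose_of_trivial]
      simp
    · rw [star_trivial, quad_eq]
      linarith [h v hv]

theorem mulVec_elim {n : ℕ} (g : Matrix (Fin 2 ⊕ Fin n) (Fin 2 ⊕ Fin n) ℝ)
    (Z : Matrix (Fin n) (Fin 2) ℝ) (v : Fin 2 → ℝ) :
    g *ᵥ (Sum.elim v (Z *ᵥ v)) = Sum.elim ((g.toBlocks₁₁ + g.toBlocks₁₂ * Z) *ᵥ v)
      ((g.toBlocks₂₁ + g.toBlocks₂₂ * Z) *ᵥ v) := by
  conv_lhs => rw [← fromBlocks_toBlocks g]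
  rw [fromBlocks_mulVec]
  simp [add_mulVec, mulVec_mulVec, Function.comp_def]

theorem form_elim {n : ℕ} (x : Fin 2 → ℝ) (y : Fin n → ℝ) :
    (Sum.elim x y) ⬝ᵥ (formMatrix n *ᵥ (Sum.elim x y)) = x ⬝ᵥ x - y ⬝ᵥ y := by
  rw [formMatrix, fromBlocks_mulVec]
  simp [Function.comp_def, neg_mulVec, sub_eq_add_neg]

theorem form_preserved {n : ℕ} {g : Matrix (Fin 2 ⊕ Fin n) (Fin 2 ⊕ Fin n) ℝ}
    (hg : gᵀ * formMatrix n * g = formMatrix n) (Z : Matrix (Fin n) (Fin 2) ℝ) (v : Fin 2 → ℝ) :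
    ((g.toBlocks₁₁ + g.toBlocks₁₂ * Z) *ᵥ v) ⬝ᵥ ((g.toBlocks₁₁ + g.toBlocks₁₂ * Z) *ᵥ v) -
      ((g.toBlocks₂₁ + g.toBlocks₂₂ * Z) *ᵥ v) ⬝ᵥ ((g.toBlocks₂₁ + g.toBlocks₂₂ * Z) *ᵥ v)
      = v ⬝ᵥ v - (Z *ᵥ v) ⬝ᵥ (Z *ᵥ v) := by
  rw [← form_elim, ← form_elim, ← mulVec_elim]
  conv_rhs => rw [← hg]
  rw [Matrix.mul_assoc, ← mulVec_mulVec, dotProduct_mulVec _ gᵀ, vecMul_transpose, mulVec_mulVec]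

theorem isUnit_moebius_den {n : ℕ} {g : Matrix (Fin 2 ⊕ Fin n) (Fin 2 ⊕ Fin n) ℝ}
    (hg : gᵀ * formMatrix n * g = formMatrix n) {Z : Matrix (Fin n) (Fin 2) ℝ}
    (hZ : Z ∈ matrixBall n) : IsUnit (g.toBlocks₁₁ + g.toBlocks₁₂ * Z) := by
  rw [← Matrix.mulVec_injective_iff_isUnit]
  refine (injective_iff_map_eq_zero (Matrix.mulVecLin (g.toBlocks₁₁ + g.toBlocks₁₂ * Z))).2 ?_
  intro v hv
  by_contra hne
  have h1 := form_preserved hg Z v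
  have h2 := (mem_matrixBall_iff Z).1 hZ v hne
  rw [mulVecLin_apply] at hv
  rw [hv, dotProduct_zero, zero_sub] at h1
  have h3 : 0 ≤ ((g.toBlocks₂₁ + g.toBlocks₂₂ * Z) *ᵥ v) ⬝ᵥ ((g.toBlocks₂₁ + g.toBlocks₂₂ * Z) *ᵥ v) :=
    Finset.sum_nonneg fun i _ => mul_self_nonneg _
  linarith

theorem moebius_mulVec {n : ℕ} {g : Matrix (Fin 2 ⊕ Fin n) (Fin 2 ⊕ Fin n) ℝ}
    (hg : gᵀ * formMatrix n * g = formMatrix n) {Z : Matrix (Fin n) (Fin 2) ℝ}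
    (hZ : Z ∈ matrixBall n) (w : Fin 2 → ℝ) :
    ∃ v, (g.toBlocks₁₁ + g.toBlocks₁₂ * Z) *ᵥ v = w ∧
      moebius g Z *ᵥ w = (g.toBlocks₂₁ + g.toBlocks₂₂ * Z) *ᵥ v := by
  refine ⟨(g.toBlocks₁₁ + g.toBlocks₁₂ * Z)⁻¹ *ᵥ w, ?_, ?_⟩
  · rw [mulVec_mulVec, Matrix.mul_nonsing_inv _
      ((Matrix.isUnit_iff_isUnit_det _).1 (isUnit_moebius_den hg hZ)), one_mulVec]
  · rw [mulVec_mulVec, moebius]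

theorem moebius_mem {n : ℕ} {g : Matrix (Fin 2 ⊕ Fin n) (Fin 2 ⊕ Fin n) ℝ}
    (hg : gᵀ * formMatrix n * g = formMatrix n) {Z : Matrix (Fin n) (Fin 2) ℝ}
    (hZ : Z ∈ matrixBall n) : moebius g Z ∈ matrixBall n := by
  rw [mem_matrixBall_iff]
  intro w hw
  obtain ⟨v, rfl, h⟩ := moebius_mulVec hg hZ w
  rw [h]
  have h1 := form_preserved hg Z v
  have h2 := (mem_matrixBall_iff Z).1 hZ v (fun h0 => hw (by rw [h0, mulVec_zero]))
  linarith

theorem moebius_mul {n : ℕ} (g : Matrix (Fin 2 ⊕ Fin n) (Fin 2 ⊕ Fin n) ℝ)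
    {g' : Matrix (Fin 2 ⊕ Fin n) (Fin 2 ⊕ Fin n) ℝ}
    (hg' : g'ᵀ * formMatrix n * g' = formMatrix n) {Z : Matrix (Fin n) (Fin 2) ℝ}
    (hZ : Z ∈ matrixBall n) : moebius (g * g') Z = moebius g (moebius g' Z) := by
  have hu := (Matrix.isUnit_iff_isUnit_det _).1 (isUnit_moebius_den hg' hZ)
  have e := fromBlocks_multiply g.toBlocks₁₁ g.toBlocks₁₂ g.toBlocks₂₁ g.toBlocks₂₂
    g'.toBlocks₁₁ g'.toBlocks₁₂ g'.toBlocks₂₁ g'.toBlocks₂₂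
  rw [fromBlocks_toBlocks, fromBlocks_toBlocks] at e
  rw [e]
  unfold moebius
  rw [toBlocks_fromBlocks₁₁, toBlocks_fromBlocks₁₂, toBlocks_fromBlocks₂₁, toBlocks_fromBlocks₂₂]
  generalize g'.toBlocks₁₁ = A' at *
  generalize g'.toBlocks₁₂ = B' at *
  generalize g'.toBlocks₂₁ = C' at *
  generalize g'.toBlocks₂₂ = D' at *
  generalize g.toBlocks₁₁ = A at *
  generalize g.toBlocks₁₂ = B at *
  generalize g.toBlocks₂₁ = C at *
  generalize g.toBlocks₂₂ = D at *
  have e1 : A * A' + B * C' + (A * B' + B * D') * Z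
      = (A + B * ((C' + D' * Z) * (A' + B' * Z)⁻¹)) * (A' + B' * Z) := by
    rw [Matrix.add_mul A, Matrix.mul_assoc B, Matrix.mul_assoc (C' + D' * Z),
      Matrix.nonsing_inv_mul _ hu, Matrix.mul_one]
    simp only [Matrix.mul_add, Matrix.add_mul, Matrix.mul_assoc]
    abel
  have e2 : C * A' + D * C' + (C * B' + D * D') * Z
      = (C + D * ((C' + D' * Z) * (A' + B' * Z)⁻¹)) * (A' + B' * Z) := by
    rw [Matrix.add_mul C, Matrix.mul_assoc D, Matrix.mul_assoc (C' + D' * Z),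
      Matrix.nonsing_inv_mul _ hu, Matrix.mul_one]
    simp only [Matrix.mul_add, Matrix.add_mul, Matrix.mul_assoc]
    abel
  rw [e1, e2, Matrix.mul_inv_rev, Matrix.mul_assoc, ← Matrix.mul_assoc (A' + B' * Z),
    Matrix.mul_nonsing_inv _ hu, Matrix.one_mul]

theorem moebius_one {n : ℕ} (Z : Matrix (Fin n) (Fin 2) ℝ) : moebius 1 Z = Z := by
  have e : (1 : Matrix (Fin 2 ⊕ Fin n) (Fin 2 ⊕ Fin n) ℝ) = fromBlocks 1 0 0 1 :=
    fromBlocks_one.symm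
  rw [moebius, e, toBlocks_fromBlocks₁₁, toBlocks_fromBlocks₁₂, toBlocks_fromBlocks₂₁,
    toBlocks_fromBlocks₂₂]
  simp

instance matrixBallAction (n : ℕ) : MulAction (indefiniteSO n) (matrixBall n) where
  smul g Z := ⟨moebius g.1.1 Z, moebius_mem g.2 Z.2⟩
  one_smul _ := Subtype.ext (moebius_one _)
  mul_smul _ g' Z := Subtype.ext (moebius_mul _ g'.2 Z.2)

/-- The Hua transform
`z ↦ Z = 2 ( [[zz^t+1, i(zz^t-1)], [conj(zz^t)+1, -i(conj(zz^t)-1)]]⁻¹ [z; conj z] )^t`.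
The entries of `Z` are real, see `hua_spec`, and are therefore read off by their real parts. -/
def hua {n : ℕ} (z : EuclideanSpace ℂ (Fin n)) : Matrix (Fin n) (Fin 2) ℝ :=
  ((2 : ℂ) • ((!![quadForm z + 1, I * (quadForm z - 1);
      conj (quadForm z) + 1, -I * (conj (quadForm z) - 1)])⁻¹ *
    (Matrix.of ![fun i => z i, fun i => conj (z i)] : Matrix (Fin 2) (Fin n) ℂ)))ᵀ.map re

theorem hua_complex {n : ℕ} {z : EuclideanSpace ℂ (Fin n)} (hz : z ∈ lieBall n) :
    ((2 : ℂ) • ((!![quadForm z + 1, I * (quadForm z - 1);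
      conj (quadForm z) + 1, -I * (conj (quadForm z) - 1)])⁻¹ *
    (Matrix.of ![fun i => z i, fun i => conj (z i)] : Matrix (Fin 2) (Fin n) ℂ)))ᵀ
    = Matrix.of fun k j => ((![2 * ((1 - conj (quadForm z)) * z k).re / (1 - ‖quadForm z‖ ^ 2),
        -2 * ((1 + conj (quadForm z)) * z k).im / (1 - ‖quadForm z‖ ^ 2)] j : ℝ) : ℂ) := by
  have hq := norm_quadForm_lt_one hz
  have hq0 := norm_nonneg (quadForm z)
  have hn : (1 - ‖quadForm z‖ ^ 2 : ℝ) ≠ 0 := by nlinarith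
  have hnC : ((1 - ‖quadForm z‖ ^ 2 : ℝ) : ℂ) ≠ 0 := by exact_mod_cast hn
  have hqq : quadForm z * conj (quadForm z) = 1 - ((1 - ‖quadForm z‖ ^ 2 : ℝ) : ℂ) := by
    rw [Complex.mul_conj']; push_cast; ring
  have hre : ∀ w : ℂ, ((w.re : ℝ) : ℂ) = (w + conj w) / 2 := fun w => by
    rw [Complex.add_conj]; push_cast; ring
  have him : ∀ w : ℂ, ((w.im : ℝ) : ℂ) = -I * (w - conj w) / 2 := fun w => by
    rw [Complex.sub_conj]; push_cast; linear_combination (w.im : ℂ) * I_sq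
  generalize (1 - ‖quadForm z‖ ^ 2 : ℝ) = N at *
  have hdet : (!![quadForm z + 1, I * (quadForm z - 1);
      conj (quadForm z) + 1, -I * (conj (quadForm z) - 1)] : Matrix (Fin 2) (Fin 2) ℂ).det
      = 2 * I * N := by
    rw [Matrix.det_fin_two_of]
    linear_combination (-2 * I) * hqq
  ext k j
  rw [Matrix.inv_def, hdet, Matrix.adjugate_fin_two_of, Ring.inverse_eq_inv']
  fin_cases j
  · simp [hre, him]
    field_simp
    ring_nf
    simp only [I_sq]
    ring
  · simp [hre, him]
    field_simp
    ring

theorem hua_zero {n : ℕ} {z : EuclideanSpace ℂ (Fin n)} (hz : z ∈ lieBall n) (k : Fin n) :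
    hua z k 0 = 2 * ((1 - conj (quadForm z)) * z k).re / (1 - ‖quadForm z‖ ^ 2) := by
  rw [hua, hua_complex hz]
  simp only [Matrix.map_apply, Matrix.of_apply, ofReal_re, cons_val_zero]

theorem hua_one {n : ℕ} {z : EuclideanSpace ℂ (Fin n)} (hz : z ∈ lieBall n) (k : Fin n) :
    hua z k 1 = -2 * ((1 + conj (quadForm z)) * z k).im / (1 - ‖quadForm z‖ ^ 2) := by
  rw [hua, hua_complex hz]
  simp only [Matrix.map_apply, Matrix.of_apply, ofReal_re, cons_val_one, cons_val_zero]

theorem hua_spec {n : ℕ} {z : EuclideanSpace ℂ (Fin n)} (hz : z ∈ lieBall n) (k : Fin n) :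
    z k = (1 + quadForm z) / 2 * hua z k 0 + I * (quadForm z - 1) / 2 * hua z k 1 := by
  have hq := norm_quadForm_lt_one hz
  have hq0 := norm_nonneg (quadForm z)
  have hn : (1 - ‖quadForm z‖ ^ 2 : ℝ) ≠ 0 := by nlinarith
  rw [hua_zero hz, hua_one hz]
  have hqq : ‖quadForm z‖ ^ 2 = (quadForm z).re * (quadForm z).re
      + (quadForm z).im * (quadForm z).im := by
    rw [Complex.sq_norm, normSq_apply]
  have e : ∀ a b : ℝ, (1 + quadForm z) / 2 * ((2 * a / (1 - ‖quadForm z‖ ^ 2) : ℝ) : ℂ)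
      + I * (quadForm z - 1) / 2 * ((-2 * b / (1 - ‖quadForm z‖ ^ 2) : ℝ) : ℂ)
      = ((1 + quadForm z) * a - I * (quadForm z - 1) * b) / ((1 - ‖quadForm z‖ ^ 2 : ℝ) : ℂ) := by
    intro a b
    push_cast
    ring
  rw [e, eq_div_iff (Complex.ofReal_ne_zero.2 hn)]
  rw [hqq]
  generalize quadForm z = q
  generalize z k = w
  apply Complex.ext
  · simp
    ring
  · simp
    ring

theorem hua_unique {n : ℕ} {z : EuclideanSpace ℂ (Fin n)} (hz : z ∈ lieBall n)
    {Z : Matrix (Fin n) (Fin 2) ℝ}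
    (h : ∀ k, z k = (1 + quadForm z) / 2 * Z k 0 + I * (quadForm z - 1) / 2 * Z k 1) :
    hua z = Z := by
  have hq := norm_quadForm_lt_one hz
  have hq0 := norm_nonneg (quadForm z)
  have hn : (1 - ‖quadForm z‖ ^ 2 : ℝ) ≠ 0 := by nlinarith
  rw [Complex.sq_norm, normSq_apply] at hn
  have key : ∀ k, hua z k 0 = Z k 0 ∧ hua z k 1 = Z k 1 := by
    intro k
    have h1 := (hua_spec hz k).symm.trans (h k)
    have hr := congrArg re h1
    have hi := congrArg im h1
    simp at hr hi
    generalize (quadForm z).re = a at *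
    generalize (quadForm z).im = b at *
    constructor
    · apply mul_left_cancel₀ hn
      linear_combination -2 * (a - 1) * hr - 2 * b * hi
    · apply mul_left_cancel₀ hn
      linear_combination -2 * (1 + a) * hi + 2 * b * hr
  ext k j
  fin_cases j
  · exact (key k).1
  · exact (key k).2

/-- `z = Z a` with `a = a(q)` splits into real and imaginary part. -/
theorem sum_sq_lin {n : ℕ} (Z : Matrix (Fin n) (Fin 2) ℝ) (a b : ℂ) :
    ∑ k, (a * Z k 0 + b * Z k 1) ^ 2 = a ^ 2 * ((∑ k, Z k 0 ^ 2 : ℝ) : ℂ)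
      + 2 * a * b * ((∑ k, Z k 0 * Z k 1 : ℝ) : ℂ) + b ^ 2 * ((∑ k, Z k 1 ^ 2 : ℝ) : ℂ) := by
  push_cast
  rw [Finset.mul_sum, Finset.mul_sum, Finset.mul_sum, ← Finset.sum_add_distrib,
    ← Finset.sum_add_distrib]
  exact Finset.sum_congr rfl fun k _ => by ring

theorem sum_norm_lin {n : ℕ} (Z : Matrix (Fin n) (Fin 2) ℝ) (a b : ℂ) :
    ∑ k, ‖a * Z k 0 + b * Z k 1‖ ^ 2
      = (Z *ᵥ ![a.re, b.re]) ⬝ᵥ (Z *ᵥ ![a.re, b.re]) + (Z *ᵥ ![a.im, b.im]) ⬝ᵥ (Z *ᵥ ![a.im, b.im]) := by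
  simp only [dotProduct, mulVec, Fin.sum_univ_two]
  rw [← Finset.sum_add_distrib]
  refine Finset.sum_congr rfl fun k _ => ?_
  rw [Complex.sq_norm, normSq_apply]
  simp
  ring

/-- The quadratic equation satisfied by `q(z)` in terms of `Z`. -/
def huaC {n : ℕ} (Z : Matrix (Fin n) (Fin 2) ℝ) : ℂ :=
  (((1 - ∑ k, Z k 0 ^ 2) - (1 - ∑ k, Z k 1 ^ 2) : ℝ) : ℂ) / 4 - I * ((∑ k, Z k 0 * Z k 1 : ℝ) : ℂ) / 2

def huaT {n : ℕ} (Z : Matrix (Fin n) (Fin 2) ℝ) : ℝ :=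
  ((1 - ∑ k, Z k 0 ^ 2) + (1 - ∑ k, Z k 1 ^ 2)) / 2

theorem huaQuadratic_iff {n : ℕ} (Z : Matrix (Fin n) (Fin 2) ℝ) (q : ℂ) :
    huaC Z * q ^ 2 + huaT Z * q + conj (huaC Z) = 0 ↔
      ∑ k, ((1 + q) / 2 * Z k 0 + I * (q - 1) / 2 * Z k 1) ^ 2 = q := by
  have hc : conj (huaC Z) = (((1 - ∑ k, Z k 0 ^ 2) - (1 - ∑ k, Z k 1 ^ 2) : ℝ) : ℂ) / 4
      + I * ((∑ k, Z k 0 * Z k 1 : ℝ) : ℂ) / 2 := by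
    simp only [huaC, map_sub, map_div₀, map_mul, conj_ofReal, conj_I, map_ofNat]
    ring
  rw [sum_sq_lin, hc, huaC, huaT]
  generalize ∑ k, Z k 0 ^ 2 = X
  generalize ∑ k, Z k 1 ^ 2 = Y
  generalize ∑ k, Z k 0 * Z k 1 = P
  push_cast
  have e2 : I ^ 2 = -1 := I_sq
  constructor
  · intro h
    linear_combination -h + (q - 1) ^ 2 / 4 * Y * e2
  · intro h
    linear_combination -h + (q - 1) ^ 2 / 4 * Y * e2

theorem huaT_pos {n : ℕ} {Z : Matrix (Fin n) (Fin 2) ℝ} (hZ : Z ∈ matrixBall n) :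
    0 < 1 - ∑ k, Z k 0 ^ 2 ∧ 0 < 1 - ∑ k, Z k 1 ^ 2 ∧
      (∑ k, Z k 0 * Z k 1) ^ 2 < (1 - ∑ k, Z k 0 ^ 2) * (1 - ∑ k, Z k 1 ^ 2) := by
  have h := (mem_matrixBall_iff Z).1 hZ
  have key : ∀ a b : ℝ, (Z *ᵥ ![a, b]) ⬝ᵥ (Z *ᵥ ![a, b]) = a ^ 2 * (∑ k, Z k 0 ^ 2)
      + 2 * a * b * (∑ k, Z k 0 * Z k 1) + b ^ 2 * (∑ k, Z k 1 ^ 2) := by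
    intro a b
    rw [Finset.mul_sum, Finset.mul_sum, Finset.mul_sum, ← Finset.sum_add_distrib,
      ← Finset.sum_add_distrib]
    refine Finset.sum_congr rfl fun k _ => ?_
    simp [mulVec, dotProduct, Fin.sum_univ_two]
    ring
  have key2 : ∀ a b : ℝ, (![a, b] : Fin 2 → ℝ) ⬝ᵥ ![a, b] = a ^ 2 + b ^ 2 := by
    intro a b
    simp [dotProduct, Fin.sum_univ_two]
    ring
  have h0 := h ![1, 0] (by intro h; simpa using congrFun h 0)
  have h1 := h ![0, 1] (by intro h; simpa using congrFun h 1)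
  rw [key, key2] at h0 h1
  generalize ∑ k, Z k 0 ^ 2 = X at *
  generalize ∑ k, Z k 1 ^ 2 = Y at *
  generalize ∑ k, Z k 0 * Z k 1 = P at *
  have hX : 0 < 1 - X := by linarith
  have hY : 0 < 1 - Y := by linarith
  refine ⟨hX, hY, ?_⟩
  have h2 := h ![1 - Y, P] (by intro h; have := congrFun h 0; simp at this; linarith)
  rw [key, key2] at h2
  have : 0 < (1 - Y) * ((1 - X) * (1 - Y) - P ^ 2) := by nlinarith
  have := (pos_iff_pos_of_mul_pos this).1 hY
  linarith

theorem two_norm_huaC_lt {n : ℕ} {Z : Matrix (Fin n) (Fin 2) ℝ} (hZ : Z ∈ matrixBall n) :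
    4 * ‖huaC Z‖ ^ 2 < huaT Z ^ 2 ∧ 0 < huaT Z := by
  obtain ⟨h1, h2, h3⟩ := huaT_pos hZ
  have : ‖huaC Z‖ ^ 2 = (((1 - ∑ k, Z k 0 ^ 2) - (1 - ∑ k, Z k 1 ^ 2)) / 4) ^ 2
      + ((∑ k, Z k 0 * Z k 1) / 2) ^ 2 := by
    rw [Complex.sq_norm, normSq_apply, huaC]
    generalize ∑ k, Z k 0 ^ 2 = X
    generalize ∑ k, Z k 1 ^ 2 = Y
    generalize ∑ k, Z k 0 * Z k 1 = P
    simp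
    ring
  rw [this, huaT]
  constructor
  · nlinarith
  · linarith

theorem hua_root_unique {n : ℕ} {Z : Matrix (Fin n) (Fin 2) ℝ} (hZ : Z ∈ matrixBall n) {q q' : ℂ}
    (hq : ‖q‖ < 1) (hq' : ‖q'‖ < 1) (h : huaC Z * q ^ 2 + huaT Z * q + conj (huaC Z) = 0)
    (h' : huaC Z * q' ^ 2 + huaT Z * q' + conj (huaC Z) = 0) : q = q' := by
  by_contra hne
  have hsub : q - q' ≠ 0 := sub_ne_zero.2 hne
  have h1 : huaC Z * (q + q') + huaT Z = 0 := by
    apply mul_left_cancel₀ hsub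
    linear_combination h - h'
  have h2 : conj (huaC Z) = huaC Z * (q * q') := by
    linear_combination h - q * h1
  have h3 := congrArg norm h2
  rw [norm_mul, norm_mul, Complex.norm_conj] at h3
  have hq0 := norm_nonneg q
  have hq0' := norm_nonneg q'
  have h4 : ‖q‖ * ‖q'‖ < 1 := by nlinarith
  have h5 : ‖huaC Z‖ = 0 := by nlinarith [norm_nonneg (huaC Z)]
  rw [norm_eq_zero] at h5
  rw [h5, zero_mul, zero_add] at h1
  have := (two_norm_huaC_lt hZ).2
  norm_cast at h1
  linarith

theorem exists_hua_root {n : ℕ} {Z : Matrix (Fin n) (Fin 2) ℝ} (hZ : Z ∈ matrixBall n) :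
    ∃ q : ℂ, ‖q‖ < 1 ∧ huaC Z * q ^ 2 + huaT Z * q + conj (huaC Z) = 0 := by
  obtain ⟨h1, h2⟩ := two_norm_huaC_lt hZ
  set c := huaC Z
  set t := huaT Z
  set s := √(t ^ 2 - 4 * ‖c‖ ^ 2)
  have hs : s ^ 2 = t ^ 2 - 4 * ‖c‖ ^ 2 := Real.sq_sqrt (by linarith)
  have hs0 : 0 < s := Real.sqrt_pos.2 (by linarith)
  have hr : 0 < t + s := by linarith
  have hcc : (c : ℂ) * conj c = ((t ^ 2 - s ^ 2 : ℝ) : ℂ) / 4 := by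
    rw [Complex.mul_conj', hs]; push_cast; ring
  have hrC : (t : ℂ) + s ≠ 0 := by exact_mod_cast hr.ne'
  refine ⟨-2 * conj c / (t + s), ?_, ?_⟩
  · have : ‖(t : ℂ) + s‖ = t + s := by
      rw [← ofReal_add, norm_real, Real.norm_of_nonneg hr.le]
    rw [norm_div, norm_mul, Complex.norm_conj, this, div_lt_one hr]
    simp
    have := norm_nonneg c
    nlinarith
  · field_simp
    push_cast at hcc
    linear_combination 4 * conj c * hcc

theorem hua_mem {n : ℕ} {z : EuclideanSpace ℂ (Fin n)} (hz : z ∈ lieBall n) :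
    hua z ∈ matrixBall n := by
  rw [mem_matrixBall_iff]
  intro v hv
  have hspec := hua_spec hz
  have hq := norm_quadForm_lt_one hz
  have hq0 := norm_nonneg (quadForm z)
  have hpos := hz.1
  have hqdef : ∑ k, z k ^ 2 = quadForm z := rfl
  have hqq : ‖quadForm z‖ ^ 2 = (quadForm z).re * (quadForm z).re
      + (quadForm z).im * (quadForm z).im := by
    rw [Complex.sq_norm, normSq_apply]
  rw [EuclideanSpace.norm_sq_eq] at hpos
  generalize hua z = Z at *
  generalize quadForm z = q at *
  set a : ℂ := (1 + q) / 2 with ha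
  set b : ℂ := I * (q - 1) / 2 with hb
  have hab : a ^ 2 + b ^ 2 = q := by
    rw [ha, hb]; linear_combination ((q - 1) ^ 2 / 4) * I_sq
  have hab2 : 2 * (‖a‖ ^ 2 + ‖b‖ ^ 2) = 1 + ‖q‖ ^ 2 := by
    rw [hqq, Complex.sq_norm, Complex.sq_norm, normSq_apply, normSq_apply, ha, hb]
    simp
    ring
  have hD : a * conj b - conj a * b = I * (((1 - ‖q‖ ^ 2) / 2 : ℝ) : ℂ) := by
    have hcq : q * conj q = ((‖q‖ ^ 2 : ℝ) : ℂ) := by rw [Complex.mul_conj']; push_cast; ring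
    rw [ha, hb]
    simp only [map_div₀, map_add, map_mul, map_sub, map_one, conj_I, map_ofNat]
    push_cast at hcq ⊢
    linear_combination (-I / 2) * hcq
  have hspec : ∀ k, z k = a * Z k 0 + b * Z k 1 := hspec
  clear_value a b
  have hD0 : a * conj b - conj a * b ≠ 0 := by
    rw [hD]
    refine mul_ne_zero I_ne_zero (Complex.ofReal_ne_zero.2 ?_)
    nlinarith
  have hD0' : conj a * b - a * conj b ≠ 0 := fun h => hD0 (by linear_combination -h)
  set α : ℂ := (v 0 * conj b - v 1 * conj a) / (a * conj b - conj a * b) with hα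
  have hαc : conj α = (v 0 * b - v 1 * a) / (conj a * b - a * conj b) := by
    rw [hα]
    simp only [map_div₀, map_sub, map_mul, conj_ofReal, conj_conj]
  have hv0 : v 0 = 2 * (α * a).re := by
    have : ((v 0 : ℝ) : ℂ) = ((2 * (α * a).re : ℝ) : ℂ) := by
      rw [← Complex.add_conj, map_mul, hαc, hα]
      have e : conj a * b - a * conj b = -(a * conj b - conj a * b) := by ring
      rw [e, div_neg, neg_mul, div_mul_eq_mul_div, div_mul_eq_mul_div, ← sub_eq_add_neg, ← sub_div,
        eq_div_iff hD0]
      ring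
    exact_mod_cast this
  have hv1 : v 1 = 2 * (α * b).re := by
    have : ((v 1 : ℝ) : ℂ) = ((2 * (α * b).re : ℝ) : ℂ) := by
      rw [← Complex.add_conj, map_mul, hαc, hα]
      have e : conj a * b - a * conj b = -(a * conj b - conj a * b) := by ring
      rw [e, div_neg, neg_mul, div_mul_eq_mul_div, div_mul_eq_mul_div, ← sub_eq_add_neg, ← sub_div,
        eq_div_iff hD0]
      ring
    exact_mod_cast this
  have hα0 : 0 < ‖α‖ ^ 2 := by
    have : α ≠ 0 := fun h0 => hv (by
      ext j
      fin_cases j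
      · simpa [h0] using hv0
      · simpa [h0] using hv1)
    positivity
  have hre2 : ∀ x : ℂ, (2 * x.re) * (2 * x.re) = 2 * ‖x‖ ^ 2 + 2 * (x ^ 2).re := by
    intro x
    rw [Complex.sq_norm, normSq_apply, sq x, mul_re]
    ring
  have h1 : v ⬝ᵥ v = ‖α‖ ^ 2 * (1 + ‖q‖ ^ 2) + 2 * (α ^ 2 * q).re := by
    rw [← hab2, ← hab]
    simp only [dotProduct, Fin.sum_univ_two]
    rw [hv0, hv1, hre2, hre2, mul_add (α ^ 2), add_re, norm_mul, norm_mul, mul_pow, mul_pow,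
      mul_pow, mul_pow]
    ring
  have hZv : ∀ k, (Z *ᵥ v) k = 2 * (α * z k).re := by
    intro k
    have : α * z k = (α * a) * (Z k 0 : ℝ) + (α * b) * (Z k 1 : ℝ) := by
      rw [hspec k]; ring
    rw [this, add_re, re_mul_ofReal, re_mul_ofReal]
    simp only [mulVec, dotProduct, Fin.sum_univ_two]
    rw [hv0, hv1]
    ring
  have h2 : (Z *ᵥ v) ⬝ᵥ (Z *ᵥ v) = 2 * ‖α‖ ^ 2 * (∑ k, ‖z k‖ ^ 2) + 2 * (α ^ 2 * q).re := by
    rw [← hqdef, Finset.mul_sum, Finset.mul_sum, re_sum, Finset.mul_sum, ← Finset.sum_add_distrib]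
    refine Finset.sum_congr rfl fun k _ => ?_
    rw [hZv k, hre2, norm_mul, mul_pow, mul_pow]
    ring
  rw [h1, h2]
  nlinarith

theorem hua_injOn {n : ℕ} : Set.InjOn (hua (n := n)) (lieBall n) := by
  intro z hz w hw h
  have hroot : ∀ {y : EuclideanSpace ℂ (Fin n)}, y ∈ lieBall n →
      huaC (hua y) * quadForm y ^ 2 + huaT (hua y) * quadForm y + conj (huaC (hua y)) = 0 := by
    intro y hy
    rw [huaQuadratic_iff]
    exact Finset.sum_congr rfl fun k _ => by rw [← hua_spec hy k]
  have hq : quadForm z = quadForm w :=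
    hua_root_unique (hua_mem hz) (norm_quadForm_lt_one hz) (norm_quadForm_lt_one hw) (hroot hz)
      (by rw [h]; exact hroot hw)
  ext k
  refine (hua_spec hz k).trans ((?_ : _ = _).trans (hua_spec hw k).symm)
  rw [h, hq]

theorem exists_hua_eq {n : ℕ} {Z : Matrix (Fin n) (Fin 2) ℝ} (hZ : Z ∈ matrixBall n) :
    ∃ z ∈ lieBall n, hua z = Z := by
  obtain ⟨q, hq, hroot⟩ := exists_hua_root hZ
  rw [huaQuadratic_iff] at hroot
  set z : EuclideanSpace ℂ (Fin n) :=
    WithLp.toLp 2 fun k => (1 + q) / 2 * Z k 0 + I * (q - 1) / 2 * Z k 1 with hz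
  have hzq : quadForm z = q := hroot
  have hnorm : 2 * ‖z‖ ^ 2 < 1 + ‖q‖ ^ 2 := by
    have h1 := (mem_matrixBall_iff Z).1 hZ
    have h2 : ‖z‖ ^ 2 = _ := (EuclideanSpace.norm_sq_eq z).trans
      (sum_norm_lin Z ((1 + q) / 2) (I * (q - 1) / 2))
    have hle : ∀ v : Fin 2 → ℝ, (Z *ᵥ v) ⬝ᵥ (Z *ᵥ v) ≤ v ⬝ᵥ v := fun v => by
      by_cases hv : v = 0
      · simp [hv]
      · exact (h1 v hv).le
    have hu := h1 ![((1 + q) / 2).re, (I * (q - 1) / 2).re] ?_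
    · have hv := hle ![((1 + q) / 2).im, (I * (q - 1) / 2).im]
      rw [h2]
      have hqq : ‖q‖ ^ 2 = q.re * q.re + q.im * q.im := by
        rw [Complex.sq_norm, normSq_apply]
      rw [hqq]
      simp [dotProduct, Fin.sum_univ_two] at hu hv ⊢
      nlinarith
    · intro h0
      have := congrFun h0 0
      simp at this
      have h3 := Complex.abs_re_le_norm q
      rw [abs_le] at h3
      linarith [h3.1]
  have hz0 := norm_nonneg z
  have hq0 := norm_nonneg q
  have hmem : z ∈ lieBall n := by
    refine ⟨?_, ?_⟩
    · rw [hzq]; linarith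
    · nlinarith
  refine ⟨z, hmem, hua_unique hmem fun k => ?_⟩
  rw [hzq]

/-- The Hua transform as a bijection of `𝒟` onto `M`. -/
def huaEquiv (n : ℕ) : lieBall n ≃ matrixBall n :=
  Equiv.ofBijective (fun z => ⟨hua z, hua_mem z.2⟩)
    ⟨fun z w h => Subtype.ext (hua_injOn z.2 w.2 (congrArg Subtype.val h)), fun Z => by
      obtain ⟨z, hz, h⟩ := exists_hua_eq Z.2
      exact ⟨⟨z, hz⟩, Subtype.ext h⟩⟩

/-- The action of `SO(2,n)` on `𝒟`, transported from `M` by the Hua transform. -/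
instance lieBallAction (n : ℕ) : MulAction (indefiniteSO n) (lieBall n) where
  smul g z := (huaEquiv n).symm (g • huaEquiv n z)
  one_smul z := by
    change (huaEquiv n).symm ((1 : indefiniteSO n) • huaEquiv n z) = z
    rw [one_smul, Equiv.symm_apply_apply]
  mul_smul g g' z := by
    change (huaEquiv n).symm ((g * g') • huaEquiv n z)
      = (huaEquiv n).symm (g • huaEquiv n ((huaEquiv n).symm (g' • huaEquiv n z)))
    rw [Equiv.apply_symm_apply, mul_smul]

theorem huaEquiv_smul {n : ℕ} (g : indefiniteSO n) (z : lieBall n) :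
    huaEquiv n (g • z) = g • huaEquiv n z :=
  (huaEquiv n).apply_symm_apply _

/-- The real part `𝒳 = 𝒟 ∩ ℝ^n` of the Lie ball. -/
def lieBallReal (n : ℕ) : Set (lieBall n) := {z | ∀ i, ((z : EuclideanSpace ℂ (Fin n)) i).im = 0}

theorem mem_lieBallReal_iff {n : ℕ} (z : lieBall n) :
    z ∈ lieBallReal n ↔ ∀ k, (huaEquiv n z : Matrix (Fin n) (Fin 2) ℝ) k 1 = 0 := by
  change _ ↔ ∀ k, hua (z : EuclideanSpace ℂ (Fin n)) k 1 = 0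
  constructor
  · intro h k
    have hq : (quadForm (z : EuclideanSpace ℂ (Fin n))).im = 0 := by
      rw [quadForm, im_sum]
      refine Finset.sum_eq_zero fun i _ => ?_
      rw [sq, mul_im, h i]
      ring
    rw [hua_one z.2, mul_im]
    simp [hq, h k]
  · intro h
    set Z := hua (z : EuclideanSpace ℂ (Fin n)) with hZ
    have hroot : huaC Z * quadForm (z : EuclideanSpace ℂ (Fin n)) ^ 2
        + huaT Z * quadForm (z : EuclideanSpace ℂ (Fin n)) + conj (huaC Z) = 0 := by
      rw [huaQuadratic_iff]
      exact Finset.sum_congr rfl fun k _ => by rw [← hua_spec z.2 k]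
    have hc : conj (huaC Z) = huaC Z := by
      simp [huaC, h, map_ofNat]
    have hroot' := congrArg conj hroot
    simp only [map_add, map_mul, map_pow, hc, conj_ofReal, map_zero] at hroot'
    rw [← hc] at hroot'
    have hq := hua_root_unique (hua_mem z.2) (norm_quadForm_lt_one z.2)
      (by rw [Complex.norm_conj]; exact norm_quadForm_lt_one z.2) hroot
      (by rw [hc] at hroot' ⊢; exact hroot')
    have hq' : (quadForm (z : EuclideanSpace ℂ (Fin n))).im = 0 :=
      Complex.conj_eq_iff_im.1 hq.symm
    intro k
    rw [hua_spec z.2 k, ← hZ, h k]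
    simp [hq']

/-- If `g` maps `𝒳` into itself, then so does `g⁻¹`. -/
theorem inv_preserves_lieBallReal {n : ℕ} {g : indefiniteSO n}
    (hg : ∀ x ∈ lieBallReal n, g • x ∈ lieBallReal n) : ∀ x ∈ lieBallReal n, g⁻¹ • x ∈ lieBallReal n := by
  rcases Nat.eq_zero_or_pos n with rfl | hn
  · intro x _ i
    exact i.elim0
  -- the common isotropic direction `e_2`
  set E : Fin 2 ⊕ Fin n → ℝ := Sum.elim ![0, 1] 0 with hE
  have hinv : g⁻¹.1.1 * g.1.1 = 1 := congrArg (fun a : indefiniteSO n => a.1.1) (inv_mul_cancel g)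
  have step : ∀ Z : matrixBall n, (∀ k, Z.1 k 1 = 0) →
      ∃ u : Fin 2 → ℝ, Sum.elim u (Z.1 *ᵥ u) = g⁻¹.1.1 *ᵥ E := by
    intro Z hZ
    have h1 : (huaEquiv n).symm Z ∈ lieBallReal n := by
      rw [mem_lieBallReal_iff, Equiv.apply_symm_apply]; exact hZ
    have h2 := (mem_lieBallReal_iff _).1 (hg _ h1)
    rw [huaEquiv_smul, Equiv.apply_symm_apply] at h2
    obtain ⟨u, hu1, hu2⟩ := moebius_mulVec g.2 Z.2 ![0, 1]
    refine ⟨u, ?_⟩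
    have h3 : moebius g.1.1 Z.1 *ᵥ ![0, 1] = 0 := by
      ext k
      have : moebius g.1.1 Z.1 k 1 = 0 := h2 k
      simp [mulVec, dotProduct, Fin.sum_univ_two, this]
    rw [h3] at hu2
    have h4 : g.1.1 *ᵥ (Sum.elim u (Z.1 *ᵥ u)) = E := by
      rw [mulVec_elim, hu1, ← hu2]
    rw [← h4, mulVec_mulVec, hinv, one_mulVec]
  have hmem : ∀ t : ℝ, |t| < 1 → (Matrix.of fun (k : Fin n) (j : Fin 2) =>
      if k = ⟨0, hn⟩ ∧ j = 0 then t else 0) ∈ matrixBall n := by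
    intro t ht
    rw [mem_matrixBall_iff]
    intro v hv
    have e : ∀ k : Fin n, ((Matrix.of fun (k : Fin n) (j : Fin 2) =>
      if k = ⟨0, hn⟩ ∧ j = 0 then t else 0) *ᵥ v) k = if k = ⟨0, hn⟩ then t * v 0 else 0 := by
      intro k
      by_cases hk : k = ⟨0, hn⟩ <;> simp [mulVec, dotProduct, Fin.sum_univ_two, hk]
    have e2 : ((Matrix.of fun (k : Fin n) (j : Fin 2) =>
      if k = ⟨0, hn⟩ ∧ j = 0 then t else 0) *ᵥ v) ⬝ᵥ ((Matrix.of fun (k : Fin n) (j : Fin 2) =>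
      if k = ⟨0, hn⟩ ∧ j = 0 then t else 0) *ᵥ v) = t ^ 2 * v 0 ^ 2 := by
      rw [dotProduct]
      simp only [e]
      simp
      ring
    rw [e2, dotProduct, Fin.sum_univ_two]
    have ht2 : t ^ 2 < 1 := by rw [← sq_abs]; nlinarith [abs_nonneg t]
    by_cases h0 : v 0 = 0
    · have h1 : v 1 ≠ 0 := fun h1 => hv (by ext j; fin_cases j <;> assumption)
      have : 0 < v 1 * v 1 := mul_self_pos.2 h1
      rw [h0]; nlinarith
    · have : 0 < v 0 ^ 2 := by positivity
      nlinarith [mul_self_nonneg (v 1)]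
  obtain ⟨u, hu⟩ := step ⟨_, hmem 0 (by simp)⟩ (fun k => by simp)
  obtain ⟨u', hu'⟩ := step ⟨_, hmem (1 / 2) (by norm_num [abs_of_pos])⟩ (fun k => by simp)
  have huu : u' = u := by
    ext j
    have := congrFun (hu'.trans hu.symm) (Sum.inl j)
    simpa using this
  subst huu
  have hu0 : u' 0 = 0 := by
    have := congrFun (hu'.trans hu.symm) (Sum.inr ⟨0, hn⟩)
    simpa [mulVec, dotProduct, Fin.sum_univ_two] using this
  have hgE : g⁻¹.1.1 *ᵥ E = u' 1 • E := by
    rw [← hu]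
    ext j
    rcases j with j | j
    · fin_cases j
      · simp [hE, hu0]
      · simp [hE]
    · simp [hE, mulVec, dotProduct, Fin.sum_univ_two]
  intro x hx
  have hZ := (mem_lieBallReal_iff x).1 hx
  rw [mem_lieBallReal_iff, huaEquiv_smul]
  intro k
  change moebius g⁻¹.1.1 (huaEquiv n x).1 k 1 = 0
  set Z := huaEquiv n x
  have hZE : Z.1 *ᵥ ![0, 1] = 0 := by
    ext k
    simp [mulVec, dotProduct, Fin.sum_univ_two, hZ k]
  have h1 := mulVec_elim g⁻¹.1.1 Z.1 ![0, 1]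
  rw [hZE] at h1
  change g⁻¹.1.1 *ᵥ E = _ at h1
  rw [hgE] at h1
  set W := g⁻¹.1.1.toBlocks₁₁ + g⁻¹.1.1.toBlocks₁₂ * Z.1 with hW
  set U := g⁻¹.1.1.toBlocks₂₁ + g⁻¹.1.1.toBlocks₂₂ * Z.1 with hU
  have hWe : W *ᵥ ![0, 1] = u' 1 • ![0, 1] := by
    ext j
    have := congrFun h1 (Sum.inl j)
    simpa [hE] using this.symm
  have hUe : U *ᵥ ![0, 1] = 0 := by
    ext j
    have := congrFun h1 (Sum.inr j)
    simpa [hE] using this.symm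
  have hWu : IsUnit W.det := (Matrix.isUnit_iff_isUnit_det _).1 (isUnit_moebius_den g⁻¹.2 Z.2)
  have h2 : u' 1 • (W⁻¹ *ᵥ ![0, 1]) = (![0, 1] : Fin 2 → ℝ) := by
    rw [← mulVec_smul, ← hWe, mulVec_mulVec, Matrix.nonsing_inv_mul _ hWu, one_mulVec]
  have h3 : u' 1 ≠ 0 := by
    intro h0
    rw [h0, zero_smul] at h2
    simpa using congrFun h2 1
  have h4 : u' 1 • (moebius g⁻¹.1.1 Z.1 *ᵥ ![0, 1]) = 0 := by
    change u' 1 • ((U * W⁻¹) *ᵥ ![0, 1]) = 0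
    rw [← mulVec_mulVec, ← mulVec_smul, h2, hUe]
  have h5 := congrFun ((smul_eq_zero.1 h4).resolve_left h3) k
  simpa [mulVec, dotProduct, Fin.sum_univ_two] using h5

/-- The group `G = SO_0(2,n)`, the identity component of `SO(2,n)`. -/
def groupG (n : ℕ) : Subgroup (indefiniteSO n) := Subgroup.connectedComponentOfOne (indefiniteSO n)

/-- The isotropy group `K` of `0` in `G`. -/
def groupK (n : ℕ) : Subgroup (indefiniteSO n) :=
  groupG n ⊓ MulAction.stabilizer (indefiniteSO n) (⟨0, zero_mem_lieBall n⟩ : lieBall n)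

/-- The group `{h ∈ G : h(x) ∈ 𝒳 if x ∈ 𝒳}`. -/
def realStabilizer (n : ℕ) : Subgroup (indefiniteSO n) where
  carrier := {g | g ∈ groupG n ∧ ∀ x ∈ lieBallReal n, g • x ∈ lieBallReal n}
  one_mem' := ⟨one_mem _, fun x hx => by rwa [one_smul]⟩
  mul_mem' := fun ha hb =>
    ⟨mul_mem ha.1 hb.1, fun x hx => by rw [mul_smul]; exact ha.2 _ (hb.2 x hx)⟩
  inv_mem' := fun ha => ⟨inv_mem ha.1, inv_preserves_lieBallReal ha.2⟩

/-- The group `H`, the identity component of `realStabilizer n`. -/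
def groupH (n : ℕ) : Subgroup (indefiniteSO n) :=
  (Subgroup.connectedComponentOfOne (realStabilizer n)).map (realStabilizer n).subtype

/-- The group `L = H ∩ K`. -/
def groupL (n : ℕ) : Subgroup (indefiniteSO n) := groupH n ⊓ groupK n

end Group

noncomputable section Representation
open Complex

instance lieBallKernel_fact (n : ℕ) [hn : Fact (2 < n)] (ν : ℝ) [hν : Fact (ν ∈ wallachSet n)] :
    Fact (lieBallKernel n ν).PosSemidef :=
  ⟨lieBallKernel_posSemidef hn.out.le hν.out⟩

/-- The Hilbert space `𝓗_ν` of functions on `𝒟` with reproducing kernel `h(z,w)^{-ν}`. -/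
abbrev HilbertNu (n : ℕ) [Fact (2 < n)] (ν : ℝ) [Fact (ν ∈ wallachSet n)] : Type :=
  RKHS.OfKernel (lieBallKernel n ν)

/-- The transformation of `𝒟` given by `g`, as a function on `ℂ^n` (with value `0` off `𝒟`). -/
def transformation {n : ℕ} (g : indefiniteSO n) :
    EuclideanSpace ℂ (Fin n) → EuclideanSpace ℂ (Fin n) :=
  Function.extend (Subtype.val : lieBall n → EuclideanSpace ℂ (Fin n)) (fun z => (g • z).1) 0

/-- The complex Jacobian `J_g(z) = det dg(z)`. -/
def jacobian {n : ℕ} (g : indefiniteSO n) (z : lieBall n) : ℂ :=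
  (fderiv ℂ (transformation g) z).det

/-- The continuous logarithm of `J_g` on `𝒟` whose value at `0` is the principal one. -/
def logJacobian {n : ℕ} (g : indefiniteSO n) : lieBall n → ℂ :=
  Classical.epsilon fun l : lieBall n → ℂ =>
    Continuous l ∧ (∀ z, cexp (l z) = jacobian g z) ∧
      l ⟨0, zero_mem_lieBall n⟩ = Complex.log (jacobian g ⟨0, zero_mem_lieBall n⟩)

/-- `(π_ν(g) f)(z) = J_{g⁻¹}(z)^{ν/n} f(g⁻¹ z)`. -/
def piNu {n : ℕ} (ν : ℝ) (g : indefiniteSO n) (f : lieBall n → ℂ) (z : lieBall n) : ℂ :=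
  cexp ((ν / n : ℂ) * logJacobian g⁻¹ z) * f (g⁻¹ • z)

end Representation

/-!
The point `z` of `𝒟` is encoded by the isotropic vector `((1 + q(z))/2, i(q(z) - 1)/2, z)` of
`ℂ^{2+n}`, on which `g` acts linearly up to a scalar, the automorphy factor `j(g, z)`. Since
`h(z, w)` and `q(z - w)` are the Hermitian and the bilinear pairings of such vectors,
`j(g, z) * conj j(g, w) * h(gz, gw) = h(z, w)` and `j(g, z) * j(g, w) * q(gz - gw) = q(z - w)`.
Letting `w → z` in the second identity shows that `dg(z)` is `j(g, z)⁻¹` times a complex orthogonal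
map, whence `J_g = j(g, ·)^{-n}`.

Let `g ∈ H`. On `𝒳` both `h` and `q(z - w)` are positive, so the two identities force `j(g, ·)` to
be real there, and positive because `H` is connected. The first identity with `w = g⁻¹ 0 ∈ 𝒳` then
makes `j(g, z)` a positive multiple of `h(z, w)`, which is never a negative number. So the principal
powers `j(g, z)^{-ν}` form a cocycle that leaves the kernel `h^{-ν}` invariant, and `π_ν(g)` is
unitary, sending kernel functions to multiples of kernel functions. The constant `1` is the kernel
function of `0`; a function orthogonal to its orbit vanishes on `H · 0 = 𝒳` and, being holomorphic
on the star-shaped domain `𝒟`, is zero.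
-/

section Topology

theorem pos_of_isPreconnected {X : Type*} [TopologicalSpace X] {s : Set X} (hs : IsPreconnected s)
    {f : X → ℝ} (hf : ContinuousOn f s) (hne : ∀ x ∈ s, f x ≠ 0) {x₀ : X} (hx₀ : x₀ ∈ s)
    (h₀ : 0 < f x₀) {x : X} (hx : x ∈ s) : 0 < f x := by
  by_contra! hle
  obtain ⟨y, hy, hy0⟩ := hs.intermediate_value hx hx₀ hf ⟨hle, h₀.le⟩
  exact hne y hy hy0

theorem eq_of_exp_comp_eq {X : Type*} [TopologicalSpace X] [PreconnectedSpace X] {f g : X → ℂ}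
    (hf : Continuous f) (hg : Continuous g) (h : ∀ x, Complex.exp (f x) = Complex.exp (g x))
    {x₀ : X} (h₀ : f x₀ = g x₀) : f = g :=
  Complex.isCoveringMap_exp.eq_of_comp_eq hf hg (funext fun x => Subtype.ext (h x)) x₀ h₀

end Topology

noncomputable section GramMatrix
open Filter Topology
open scoped InnerProductSpace

variable {𝕜 ι E F : Type*} [RCLike 𝕜] [NormedAddCommGroup E] [InnerProductSpace 𝕜 E]
  [NormedAddCommGroup F] [InnerProductSpace 𝕜 F] {v : ι → E} {w : ι → F}

theorem norm_linearCombination_eq_of_inner_eq (h : ∀ i j, ⟪w i, w j⟫_𝕜 = ⟪v i, v j⟫_𝕜)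
    (c : ι →₀ 𝕜) :
    ‖Finsupp.linearCombination 𝕜 w c‖ = ‖Finsupp.linearCombination 𝕜 v c‖ := by
  have hinner : ⟪Finsupp.linearCombination 𝕜 w c, Finsupp.linearCombination 𝕜 w c⟫_𝕜
      = ⟪Finsupp.linearCombination 𝕜 v c, Finsupp.linearCombination 𝕜 v c⟫_𝕜 := by
    simp only [Finsupp.linearCombination_apply, Finsupp.sum, sum_inner, inner_sum, inner_smul_left,
      inner_smul_right, h]
  rw [@norm_eq_sqrt_re_inner 𝕜, @norm_eq_sqrt_re_inner 𝕜, hinner]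

theorem denseRange_linearCombination
    (hv : (Submodule.span 𝕜 (Set.range v)).topologicalClosure = ⊤) :
    DenseRange (Finsupp.linearCombination 𝕜 v) := by
  rw [← Submodule.dense_iff_topologicalClosure_eq_top, ← Finsupp.range_linearCombination,
    LinearMap.coe_range] at hv
  exact hv

/-- The unitary operator `v i ↦ w i` between Hilbert spaces determined by two total families with
the same Gram matrix. -/
def isometryEquivOfInnerEq [CompleteSpace E] [CompleteSpace F]
    (hv : (Submodule.span 𝕜 (Set.range v)).topologicalClosure = ⊤)
    (hw : (Submodule.span 𝕜 (Set.range w)).topologicalClosure = ⊤)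
    (h : ∀ i j, ⟪w i, w j⟫_𝕜 = ⟪v i, v j⟫_𝕜) : E ≃ₗᵢ[𝕜] F :=
  (LinearEquiv.refl 𝕜 (ι →₀ 𝕜)).extendOfIsometry (Finsupp.linearCombination 𝕜 v)
    (Finsupp.linearCombination 𝕜 w) (denseRange_linearCombination hv)
    (denseRange_linearCombination hw) (norm_linearCombination_eq_of_inner_eq h)

theorem isometryEquivOfInnerEq_apply [CompleteSpace E] [CompleteSpace F]
    (hv : (Submodule.span 𝕜 (Set.range v)).topologicalClosure = ⊤)
    (hw : (Submodule.span 𝕜 (Set.range w)).topologicalClosure = ⊤)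
    (h : ∀ i j, ⟪w i, w j⟫_𝕜 = ⟪v i, v j⟫_𝕜) (i : ι) :
    isometryEquivOfInnerEq hv hw h (v i) = w i := by
  simpa [isometryEquivOfInnerEq] using (LinearEquiv.refl 𝕜 (ι →₀ 𝕜)).extendOfIsometry_eq
    (Finsupp.linearCombination 𝕜 v) (Finsupp.linearCombination 𝕜 w)
    (denseRange_linearCombination hv) (denseRange_linearCombination hw)
    (norm_linearCombination_eq_of_inner_eq h) (Finsupp.single i 1)

theorem continuous_isometry_apply_of_total {T : Type*} [TopologicalSpace T] (U : T → E →ₗᵢ[𝕜] F)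
    (hv : (Submodule.span 𝕜 (Set.range v)).topologicalClosure = ⊤)
    (hU : ∀ i, Continuous fun t => U t (v i)) (x : E) : Continuous fun t => U t x := by
  have hspan : ∀ x ∈ Submodule.span 𝕜 (Set.range v), Continuous fun t => U t x := by
    intro x hx
    induction hx using Submodule.span_induction with
    | mem x hx => obtain ⟨i, rfl⟩ := hx; exact hU i
    | zero => simpa only [map_zero] using continuous_const
    | add x y _ _ hx hy => simp only [map_add]; exact hx.add hy
    | smul c x _ hx => simp only [map_smul]; exact hx.const_smul c
  have hdense := Submodule.dense_iff_topologicalClosure_eq_top.2 hv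
  refine continuous_of_uniform_approx_of_continuous fun u hu => ?_
  obtain ⟨ε, hε, hεu⟩ := Metric.mem_uniformity_dist.1 hu
  obtain ⟨y, hy, hyspan⟩ := Metric.dense_iff.1 hdense x ε hε
  refine ⟨fun t => U t y, hspan y hyspan, fun t => hεu ?_⟩
  rwa [(U t).dist_map, dist_comm]

theorem continuous_of_continuous_inner {T : Type*} [TopologicalSpace T] {v : T → E}
    (h : Continuous fun p : T × T => ⟪v p.1, v p.2⟫_𝕜) : Continuous v := by
  refine continuous_iff_continuousAt.2 fun t => tendsto_iff_norm_sub_tendsto_zero.2 ?_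
  have hinner : Continuous fun s => ⟪v s - v t, v s - v t⟫_𝕜 := by
    simp only [inner_sub_left, inner_sub_right]
    have h₁ := h.comp (continuous_id.prodMk continuous_id)
    have h₂ := h.comp (continuous_id.prodMk (continuous_const (y := t)))
    have h₃ := h.comp ((continuous_const (y := t)).prodMk continuous_id)
    exact (h₁.sub h₃).sub (h₂.sub continuous_const)
  have hnorm : Continuous fun s => ‖v s - v t‖ := by
    simp only [@norm_eq_sqrt_re_inner 𝕜]
    exact (RCLike.continuous_re.comp hinner).sqrt
  simpa using hnorm.tendsto t

end GramMatrix

noncomputable section KernelFunctions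
open Filter Topology
open scoped InnerProductSpace

variable {𝕜 X : Type*} [RCLike 𝕜] (H : Type*) [NormedAddCommGroup H] [InnerProductSpace 𝕜 H]
  [RKHS 𝕜 H X 𝕜] [CompleteSpace H]

/-- The kernel function `k(·, x)` of a reproducing kernel Hilbert space of scalar functions, which
represents the evaluation at `x`. -/
def kernelVec (x : X) : H := RKHS.kerFun H x 1

variable {H}

theorem inner_kernelVec (x : X) (f : H) : ⟪kernelVec H x, f⟫_𝕜 = f x := by
  simp [kernelVec, RKHS.kerFun_inner]

variable (H) in
theorem span_range_kernelVec :
    (Submodule.span 𝕜 (Set.range (kernelVec H : X → H))).topologicalClosure = ⊤ := by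
  rw [eq_top_iff, ← RKHS.kerFun_dense H]
  refine Submodule.topologicalClosure_mono (Submodule.span_le.2 ?_)
  rintro _ ⟨x, c, rfl⟩
  have hc : RKHS.kerFun H x c = c • kernelVec H x := by
    rw [kernelVec, ← map_smul, smul_eq_mul, mul_one]
  exact hc ▸ Submodule.smul_mem _ c (Submodule.subset_span ⟨x, rfl⟩)

theorem tendstoLocallyUniformly_of_tendsto [TopologicalSpace X]
    (hK : Continuous (kernelVec H : X → H)) {ι : Type*} {p : Filter ι} {F : ι → H} {f : H}
    (hF : Tendsto F p (𝓝 f)) : TendstoLocallyUniformly (fun i => ⇑(F i)) f p := by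
  rw [Metric.tendstoLocallyUniformly_iff]
  intro ε hε x
  set C := ‖kernelVec H x‖ + 1
  have hC : 0 < C := by positivity
  refine ⟨{y | ‖kernelVec H y‖ < C}, hK.norm.continuousAt.eventually_lt continuousAt_const
    (lt_add_one _), ?_⟩
  filter_upwards [Metric.tendsto_nhds.1 hF (ε / C) (by positivity)] with i hi y hy
  rw [dist_eq_norm] at hi
  rw [dist_comm, dist_eq_norm, ← inner_kernelVec, ← inner_kernelVec, ← inner_sub_right]
  calc ‖⟪kernelVec H y, F i - f⟫_𝕜‖ ≤ ‖kernelVec H y‖ * ‖F i - f‖ := norm_inner_le_norm _ _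
    _ ≤ C * ‖F i - f‖ := by gcongr
    _ < C * (ε / C) := by gcongr
    _ = ε := by field_simp

end KernelFunctions

noncomputable section Multiplier
open scoped InnerProductSpace

/-- A multiplier for the action of a group `G` on the domain of a reproducing kernel Hilbert space
of scalar functions: a cocycle `m` with `m(g,x) k(gx,gy) conj(m(g,y)) = k(x,y)`. -/
structure KernelMultiplier {𝕜 X : Type*} [RCLike 𝕜] (G : Type*) [Group G] [MulAction G X]
    (H : Type*) [NormedAddCommGroup H] [InnerProductSpace 𝕜 H] [RKHS 𝕜 H X 𝕜]
    [CompleteSpace H] where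
  toFun : G → X → 𝕜
  one_apply : ∀ x, toFun 1 x = 1
  mul_apply : ∀ g g' x, toFun (g * g') x = toFun g (g' • x) * toFun g' x
  inner_smul : ∀ g x y, toFun g x * conj (toFun g y) *
    ⟪kernelVec H (g • x), kernelVec H (g • y)⟫_𝕜 = ⟪kernelVec H x, kernelVec H y⟫_𝕜

namespace KernelMultiplier

variable {𝕜 X G H : Type*} [RCLike 𝕜] [Group G] [MulAction G X] [NormedAddCommGroup H]
  [InnerProductSpace 𝕜 H] [RKHS 𝕜 H X 𝕜] [CompleteSpace H] (m : KernelMultiplier G H)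

instance : CoeFun (KernelMultiplier G H) fun _ => G → X → 𝕜 := ⟨toFun⟩

theorem inv_apply_mul (g : G) (x : X) : m g⁻¹ x * m g (g⁻¹ • x) = 1 := by
  rw [mul_comm, ← m.mul_apply, mul_inv_cancel, m.one_apply]

/-- The family `conj(m(g,x)) k(·, gx)`, onto which `π(g)` maps the kernel functions. -/
def translate (g : G) (x : X) : H := conj (m g x) • kernelVec H (g • x)

theorem inner_translate (g : G) (x y : X) :
    ⟪m.translate g x, m.translate g y⟫_𝕜 = ⟪kernelVec H x, kernelVec H y⟫_𝕜 := by
  rw [translate, translate, inner_smul_left, inner_smul_right, RCLike.conj_conj, ← mul_assoc,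
    m.inner_smul]

theorem kernelVec_eq_smul_translate (g : G) (x : X) :
    kernelVec H x = conj (m g⁻¹ x) • m.translate g (g⁻¹ • x) := by
  rw [translate, smul_smul, smul_inv_smul, ← map_mul, m.inv_apply_mul, map_one, one_smul]

theorem span_range_translate (g : G) :
    (Submodule.span 𝕜 (Set.range (m.translate g))).topologicalClosure = ⊤ := by
  rw [eq_top_iff, ← span_range_kernelVec H]
  refine Submodule.topologicalClosure_mono (Submodule.span_le.2 ?_)
  rintro _ ⟨x, rfl⟩
  rw [m.kernelVec_eq_smul_translate g x]
  exact Submodule.smul_mem _ _ (Submodule.subset_span ⟨_, rfl⟩)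

/-- The unitary operator `π(g)` of the representation defined by a multiplier. -/
def unitary (g : G) : H ≃ₗᵢ[𝕜] H :=
  isometryEquivOfInnerEq (span_range_kernelVec H) (m.span_range_translate g) (m.inner_translate g)

theorem unitary_kernelVec (g : G) (x : X) :
    m.unitary g (kernelVec H x) = conj (m g x) • kernelVec H (g • x) :=
  isometryEquivOfInnerEq_apply _ _ _ x

theorem unitary_apply (g : G) (f : H) (x : X) : m.unitary g f x = m g⁻¹ x * f (g⁻¹ • x) := by
  rw [← inner_kernelVec, m.kernelVec_eq_smul_translate g x, translate, ← m.unitary_kernelVec,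
    inner_smul_left, RCLike.conj_conj, LinearIsometryEquiv.inner_map_map, inner_kernelVec]

/-- The unitary representation `(π(g)f)(x) = m(g⁻¹,x) f(g⁻¹x)` defined by a multiplier. -/
def unitaryRep : G →* (H ≃ₗᵢ[𝕜] H) :=
  MonoidHom.mk' m.unitary fun g g' => LinearIsometryEquiv.ext fun f => RKHS.ext fun x => by
    change m.unitary (g * g') f x = m.unitary g (m.unitary g' f) x
    rw [unitary_apply, unitary_apply, unitary_apply, mul_inv_rev, mul_smul, m.mul_apply]
    ring

theorem unitaryRep_apply (g : G) (f : H) (x : X) : m.unitaryRep g f x = m g⁻¹ x * f (g⁻¹ • x) :=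
  m.unitary_apply g f x

theorem unitaryRep_kernelVec (g : G) (x : X) :
    m.unitaryRep g (kernelVec H x) = conj (m g x) • kernelVec H (g • x) :=
  m.unitary_kernelVec g x

theorem continuous_unitaryRep_apply [TopologicalSpace G] [TopologicalSpace X]
    (hK : Continuous (kernelVec H : X → H)) (hsmul : ∀ x : X, Continuous fun g : G => g • x)
    (hm : ∀ x, Continuous fun g => m g x) (f : H) : Continuous fun g => m.unitaryRep g f := by
  refine continuous_isometry_apply_of_total (fun g => (m.unitaryRep g).toLinearIsometry)
    (span_range_kernelVec H) (fun x => ?_) f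
  simp only [LinearIsometryEquiv.coe_toLinearIsometry, unitaryRep_kernelVec]
  exact (RCLike.continuous_conj.comp (hm x)).smul (hK.comp (hsmul x))

theorem span_range_unitaryRep_kernelVec (x₀ : X)
    (huniq : ∀ f : H, (∀ g : G, f (g • x₀) = 0) → f = 0) :
    (Submodule.span 𝕜 (Set.range fun g => m.unitaryRep g (kernelVec H x₀))).topologicalClosure
      = ⊤ := by
  rw [← Submodule.orthogonal_eq_bot_iff, Submodule.eq_bot_iff]
  refine fun f hf => huniq f fun g => ?_
  have horth := (Submodule.mem_orthogonal _ f).1 hf (m.unitaryRep g (kernelVec H x₀))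
    (Submodule.le_topologicalClosure _ (Submodule.subset_span ⟨g, rfl⟩))
  rw [unitaryRep_kernelVec, inner_smul_left, inner_kernelVec, RCLike.conj_conj] at horth
  refine (mul_eq_zero.1 horth).resolve_left fun h0 => ?_
  simpa [h0] using m.inv_apply_mul g (g • x₀)

end KernelMultiplier

end Multiplier

section GateauxHolomorphic
open Filter Topology

/-- Holomorphy along complex lines of a function on an open subset `U` of a complex vector space. -/
def GateauxHolomorphicOn {E : Type*} [AddCommGroup E] [Module ℂ E] (f : E → ℂ) (U : Set E) : Prop :=
  ∀ a b : E, DifferentiableOn ℂ (fun s : ℂ => f (a + s • b)) ((fun s : ℂ => a + s • b) ⁻¹' U)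

namespace GateauxHolomorphicOn

section Algebra

variable {E : Type*} [AddCommGroup E] [Module ℂ E] {f : E → ℂ} {U V : Set E}

theorem mono (hf : GateauxHolomorphicOn f U) (h : V ⊆ U) : GateauxHolomorphicOn f V :=
  fun a b => (hf a b).mono (Set.preimage_mono h)

end Algebra

variable {E : Type*} [NormedAddCommGroup E] [NormedSpace ℂ E] {f : E → ℂ} {U : Set E}

theorem analyticOnNhd_line (hf : GateauxHolomorphicOn f U) (hU : IsOpen U) (a b : E) :
    AnalyticOnNhd ℂ (fun s : ℂ => f (a + s • b)) ((fun s : ℂ => a + s • b) ⁻¹' U) :=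
  (hf a b).analyticOnNhd (hU.preimage (by fun_prop))

theorem of_tendstoLocallyUniformlyOn {F : ℕ → E → ℂ} (hU : IsOpen U)
    (hF : TendstoLocallyUniformlyOn F f atTop U) (hhol : ∀ k, GateauxHolomorphicOn (F k) U) :
    GateauxHolomorphicOn f U := fun a b =>
  have hline : Continuous fun s : ℂ => a + s • b := by fun_prop
  (hF.comp _ (Set.mapsTo_preimage _ _) hline.continuousOn).differentiableOn
    (Eventually.of_forall fun k => hhol k a b) (hU.preimage hline)

theorem eqOn_zero_of_starConvex (hf : GateauxHolomorphicOn f U) (hU : IsOpen U)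
    (hstar : StarConvex ℝ 0 U) (hzero : f =ᶠ[𝓝 0] 0) : Set.EqOn f 0 U := by
  intro z hz
  set S : Set ℂ := (fun s : ℂ => (0 : E) + s • z) ⁻¹' U
  have hS₀ : (0 : ℂ) ∈ S := by simpa [S] using hstar.mem ⟨z, hz⟩
  have hS₁ : (1 : ℂ) ∈ S := by simpa [S] using hz
  have hS : IsPreconnected S := by
    have hSstar : StarConvex ℝ (0 : ℂ) S := starConvex_zero_iff.2 fun s hs t ht₀ ht₁ => by
      have := starConvex_zero_iff.1 hstar hs ht₀ ht₁
      simpa [S, mul_smul] using this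
    exact (hSstar.isPathConnected hS₀).isConnected.isPreconnected
  have htendsto : Tendsto (fun s : ℂ => (0 : E) + s • z) (𝓝 0) (𝓝 0) := by
    have hline : Continuous fun s : ℂ => (0 : E) + s • z := by fun_prop
    simpa using hline.tendsto 0
  simpa using (hf.analyticOnNhd_line hU 0 z).eqOn_zero_of_preconnected_of_eventuallyEq_zero hS hS₀
    (htendsto.eventually hzero) hS₁

end GateauxHolomorphicOn

theorem isPreconnected_preimage_line {E : Type*} [AddCommGroup E] [Module ℂ E] [Module ℝ E]
    [IsScalarTower ℝ ℂ E] {U : Set E} (hU : Convex ℝ U) (a b : E) :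
    IsPreconnected ((fun s : ℂ => a + s • b) ⁻¹' U) :=
  ((hU.translate_preimage_right a).linear_preimage
    ((LinearMap.toSpanSingleton ℂ E b).restrictScalars ℝ)).isPreconnected

theorem frequently_ofReal {P : ℂ → Prop} (hP : ∀ᶠ s : ℂ in 𝓝 0, ∀ t : ℝ, s = (t : ℂ) → P s) :
    ∃ᶠ s in 𝓝[≠] (0 : ℂ), P s := by
  have hreal : Tendsto (fun t : ℝ => (t : ℂ)) (𝓝[≠] 0) (𝓝[≠] 0) := by
    refine tendsto_nhdsWithin_of_tendsto_nhds_of_eventually_within _ ?_ ?_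
    · simpa using (Complex.continuous_ofReal.tendsto 0).mono_left nhdsWithin_le_nhds
    · filter_upwards [self_mem_nhdsWithin] with t ht
      exact Complex.ofReal_ne_zero.2 ht
  have hev : ∀ᶠ t : ℝ in 𝓝[≠] 0, P t :=
    (hreal.eventually (hP.filter_mono nhdsWithin_le_nhds)).mono fun t ht => ht t rfl
  exact hreal.frequently hev.frequently

/-- The real points of `ℂ^ι`. -/
def realPoints (ι : Type*) : Set (EuclideanSpace ℂ ι) := {z | ∀ i, (z i).im = 0}

theorem exists_eq_add_I_smul {ι : Type*} [Fintype ι] (z : EuclideanSpace ℂ ι) :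
    ∃ a ∈ realPoints ι, ∃ b ∈ realPoints ι, ‖a‖ ≤ ‖z‖ ∧ z = a + Complex.I • b := by
  refine ⟨WithLp.toLp 2 fun i => ((z i).re : ℂ), fun _ => by simp,
    WithLp.toLp 2 fun i => ((z i).im : ℂ), fun _ => by simp, ?_, ?_⟩
  · rw [EuclideanSpace.norm_eq, EuclideanSpace.norm_eq]
    gcongr with i
    simpa using Complex.abs_re_le_norm (z i)
  · ext i
    simp [mul_comm Complex.I, Complex.re_add_im]

namespace GateauxHolomorphicOn

variable {ι : Type*} {f : EuclideanSpace ℂ ι → ℂ}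

theorem eqOn_zero_ball_of_realPoints [Fintype ι] {r : ℝ}
    (hf : GateauxHolomorphicOn f (Metric.ball 0 r))
    (hzero : ∀ z ∈ Metric.ball 0 r ∩ realPoints ι, f z = 0) :
    Set.EqOn f 0 (Metric.ball 0 r) := by
  intro z hz
  obtain ⟨a, ha, b, hb, haz, rfl⟩ := exists_eq_add_I_smul z
  have hopen : IsOpen ((fun s : ℂ => a + s • b) ⁻¹' Metric.ball 0 r) :=
    Metric.isOpen_ball.preimage (by fun_prop)
  have h0 : (0 : ℂ) ∈ (fun s : ℂ => a + s • b) ⁻¹' Metric.ball 0 r := by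
    simpa using haz.trans_lt (mem_ball_zero_iff.1 hz)
  have hline := hf.analyticOnNhd_line Metric.isOpen_ball a b
  refine hline.eqOn_zero_of_preconnected_of_frequently_eq_zero
    (isPreconnected_preimage_line (convex_ball 0 r) a b) h0 (frequently_ofReal ?_) hz
  filter_upwards [hopen.mem_nhds h0] with s hs t hst
  exact hzero _ ⟨hs, fun i => by simp [hst, ha i, hb i]⟩

theorem eqOn_zero_of_realPoints [Finite ι] {U : Set (EuclideanSpace ℂ ι)}
    (hf : GateauxHolomorphicOn f U) (hU : IsOpen U) (hstar : StarConvex ℝ 0 U)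
    (hzero : ∀ z ∈ U ∩ realPoints ι, f z = 0) : Set.EqOn f 0 U := by
  have := Fintype.ofFinite ι
  rcases U.eq_empty_or_nonempty with rfl | hne
  · exact Set.eqOn_empty f 0
  obtain ⟨r, hr, hball⟩ := Metric.isOpen_iff.1 hU 0 (hstar.mem hne)
  have hzero_ball : Set.EqOn f 0 (Metric.ball 0 r) :=
    (hf.mono hball).eqOn_zero_ball_of_realPoints fun z hz => hzero z ⟨hball hz.1, hz.2⟩
  exact hf.eqOn_zero_of_starConvex hU hstar
    (hzero_ball.eventuallyEq_of_mem (Metric.ball_mem_nhds 0 hr))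

end GateauxHolomorphicOn

theorem gateauxHolomorphicOn_of_kernelVec {E H : Type*} [NormedAddCommGroup E] [NormedSpace ℂ E]
    {U : Set E} (hU : IsOpen U) [NormedAddCommGroup H] [InnerProductSpace ℂ H] [RKHS ℂ H U ℂ]
    [CompleteSpace H] (hcont : Continuous (kernelVec H : U → H))
    (hhol : ∀ w, GateauxHolomorphicOn (Function.extend Subtype.val (kernelVec H w) 0) U) (f : H) :
    GateauxHolomorphicOn (Function.extend Subtype.val f 0) U := by
  have hval : ∀ (f : H) {z : E} (hz : z ∈ U), Function.extend Subtype.val f 0 z = f ⟨z, hz⟩ :=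
    fun f z hz => Subtype.val_injective.extend_apply f 0 ⟨z, hz⟩
  have hspan : ∀ f ∈ Submodule.span ℂ (Set.range (kernelVec H : U → H)),
      GateauxHolomorphicOn (Function.extend Subtype.val f 0) U := by
    intro f hf
    induction hf using Submodule.span_induction with
    | mem f hf => obtain ⟨w, rfl⟩ := hf; exact hhol w
    | zero =>
      exact fun a b => (differentiableOn_const 0).congr fun s hs => by
        rw [hval _ hs, RKHS.coe_zero, Pi.zero_apply]
    | add f g _ _ hf hg =>
      exact fun a b => ((hf a b).add (hg a b)).congr fun s hs => by
        rw [hval _ hs, RKHS.coe_add, Pi.add_apply, Pi.add_apply, hval _ hs, hval _ hs]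
    | smul c f _ hf =>
      exact fun a b => ((hf a b).const_smul c).congr fun s hs => by
        rw [hval _ hs, RKHS.coe_smul, Pi.smul_apply, Pi.smul_apply, hval _ hs]
  have hdense := Submodule.dense_iff_topologicalClosure_eq_top.2 (span_range_kernelVec H (X := U))
  obtain ⟨F, hF, hFf⟩ := mem_closure_iff_seq_limit.1 (hdense f)
  refine .of_tendstoLocallyUniformlyOn hU ?_ fun k => hspan _ (hF k)
  rw [tendstoLocallyUniformlyOn_iff_tendstoLocallyUniformly_comp_coe]
  have := tendstoLocallyUniformly_of_tendsto hcont hFf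
  convert this using 1
  · ext k z; exact hval (F k) z.2
  · ext z; exact hval f z.2

end GateauxHolomorphic

noncomputable section BilinearForm
open Complex Matrix

variable {n : ℕ}

/-- The complex bilinear extension of the form of signature `(2,n)` to `ℂ^(2+n)`. -/
def bilinForm (x y : Fin 2 ⊕ Fin n → ℂ) : ℂ := x ⬝ᵥ ((formMatrix n).map ofReal *ᵥ y)

/-- The light-cone coordinate `x₁ + i x₂` of a vector of `ℂ^(2+n)`. -/
def nullCoord (x : Fin 2 ⊕ Fin n → ℂ) : ℂ := x (.inl 0) + I * x (.inl 1)

/-- The light-cone coordinate `x₁ - i x₂` of a vector of `ℂ^(2+n)`. -/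
def conullCoord (x : Fin 2 ⊕ Fin n → ℂ) : ℂ := x (.inl 0) - I * x (.inl 1)

theorem nullCoord_smul (c : ℂ) (x : Fin 2 ⊕ Fin n → ℂ) : nullCoord (c • x) = c * nullCoord x := by
  simp only [nullCoord, Pi.smul_apply, smul_eq_mul]
  ring

theorem conullCoord_smul (c : ℂ) (x : Fin 2 ⊕ Fin n → ℂ) :
    conullCoord (c • x) = c * conullCoord x := by
  simp only [conullCoord, Pi.smul_apply, smul_eq_mul]
  ring

theorem nullCoord_star (x : Fin 2 ⊕ Fin n → ℂ) : nullCoord (star x) = conj (conullCoord x) := by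
  simp [nullCoord, conullCoord]

theorem conullCoord_star (x : Fin 2 ⊕ Fin n → ℂ) : conullCoord (star x) = conj (nullCoord x) := by
  simp [nullCoord, conullCoord, sub_eq_add_neg]

theorem ext_nullCoord {x y : Fin 2 ⊕ Fin n → ℂ} (hnull : nullCoord x = nullCoord y)
    (hconull : conullCoord x = conullCoord y) (hinr : ∀ k, x (.inr k) = y (.inr k)) : x = y := by
  simp only [nullCoord, conullCoord] at hnull hconull
  funext i
  rcases i with i | k
  · fin_cases i
    · change x (.inl 0) = y (.inl 0)
      linear_combination (hnull + hconull) / 2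
    · change x (.inl 1) = y (.inl 1)
      linear_combination (-I / 2) * (hnull - hconull) + (x (.inl 1) - y (.inl 1)) * I_sq
  · exact hinr k

theorem bilinForm_eq (x y : Fin 2 ⊕ Fin n → ℂ) :
    bilinForm x y = (nullCoord x * conullCoord y + conullCoord x * nullCoord y) / 2
      - ∑ k, x (.inr k) * y (.inr k) := by
  have h : (formMatrix n).map ofReal = fromBlocks (1 : Matrix (Fin 2) (Fin 2) ℂ) 0 0
      (-1 : Matrix (Fin n) (Fin n) ℂ) := by
    rw [formMatrix, fromBlocks_map]
    congr 1 <;> ext i j <;> simp [Matrix.one_apply, apply_ite]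
  have hsum : bilinForm x y
      = x (.inl 0) * y (.inl 0) + x (.inl 1) * y (.inl 1) - ∑ k, x (.inr k) * y (.inr k) := by
    rw [bilinForm, h, fromBlocks_mulVec, dotProduct, Fintype.sum_sum_type]
    simp [Fin.sum_univ_two, neg_mulVec, sub_eq_add_neg]
  rw [hsum, nullCoord, nullCoord, conullCoord, conullCoord]
  linear_combination (x (.inl 1) * y (.inl 1)) * I_sq

theorem bilinForm_smul_smul (c d : ℂ) (x y : Fin 2 ⊕ Fin n → ℂ) :
    bilinForm (c • x) (d • y) = c * d * bilinForm x y := by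
  rw [bilinForm, bilinForm, mulVec_smul, smul_dotProduct, dotProduct_smul, smul_smul, smul_eq_mul]

theorem nullCoord_mul_conullCoord {x : Fin 2 ⊕ Fin n → ℂ} (hx : bilinForm x x = 0) :
    nullCoord x * conullCoord x = ∑ k, x (.inr k) ^ 2 := by
  simp only [bilinForm_eq, ← sq] at hx
  linear_combination hx

theorem two_mul_bilinForm_star_self (x : Fin 2 ⊕ Fin n → ℂ) :
    2 * bilinForm x (star x) = ((‖nullCoord x‖ ^ 2 + ‖conullCoord x‖ ^ 2
      - 2 * ∑ k, ‖x (.inr k)‖ ^ 2 : ℝ) : ℂ) := by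
  simp only [bilinForm_eq, nullCoord_star, conullCoord_star, Pi.star_apply, RCLike.star_def,
    mul_conj']
  push_cast
  ring

theorem norm_conullCoord_ne {x : Fin 2 ⊕ Fin n → ℂ} (hx : bilinForm x x = 0)
    (hpos : 0 < (2 * bilinForm x (star x)).re) : ‖conullCoord x‖ ≠ ‖nullCoord x‖ := by
  intro h
  rw [two_mul_bilinForm_star_self, ofReal_re, h] at hpos
  have hle : ‖nullCoord x‖ * ‖conullCoord x‖ ≤ ∑ k, ‖x (.inr k)‖ ^ 2 := by
    rw [← norm_mul, nullCoord_mul_conullCoord hx]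
    simpa only [← norm_pow] using norm_sum_le Finset.univ fun k => x (.inr k) ^ 2
  rw [h] at hle
  linarith

/-- The complexification of a matrix of `SO(2,n)`. -/
abbrev complexify (g : indefiniteSO n) : Matrix (Fin 2 ⊕ Fin n) (Fin 2 ⊕ Fin n) ℂ :=
  g.1.1.map ofReal

theorem complexify_mul (g g' : indefiniteSO n) :
    complexify (g * g') = complexify g * complexify g' :=
  Matrix.map_mul (f := ofRealHom)

theorem complexify_one : complexify (1 : indefiniteSO n) = 1 :=
  Matrix.map_one ofReal ofReal_zero ofReal_one

theorem star_complexify_mulVec (g : indefiniteSO n) (x : Fin 2 ⊕ Fin n → ℂ) :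
    star (complexify g *ᵥ x) = complexify g *ᵥ star x := by
  ext i
  simp [mulVec, dotProduct]

theorem bilinForm_mulVec (g : indefiniteSO n) (x y : Fin 2 ⊕ Fin n → ℂ) :
    bilinForm (complexify g *ᵥ x) (complexify g *ᵥ y) = bilinForm x y := by
  have h : (complexify g)ᵀ * (formMatrix n).map ofReal * complexify g
      = (formMatrix n).map ofReal := by
    have hg : g.1.1ᵀ * formMatrix n * g.1.1 = formMatrix n := g.2
    have hmap := congrArg (fun M => M.map ofRealHom) hg
    simp only [Matrix.map_mul] at hmap
    exact hmap
  rw [bilinForm, bilinForm]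
  conv_rhs => rw [← h]
  rw [Matrix.mul_assoc, ← mulVec_mulVec, dotProduct_mulVec _ (complexify g)ᵀ, vecMul_transpose,
    mulVec_mulVec]

theorem bilinForm_mulVec_star (g : indefiniteSO n) (x y : Fin 2 ⊕ Fin n → ℂ) :
    bilinForm (complexify g *ᵥ x) (star (complexify g *ᵥ y)) = bilinForm x (star y) := by
  rw [star_complexify_mulVec, bilinForm_mulVec]

theorem inr_mulVec_eq_moebius (g : indefiniteSO n) {Z : Matrix (Fin n) (Fin 2) ℝ}
    (hZ : Z ∈ matrixBall n) {x : Fin 2 ⊕ Fin n → ℂ} (hx : x ∘ .inr = Z.map ofReal *ᵥ (x ∘ .inl)) :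
    (complexify g *ᵥ x) ∘ .inr = (moebius g.1.1 Z).map ofReal *ᵥ ((complexify g *ᵥ x) ∘ .inl) := by
  have hinl : (complexify g *ᵥ x) ∘ .inl
      = (g.1.1.toBlocks₁₁ + g.1.1.toBlocks₁₂ * Z).map ofRealHom *ᵥ (x ∘ .inl) := by
    rw [Matrix.map_add _ (map_add ofRealHom), Matrix.map_mul, add_mulVec, ← mulVec_mulVec]
    conv_lhs => rw [complexify, ← fromBlocks_toBlocks g.1.1, fromBlocks_map, fromBlocks_mulVec, hx]
    rfl
  have hinr : (complexify g *ᵥ x) ∘ .inr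
      = (g.1.1.toBlocks₂₁ + g.1.1.toBlocks₂₂ * Z).map ofRealHom *ᵥ (x ∘ .inl) := by
    rw [Matrix.map_add _ (map_add ofRealHom), Matrix.map_mul, add_mulVec, ← mulVec_mulVec]
    conv_lhs => rw [complexify, ← fromBlocks_toBlocks g.1.1, fromBlocks_map, fromBlocks_mulVec, hx]
    rfl
  have hden := (isUnit_iff_isUnit_det _).1 (isUnit_moebius_den g.2 hZ)
  change _ = (moebius g.1.1 Z).map ofRealHom *ᵥ _
  rw [hinl, hinr, mulVec_mulVec, ← Matrix.map_mul, moebius, Matrix.mul_assoc,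
    nonsing_inv_mul _ hden, Matrix.mul_one]

end BilinearForm

noncomputable section IsotropicLift
open Complex Matrix

variable {n : ℕ}

/-- The isotropic vector of `ℂ^(2+n)` with light-cone coordinates `1` and `q(z)` above `z`. -/
def isotropicLift (z : EuclideanSpace ℂ (Fin n)) : Fin 2 ⊕ Fin n → ℂ :=
  Sum.elim ![(1 + quadForm z) / 2, I * (quadForm z - 1) / 2] fun k => z k

theorem nullCoord_isotropicLift (z : EuclideanSpace ℂ (Fin n)) :
    nullCoord (isotropicLift z) = 1 := by
  simp only [nullCoord, isotropicLift, Sum.elim_inl, cons_val_zero, cons_val_one]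
  linear_combination ((quadForm z - 1) / 2) * I_sq

theorem conullCoord_isotropicLift (z : EuclideanSpace ℂ (Fin n)) :
    conullCoord (isotropicLift z) = quadForm z := by
  simp only [conullCoord, isotropicLift, Sum.elim_inl, cons_val_zero, cons_val_one]
  linear_combination (-(quadForm z - 1) / 2) * I_sq

theorem isotropicLift_inr (z : EuclideanSpace ℂ (Fin n)) (k : Fin n) :
    isotropicLift z (.inr k) = z k := rfl

theorem quadForm_sub (z w : EuclideanSpace ℂ (Fin n)) :
    quadForm (z - w) = quadForm z + quadForm w - 2 * ∑ k, z k * w k := by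
  simp only [quadForm, Finset.mul_sum, ← Finset.sum_add_distrib, ← Finset.sum_sub_distrib]
  exact Finset.sum_congr rfl fun k _ => by rw [PiLp.sub_apply]; ring

theorem two_mul_bilinForm_isotropicLift (z w : EuclideanSpace ℂ (Fin n)) :
    2 * bilinForm (isotropicLift z) (isotropicLift w) = quadForm (z - w) := by
  rw [bilinForm_eq, quadForm_sub]
  simp only [nullCoord_isotropicLift, conullCoord_isotropicLift, isotropicLift_inr]
  ring

theorem two_mul_bilinForm_isotropicLift_star (z w : EuclideanSpace ℂ (Fin n)) :
    2 * bilinForm (isotropicLift z) (star (isotropicLift w)) = hPoly z w := by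
  simp only [bilinForm_eq, hPoly, nullCoord_star, conullCoord_star, nullCoord_isotropicLift,
    conullCoord_isotropicLift, Pi.star_apply, isotropicLift_inr, RCLike.star_def, map_one]
  ring

theorem bilinForm_isotropicLift_self (z : EuclideanSpace ℂ (Fin n)) :
    bilinForm (isotropicLift z) (isotropicLift z) = 0 := by
  simpa [quadForm] using two_mul_bilinForm_isotropicLift z z

theorem isotropicLift_inr_eq_hua {z : EuclideanSpace ℂ (Fin n)} (hz : z ∈ lieBall n) :
    isotropicLift z ∘ .inr = (hua z).map ofReal *ᵥ (isotropicLift z ∘ .inl) := by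
  ext k
  change z k = _
  rw [hua_spec hz k]
  simp only [mulVec, dotProduct, Fin.sum_univ_two, map_apply, Function.comp_apply, isotropicLift,
    Sum.elim_inl, cons_val_zero, cons_val_one]
  ring

/-- The point of `ℂ^n` below an isotropic vector of `ℂ^(2+n)` whose first light-cone coordinate
does not vanish. -/
def isotropicPoint (x : Fin 2 ⊕ Fin n → ℂ) : EuclideanSpace ℂ (Fin n) :=
  WithLp.toLp 2 fun k => x (.inr k) / nullCoord x

variable {x : Fin 2 ⊕ Fin n → ℂ}

theorem eq_smul_isotropicLift (hx : bilinForm x x = 0) (h0 : nullCoord x ≠ 0) :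
    x = nullCoord x • isotropicLift (isotropicPoint x) := by
  refine ext_nullCoord ?_ ?_ fun k => ?_
  · rw [nullCoord_smul, nullCoord_isotropicLift, mul_one]
  · rw [conullCoord_smul, conullCoord_isotropicLift, quadForm]
    simp only [isotropicPoint, div_pow, ← Finset.sum_div, ← nullCoord_mul_conullCoord hx]
    field_simp
  · rw [Pi.smul_apply, isotropicLift_inr, smul_eq_mul]
    exact (mul_div_cancel₀ _ h0).symm

theorem isotropicPoint_mem_lieBall (hx : bilinForm x x = 0)
    (hpos : 0 < (2 * bilinForm x (star x)).re) (hlt : ‖conullCoord x‖ < ‖nullCoord x‖) :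
    isotropicPoint x ∈ lieBall n := by
  have h0 : 0 < ‖nullCoord x‖ := (norm_nonneg _).trans_lt hlt
  have hlift := eq_smul_isotropicLift hx (norm_pos_iff.1 h0)
  set y := isotropicPoint x
  set c := nullCoord x
  have hform : 2 * bilinForm x (star x)
      = ((‖c‖ ^ 2 * (1 - 2 * ‖y‖ ^ 2 + ‖quadForm y‖ ^ 2) : ℝ) : ℂ) := by
    rw [hlift, star_smul, bilinForm_smul_smul, mul_left_comm, two_mul_bilinForm_isotropicLift_star,
      hPoly_self, RCLike.star_def, mul_conj']
    push_cast
    rfl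
  have hq : ‖quadForm y‖ < 1 := by
    rw [hlift, conullCoord_smul, conullCoord_isotropicLift, norm_mul] at hlt
    exact (mul_lt_iff_lt_one_right h0).1 hlt
  rw [hform, ofReal_re, mul_pos_iff_of_pos_left (by positivity)] at hpos
  refine ⟨hpos, ?_⟩
  nlinarith [norm_nonneg y, norm_nonneg (quadForm y)]

theorem hua_isotropicPoint (hx : bilinForm x x = 0) (h0 : nullCoord x ≠ 0)
    (hmem : isotropicPoint x ∈ lieBall n) {Z : Matrix (Fin n) (Fin 2) ℝ}
    (hZ : x ∘ .inr = Z.map ofReal *ᵥ (x ∘ .inl)) : hua (isotropicPoint x) = Z := by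
  refine hua_unique hmem fun k => ?_
  have hk := congrFun hZ k
  rw [eq_smul_isotropicLift hx h0] at hk
  simp only [Function.comp_apply, Pi.smul_apply, smul_eq_mul, mulVec, dotProduct,
    Fin.sum_univ_two, map_apply, isotropicLift, Sum.elim_inl, Sum.elim_inr, cons_val_zero,
    cons_val_one] at hk
  refine mul_left_cancel₀ h0 (hk.trans ?_)
  ring

end IsotropicLift

noncomputable section AutomorphyFactor
open Complex Matrix

variable {n : ℕ}

theorem continuous_isotropicLift : Continuous (isotropicLift (n := n)) := by
  have hq := continuous_quadForm (n := n)
  refine continuous_pi fun i => ?_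
  rcases i with i | k
  · fin_cases i
    · change Continuous fun z : EuclideanSpace ℂ (Fin n) => (1 + quadForm z) / 2
      fun_prop
    · change Continuous fun z : EuclideanSpace ℂ (Fin n) => I * (quadForm z - 1) / 2
      fun_prop
  · change Continuous fun z : EuclideanSpace ℂ (Fin n) => z k
    fun_prop

theorem continuous_complexify : Continuous (complexify (n := n)) :=
  have hval : Continuous fun g : indefiniteSO n => g.1.1 :=
    continuous_subtype_val.comp continuous_subtype_val
  hval.matrix_map continuous_ofReal

theorem continuous_nullCoord : Continuous (nullCoord (n := n)) := by
  unfold nullCoord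
  fun_prop

theorem continuous_conullCoord : Continuous (conullCoord (n := n)) := by
  unfold conullCoord
  fun_prop

theorem continuousAt_isotropicPoint {x : Fin 2 ⊕ Fin n → ℂ} (hx : nullCoord x ≠ 0) :
    ContinuousAt isotropicPoint x := by
  refine (PiLp.continuous_toLp 2 _).continuousAt.comp (continuousAt_pi.2 fun k => ?_)
  exact (continuous_apply (Sum.inr k)).continuousAt.div continuous_nullCoord.continuousAt hx

theorem continuous_mulVec_isotropicLift :
    Continuous fun p : indefiniteSO n × EuclideanSpace ℂ (Fin n) =>
      complexify p.1 *ᵥ isotropicLift p.2 :=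
  (continuous_complexify.comp continuous_fst).matrix_mulVec
    (continuous_isotropicLift.comp continuous_snd)

/-- The automorphy factor of the action of `SO(2,n)` on the Lie ball. -/
def factor (g : indefiniteSO n) (z : EuclideanSpace ℂ (Fin n)) : ℂ :=
  nullCoord (complexify g *ᵥ isotropicLift z)

theorem continuous_factor :
    Continuous fun p : indefiniteSO n × EuclideanSpace ℂ (Fin n) => factor p.1 p.2 :=
  continuous_nullCoord.comp continuous_mulVec_isotropicLift

theorem continuous_factor_right (g : indefiniteSO n) :
    Continuous fun z : lieBall n => factor g z := by
  have hcont := continuous_factor.comp (Continuous.prodMk_right g)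
  exact hcont.comp continuous_subtype_val

theorem factor_one (z : EuclideanSpace ℂ (Fin n)) : factor 1 z = 1 := by
  rw [factor, complexify_one, one_mulVec, nullCoord_isotropicLift]

variable {g : indefiniteSO n} {z : EuclideanSpace ℂ (Fin n)}

theorem bilinForm_mulVec_isotropicLift_self (g : indefiniteSO n) (z : EuclideanSpace ℂ (Fin n)) :
    bilinForm (complexify g *ᵥ isotropicLift z) (complexify g *ᵥ isotropicLift z) = 0 := by
  rw [bilinForm_mulVec, bilinForm_isotropicLift_self]

theorem bilinForm_mulVec_isotropicLift_star_pos (g : indefiniteSO n) (hz : z ∈ lieBall n) :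
    0 < (2 * bilinForm (complexify g *ᵥ isotropicLift z)
      (star (complexify g *ᵥ isotropicLift z))).re := by
  rw [bilinForm_mulVec_star, two_mul_bilinForm_isotropicLift_star, hPoly_self, ofReal_re]
  exact hz.1

theorem norm_conullCoord_mulVec_lt (hg : g ∈ groupG n) (hz : z ∈ lieBall n) :
    ‖conullCoord (complexify g *ᵥ isotropicLift z)‖ < ‖factor g z‖ := by
  have hlift := continuous_mulVec_isotropicLift.comp (Continuous.prodMk_left z)
  have hcont : Continuous fun g : indefiniteSO n =>
      ‖factor g z‖ - ‖conullCoord (complexify g *ᵥ isotropicLift z)‖ :=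
    (continuous_nullCoord.comp hlift).norm.sub (continuous_conullCoord.comp hlift).norm
  refine sub_pos.1 (pos_of_isPreconnected (s := connectedComponent 1)
    isPreconnected_connectedComponent hcont.continuousOn (fun g _ h => ?_) mem_connectedComponent
    ?_ hg)
  · exact norm_conullCoord_ne (bilinForm_mulVec_isotropicLift_self g z)
      (bilinForm_mulVec_isotropicLift_star_pos g hz) (sub_eq_zero.1 h).symm
  · rw [factor_one, complexify_one, one_mulVec, conullCoord_isotropicLift, norm_one, sub_pos]
    exact norm_quadForm_lt_one hz

theorem factor_ne_zero (hg : g ∈ groupG n) (hz : z ∈ lieBall n) : factor g z ≠ 0 :=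
  norm_pos_iff.1 ((norm_nonneg _).trans_lt (norm_conullCoord_mulVec_lt hg hz))

theorem coe_smul_eq_isotropicPoint (hg : g ∈ groupG n) (z : lieBall n) :
    (g • z).1 = isotropicPoint (complexify g *ᵥ isotropicLift z.1) := by
  have hiso := bilinForm_mulVec_isotropicLift_self g z.1
  have hmem := isotropicPoint_mem_lieBall hiso (bilinForm_mulVec_isotropicLift_star_pos g z.2)
    (norm_conullCoord_mulVec_lt hg z.2)
  have hhua := hua_isotropicPoint hiso (factor_ne_zero hg z.2) hmem
    (inr_mulVec_eq_moebius g (hua_mem z.2) (isotropicLift_inr_eq_hua z.2))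
  have hsmul : g • z = ⟨_, hmem⟩ := (huaEquiv n).injective <| by
    rw [huaEquiv_smul]
    exact Subtype.ext hhua.symm
  rw [hsmul]

theorem mulVec_isotropicLift (hg : g ∈ groupG n) (z : lieBall n) :
    complexify g *ᵥ isotropicLift z.1 = factor g z • isotropicLift (g • z).1 := by
  rw [coe_smul_eq_isotropicPoint hg]
  exact eq_smul_isotropicLift (bilinForm_mulVec_isotropicLift_self g z.1) (factor_ne_zero hg z.2)

theorem factor_mul (g : indefiniteSO n) {g' : indefiniteSO n} (hg' : g' ∈ groupG n)
    (z : lieBall n) : factor (g * g') z = factor g (g' • z).1 * factor g' z := by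
  rw [factor, complexify_mul, ← mulVec_mulVec, mulVec_isotropicLift hg', mulVec_smul,
    nullCoord_smul, mul_comm, factor, factor]

theorem hPoly_smul (hg : g ∈ groupG n) (z w : lieBall n) :
    factor g z * conj (factor g w) * hPoly (g • z).1 (g • w).1 = hPoly z.1 w.1 := by
  rw [← two_mul_bilinForm_isotropicLift_star, ← two_mul_bilinForm_isotropicLift_star,
    ← bilinForm_mulVec_star g (isotropicLift z.1), mulVec_isotropicLift hg,
    mulVec_isotropicLift hg, star_smul, bilinForm_smul_smul, RCLike.star_def, mul_left_comm]

theorem quadForm_smul_sub (hg : g ∈ groupG n) (z w : lieBall n) :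
    factor g z * factor g w * quadForm ((g • z).1 - (g • w).1) = quadForm (z.1 - w.1) := by
  rw [← two_mul_bilinForm_isotropicLift, ← two_mul_bilinForm_isotropicLift,
    ← bilinForm_mulVec g (isotropicLift z.1), mulVec_isotropicLift hg, mulVec_isotropicLift hg,
    bilinForm_smul_smul, mul_left_comm]

instance : ContinuousSMul (groupG n) (lieBall n) where
  continuous_smul := by
    have hval : Continuous fun p : groupG n × lieBall n => (p.1.1, p.2.1) :=
      (continuous_subtype_val.comp continuous_fst).prodMk
        (continuous_subtype_val.comp continuous_snd)
    have hlift := continuous_mulVec_isotropicLift.comp hval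
    refine continuous_induced_rng.2 (continuous_iff_continuousAt.2 fun p => ?_)
    have hpoint := (continuousAt_isotropicPoint (factor_ne_zero p.1.2 p.2.2)).comp
      (f := fun p : groupG n × lieBall n => complexify p.1.1 *ᵥ isotropicLift p.2.1)
      hlift.continuousAt
    refine hpoint.congr (.of_forall fun p => ?_)
    exact (coe_smul_eq_isotropicPoint p.1.2 p.2).symm

end AutomorphyFactor

noncomputable section Reflection
open Matrix

variable {ι 𝕜 : Type*} [Fintype ι] [DecidableEq ι] [Field 𝕜]

/-- The reflection in the hyperplane orthogonal to `w` with respect to the bilinear form with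
symmetric Gram matrix `J`. -/
def reflectionMatrix (J : Matrix ι ι 𝕜) (w : ι → 𝕜) : Matrix ι ι 𝕜 :=
  1 - (2 / (w ⬝ᵥ J *ᵥ w)) • vecMulVec w (w ᵥ* J)

theorem reflectionMatrix_mulVec (J : Matrix ι ι 𝕜) (w v : ι → 𝕜) :
    reflectionMatrix J w *ᵥ v = v - (2 * (w ⬝ᵥ J *ᵥ v) / (w ⬝ᵥ J *ᵥ w)) • w := by
  rw [reflectionMatrix, sub_mulVec, one_mulVec, smul_mulVec, vecMulVec_mulVec, ← dotProduct_mulVec,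
    op_smul_eq_smul, smul_smul, div_mul_eq_mul_div]

theorem reflectionMatrix_mulVec_of_dotProduct_eq_zero {J : Matrix ι ι 𝕜} {w v : ι → 𝕜}
    (h : w ⬝ᵥ J *ᵥ v = 0) : reflectionMatrix J w *ᵥ v = v := by
  rw [reflectionMatrix_mulVec, h, mul_zero, zero_div, zero_smul, sub_zero]

theorem reflectionMatrix_map {𝕜' : Type*} [Field 𝕜'] (f : 𝕜 →+* 𝕜') (J : Matrix ι ι 𝕜)
    (w : ι → 𝕜) : (reflectionMatrix J w).map f = reflectionMatrix (J.map f) (f ∘ w) := by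
  have hd : f (w ⬝ᵥ J *ᵥ w) = (f ∘ w) ⬝ᵥ J.map f *ᵥ (f ∘ w) := by
    rw [RingHom.map_dotProduct]
    congr 1
    exact funext fun i => RingHom.map_mulVec f J w i
  ext i j
  simp only [reflectionMatrix, map_apply, Matrix.sub_apply, Matrix.smul_apply, vecMulVec_apply,
    map_sub, map_mul, map_div₀, map_ofNat, smul_eq_mul, hd, RingHom.map_vecMul, one_apply,
    apply_ite f, map_one, map_zero, Function.comp_apply]

variable {J : Matrix ι ι 𝕜} {w : ι → 𝕜}

theorem reflectionMatrix_mul_self (hw : w ⬝ᵥ J *ᵥ w ≠ 0) :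
    reflectionMatrix J w * reflectionMatrix J w = 1 := by
  refine ext_of_mulVec_single fun i => ?_
  rw [← mulVec_mulVec, one_mulVec, reflectionMatrix_mulVec, reflectionMatrix_mulVec, sub_sub,
    ← add_smul, mulVec_sub, mulVec_smul, dotProduct_sub, dotProduct_smul, smul_eq_mul,
    div_mul_cancel₀ _ hw, ← add_div, sub_eq_self]
  ring_nf
  exact zero_smul 𝕜 w

theorem transpose_reflectionMatrix_mul_mul (hJ : J.IsSymm) (hw : w ⬝ᵥ J *ᵥ w ≠ 0) :
    (reflectionMatrix J w)ᵀ * J * reflectionMatrix J w = J := by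
  have hJw : w ᵥ* J = J *ᵥ w := by rw [← mulVec_transpose, hJ.eq]
  have hcomm : (reflectionMatrix J w)ᵀ * J = J * reflectionMatrix J w := by
    simp only [reflectionMatrix, transpose_sub, transpose_one, transpose_smul,
      transpose_vecMulVec, Matrix.sub_mul, Matrix.mul_sub, Matrix.one_mul, Matrix.mul_one,
      Matrix.smul_mul, Matrix.mul_smul, vecMulVec_mul, mul_vecMulVec, hJw]
  rw [hcomm, Matrix.mul_assoc, reflectionMatrix_mul_self hw, Matrix.mul_one]

theorem det_reflectionMatrix (hw : w ⬝ᵥ J *ᵥ w ≠ 0) : (reflectionMatrix J w).det = -1 := by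
  have h : reflectionMatrix J w = 1 + replicateCol Unit (-(2 / (w ⬝ᵥ J *ᵥ w)) • w)
      * replicateRow Unit (w ᵥ* J) := by
    rw [← vecMulVec_eq, smul_vecMulVec, neg_smul, ← sub_eq_add_neg, reflectionMatrix]
  rw [h, det_one_add_replicateCol_mul_replicateRow, dotProduct_smul, ← dotProduct_mulVec,
    smul_eq_mul]
  field_simp
  norm_num

theorem continuous_reflectionMatrix {T : Type*} [TopologicalSpace T] [TopologicalSpace 𝕜]
    [IsTopologicalDivisionRing 𝕜] {w : T → ι → 𝕜} (hw : Continuous w)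
    (h0 : ∀ t, w t ⬝ᵥ J *ᵥ w t ≠ 0) : Continuous fun t => reflectionMatrix J (w t) := by
  have hJw : Continuous fun t => w t ᵥ* J := hw.matrix_vecMul continuous_const
  have hd : Continuous fun t => w t ⬝ᵥ J *ᵥ w t := by
    simp only [dotProduct_mulVec]
    exact hJw.dotProduct hw
  exact continuous_const.sub ((continuous_const.div hd h0).smul (hw.matrix_vecMulVec hJw))

end Reflection

noncomputable section Transitivity
open Complex Matrix

variable {n : ℕ}

theorem groupH_le_realStabilizer (n : ℕ) : groupH n ≤ realStabilizer n := by
  rintro _ ⟨g, _, rfl⟩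
  exact g.2

theorem groupH_le_groupG (n : ℕ) : groupH n ≤ groupG n :=
  fun _ h => (groupH_le_realStabilizer n h).1

/-- The centre of the Lie ball. -/
abbrev origin (n : ℕ) : lieBall n := ⟨0, zero_mem_lieBall n⟩

theorem origin_mem_lieBallReal (n : ℕ) : origin n ∈ lieBallReal n := fun _ => rfl

theorem mem_realStabilizer_of_mulVec_eq {g : indefiniteSO n} (hg : g ∈ groupG n)
    (hfix : g.1.1 *ᵥ Sum.elim ![0, 1] 0 = Sum.elim ![0, 1] 0) : g ∈ realStabilizer n := by
  refine ⟨hg, fun z hz => ?_⟩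
  have hcol (Z : Matrix (Fin n) (Fin 2) ℝ) : (∀ k, Z k 1 = 0) ↔ Z *ᵥ ![0, 1] = 0 := by
    simp [funext_iff, mulVec, dotProduct, Fin.sum_univ_two]
  rw [mem_lieBallReal_iff, hcol] at hz ⊢
  obtain ⟨hden, hnum⟩ := Sum.elim_eq_iff.1
    ((mulVec_elim g.1.1 (huaEquiv n z).1 ![0, 1]).symm.trans (by rw [hz, hfix]))
  have hunit := (isUnit_iff_isUnit_det _).1 (isUnit_moebius_den g.2 (huaEquiv n z).2)
  rw [huaEquiv_smul, ← hnum]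
  change moebius g.1.1 (huaEquiv n z).1 *ᵥ ![0, 1] = _
  nth_rw 1 [← hden]
  rw [mulVec_mulVec, moebius, Matrix.mul_assoc, nonsing_inv_mul _ hunit, Matrix.mul_one]

/-- The real vector `(1, 0, x)`, of squared length `1 - ‖x‖²`. -/
def boostVec (x : EuclideanSpace ℝ (Fin n)) : Fin 2 ⊕ Fin n → ℝ := Sum.elim ![1, 0] x

theorem continuous_boostVec : Continuous (boostVec (n := n)) := by
  refine continuous_pi fun i => ?_
  rcases i with i | k
  · exact continuous_const
  · change Continuous fun x : EuclideanSpace ℝ (Fin n) => x k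
    fun_prop

theorem boostVec_dotProduct_self (x : EuclideanSpace ℝ (Fin n)) :
    boostVec x ⬝ᵥ formMatrix n *ᵥ boostVec x = 1 - ‖x‖ ^ 2 := by
  rw [boostVec, form_elim, EuclideanSpace.real_norm_sq_eq]
  simp [dotProduct, Fin.sum_univ_two, sq]

theorem boostVec_dotProduct_self_ne_zero (x : Metric.ball (0 : EuclideanSpace ℝ (Fin n)) 1) :
    boostVec x.1 ⬝ᵥ formMatrix n *ᵥ boostVec x.1 ≠ 0 := by
  have hx : ‖x.1‖ < 1 := mem_ball_zero_iff.1 x.2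
  rw [boostVec_dotProduct_self]
  nlinarith [norm_nonneg x.1]

/-- The product of the reflections along `(1, 0, 0)` and `(1, 0, x)`: it maps the centre of the Lie
ball to the real point `x`. -/
def boost (x : Metric.ball (0 : EuclideanSpace ℝ (Fin n)) 1) : indefiniteSO n :=
  have h₀ : boostVec (0 : EuclideanSpace ℝ (Fin n)) ⬝ᵥ formMatrix n *ᵥ boostVec 0 ≠ 0 :=
    boostVec_dotProduct_self_ne_zero ⟨0, Metric.mem_ball_self one_pos⟩
  have hx := boostVec_dotProduct_self_ne_zero x
  have hsymm : (formMatrix n).IsSymm := by simp [Matrix.IsSymm, formMatrix, fromBlocks_transpose]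
  have hmul (A B : Matrix (Fin 2 ⊕ Fin n) (Fin 2 ⊕ Fin n) ℝ) :
      (A * B)ᵀ * formMatrix n * (A * B) = Bᵀ * (Aᵀ * formMatrix n * A) * B := by
    simp only [transpose_mul, Matrix.mul_assoc]
  ⟨⟨reflectionMatrix (formMatrix n) (boostVec x.1) * reflectionMatrix (formMatrix n) (boostVec 0),
    by rw [det_mul, det_reflectionMatrix h₀, det_reflectionMatrix hx, neg_one_mul, neg_neg]⟩,
    (hmul _ _).trans <| by
      rw [transpose_reflectionMatrix_mul_mul hsymm hx, transpose_reflectionMatrix_mul_mul hsymm h₀]⟩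

theorem continuous_boost : Continuous (boost (n := n)) :=
  Continuous.subtype_mk (Continuous.subtype_mk ((continuous_reflectionMatrix
    (continuous_boostVec.comp continuous_subtype_val) boostVec_dotProduct_self_ne_zero).matrix_mul
      continuous_const) _) _

theorem boost_zero : boost ⟨0, Metric.mem_ball_self one_pos⟩ = (1 : indefiniteSO n) :=
  Subtype.ext <| Subtype.ext <| reflectionMatrix_mul_self <|
    boostVec_dotProduct_self_ne_zero ⟨0, Metric.mem_ball_self one_pos⟩

theorem boost_mem_groupG (x : Metric.ball (0 : EuclideanSpace ℝ (Fin n)) 1) :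
    boost x ∈ groupG n :=
  have := isPreconnected_iff_preconnectedSpace.1
    (convex_ball (0 : EuclideanSpace ℝ (Fin n)) 1).isPreconnected
  (isPreconnected_range continuous_boost).subset_connectedComponent ⟨_, boost_zero⟩ ⟨x, rfl⟩

theorem boost_mem_realStabilizer (x : Metric.ball (0 : EuclideanSpace ℝ (Fin n)) 1) :
    boost x ∈ realStabilizer n := by
  refine mem_realStabilizer_of_mulVec_eq (boost_mem_groupG x) ?_
  have horth (y : EuclideanSpace ℝ (Fin n)) :
      boostVec y ⬝ᵥ formMatrix n *ᵥ Sum.elim ![0, 1] 0 = 0 := by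
    simp [boostVec, formMatrix, fromBlocks_mulVec]
  change (_ * _) *ᵥ _ = _
  rw [← mulVec_mulVec, reflectionMatrix_mulVec_of_dotProduct_eq_zero (horth 0),
    reflectionMatrix_mulVec_of_dotProduct_eq_zero (horth x)]

theorem boost_mem_groupH (x : Metric.ball (0 : EuclideanSpace ℝ (Fin n)) 1) :
    boost x ∈ groupH n :=
  have := isPreconnected_iff_preconnectedSpace.1
    (convex_ball (0 : EuclideanSpace ℝ (Fin n)) 1).isPreconnected
  have hcont : Continuous fun x : Metric.ball (0 : EuclideanSpace ℝ (Fin n)) 1 =>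
      (⟨boost x, boost_mem_realStabilizer x⟩ : realStabilizer n) :=
    continuous_boost.subtype_mk _
  ⟨⟨boost x, boost_mem_realStabilizer x⟩, (isPreconnected_range hcont).subset_connectedComponent
    (x := (1 : realStabilizer n)) ⟨_, Subtype.ext boost_zero⟩ ⟨x, rfl⟩, rfl⟩

theorem bilinForm_boostVec (x : EuclideanSpace ℝ (Fin n)) (v : Fin 2 ⊕ Fin n → ℂ) :
    bilinForm (ofReal ∘ boostVec x) v = v (.inl 0) - ∑ k, x k * v (.inr k) := by
  rw [bilinForm_eq]
  simp only [nullCoord, conullCoord, boostVec, Function.comp_apply, Sum.elim_inl, Sum.elim_inr,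
    cons_val_zero, cons_val_one]
  push_cast
  ring

theorem map_reflectionMatrix_boostVec_mulVec (x : EuclideanSpace ℝ (Fin n))
    (v : Fin 2 ⊕ Fin n → ℂ) :
    (reflectionMatrix (formMatrix n) (boostVec x)).map ofRealHom *ᵥ v
      = v - (2 * (v (.inl 0) - ∑ k, x k * v (.inr k)) / (1 - ‖x‖ ^ 2 : ℝ))
        • (ofReal ∘ boostVec x) := by
  have hself : bilinForm (ofReal ∘ boostVec x) (ofReal ∘ boostVec x) = (1 - ‖x‖ ^ 2 : ℝ) := by
    rw [bilinForm_boostVec, EuclideanSpace.real_norm_sq_eq]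
    simp [boostVec, sq]
  rw [reflectionMatrix_map, reflectionMatrix_mulVec, ← hself, ← bilinForm_boostVec]
  rfl

theorem complexify_boost_mulVec_isotropicLift_zero
    (x : Metric.ball (0 : EuclideanSpace ℝ (Fin n)) 1) :
    complexify (boost x) *ᵥ isotropicLift 0 = isotropicLift 0 - ofReal ∘ boostVec 0
      + (1 / (1 - ‖x.1‖ ^ 2 : ℝ) : ℂ) • (ofReal ∘ boostVec x.1) := by
  have hmul : complexify (boost x) = (reflectionMatrix (formMatrix n) (boostVec x.1)).map ofRealHom
      * (reflectionMatrix (formMatrix n) (boostVec 0)).map ofRealHom :=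
    Matrix.map_mul (f := ofRealHom)
  have hzero : (reflectionMatrix (formMatrix n) (boostVec 0)).map ofRealHom *ᵥ isotropicLift 0
      = isotropicLift 0 - ofReal ∘ boostVec 0 := by
    rw [map_reflectionMatrix_boostVec_mulVec]
    simp [isotropicLift, quadForm]
  rw [hmul, ← mulVec_mulVec, hzero, map_reflectionMatrix_boostVec_mulVec, sub_eq_add_neg,
    ← neg_smul]
  have hinl : (isotropicLift 0 - ofReal ∘ boostVec 0 : Fin 2 ⊕ Fin n → ℂ) (.inl 0) = -1 / 2 := by
    norm_num [isotropicLift, quadForm, boostVec]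
  have hinr (k : Fin n) :
      (isotropicLift 0 - ofReal ∘ boostVec 0 : Fin 2 ⊕ Fin n → ℂ) (.inr k) = 0 := by
    simp [isotropicLift, boostVec]
  simp only [hinl, hinr, mul_zero, Finset.sum_const_zero, sub_zero, ← neg_div]
  norm_num

theorem boost_smul_origin (x : Metric.ball (0 : EuclideanSpace ℝ (Fin n)) 1) (k : Fin n) :
    (boost x • origin n).1 k = x.1 k := by
  rw [coe_smul_eq_isotropicPoint (boost_mem_groupG x), complexify_boost_mulVec_isotropicLift_zero]
  have hx : (1 - ‖x.1‖ ^ 2 : ℝ) ≠ 0 := by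
    rw [← boostVec_dotProduct_self]
    exact boostVec_dotProduct_self_ne_zero x
  have hx' := ofReal_ne_zero.2 hx
  generalize ((1 - ‖x.1‖ ^ 2 : ℝ) : ℂ) = d at hx' ⊢
  set v := isotropicLift 0 - ofReal ∘ boostVec 0 + (1 / d) • (ofReal ∘ boostVec x.1)
  have hnull : nullCoord v = 1 / d := by
    simp [v, nullCoord, isotropicLift, quadForm, boostVec]
    linear_combination (-1 / 2 : ℂ) * I_sq
  have hinr : v (.inr k) = 1 / d * x.1 k := by
    simp [v, isotropicLift, boostVec]
  change v (.inr k) / nullCoord v = x.1 k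
  rw [hnull, hinr, mul_div_cancel_left₀ _ (one_div_ne_zero hx')]

theorem exists_smul_origin_eq {z : lieBall n} (hz : z ∈ lieBallReal n) :
    ∃ g : groupH n, g • origin n = z := by
  set x : EuclideanSpace ℝ (Fin n) := WithLp.toLp 2 fun i => (z.1 i).re
  have hzx (i : Fin n) : (x i : ℂ) = z.1 i := conj_eq_iff_re.1 (conj_eq_iff_im.2 (hz i))
  have hx : x ∈ Metric.ball 0 1 := by
    have hnorm : ‖x‖ = ‖z.1‖ := by simp only [EuclideanSpace.norm_eq, ← hzx, norm_real]
    rw [mem_ball_zero_iff, hnorm]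
    exact z.2.2
  exact ⟨⟨boost ⟨x, hx⟩, boost_mem_groupH _⟩, Subtype.ext <| PiLp.ext fun k =>
    (boost_smul_origin ⟨x, hx⟩ k).trans (hzx k)⟩

end Transitivity

noncomputable section FactorPositivity
open Complex Matrix
open scoped ComplexOrder

variable {n : ℕ} {g : indefiniteSO n} {z w : lieBall n}

theorem hPoly_pos (hn : 2 ≤ n) (hz : z ∈ lieBallReal n) (hw : w ∈ lieBallReal n) :
    0 < hPoly z.1 w.1 := by
  have hz' (i : Fin n) := conj_eq_iff_im.2 (hz i)
  have hw' (i : Fin n) := conj_eq_iff_im.2 (hw i)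
  have him : (hPoly z.1 w.1).im = 0 := by
    rw [← conj_eq_iff_im]
    simp only [hPoly, quadForm, map_add, map_sub, map_mul, map_pow, map_one, map_ofNat, map_sum,
      hz', hw']
  exact pos_iff.2 ⟨(hPoly_mem_slitPlane hn z.2 w.2).resolve_right fun h => h him, him.symm⟩

theorem quadForm_sub_pos (hz : z ∈ lieBallReal n) (hw : w ∈ lieBallReal n) (hne : z ≠ w) :
    0 < quadForm (z.1 - w.1) := by
  have hz' (i : Fin n) := conj_eq_iff_re.1 (conj_eq_iff_im.2 (hz i))
  have hw' (i : Fin n) := conj_eq_iff_re.1 (conj_eq_iff_im.2 (hw i))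
  obtain ⟨i, hi⟩ : ∃ i, (z.1 i).re ≠ (w.1 i).re := by
    by_contra! h
    exact hne (Subtype.ext (PiLp.ext fun i => by rw [← hz', ← hw', h]))
  have hsum : quadForm (z.1 - w.1) = (∑ i, ((z.1 i).re - (w.1 i).re) ^ 2 : ℝ) := by
    simp only [quadForm, PiLp.sub_apply, ofReal_sum, ofReal_pow, ofReal_sub, hz', hw']
  rw [hsum, zero_lt_real]
  exact Finset.sum_pos' (fun _ _ => sq_nonneg _)
    ⟨i, Finset.mem_univ i, sq_pos_of_ne_zero (sub_ne_zero.2 hi)⟩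

theorem factor_mul_conj_factor_pos (hn : 2 ≤ n) (hg : g ∈ realStabilizer n)
    (hz : z ∈ lieBallReal n) (hw : w ∈ lieBallReal n) :
    0 < factor g z * conj (factor g w) := by
  have h := hPoly_smul hg.1 z w ▸ hPoly_pos hn hz hw
  exact (pos_iff_pos_of_mul_pos h).2 (hPoly_pos hn (hg.2 z hz) (hg.2 w hw))

theorem factor_mul_factor_pos (hg : g ∈ realStabilizer n)
    (hz : z ∈ lieBallReal n) (hw : w ∈ lieBallReal n) (hne : z ≠ w) :
    0 < factor g z * factor g w := by
  have h := quadForm_smul_sub hg.1 z w ▸ quadForm_sub_pos hz hw hne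
  exact (pos_iff_pos_of_mul_pos h).2 (quadForm_sub_pos (hg.2 z hz) (hg.2 w hw)
    fun h => hne (MulAction.injective g h))

theorem im_eq_zero_of_mul_pos_of_mul_conj_pos {u v : ℂ} (h : 0 < u * v) (h' : 0 < u * conj v) :
    u.im = 0 := by
  obtain ⟨hre, him⟩ := pos_iff.1 h
  obtain ⟨hre', him'⟩ := pos_iff.1 h'
  simp only [mul_re, mul_im, conj_re, conj_im] at hre him hre' him'
  have huv : 2 * (u.im * v.re) = 0 := by linarith
  rcases mul_eq_zero.1 ((mul_eq_zero.1 huv).resolve_left two_ne_zero) with hu | hv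
  · exact hu
  · rw [hv] at hre hre'
    linarith

theorem exists_mem_lieBallReal_ne_origin (hn : 0 < n) : ∃ w ∈ lieBallReal n, origin n ≠ w := by
  set w : EuclideanSpace ℂ (Fin n) := EuclideanSpace.single ⟨0, hn⟩ (1 / 2)
  have hnorm : ‖w‖ = 1 / 2 := by rw [PiLp.norm_single]; norm_num
  have hw : w ∈ lieBall n :=
    ⟨by rw [hnorm]; nlinarith [sq_nonneg ‖quadForm w‖], by rw [hnorm]; norm_num⟩
  refine ⟨⟨w, hw⟩, fun i => ?_, fun h => ?_⟩
  · by_cases hi : i = ⟨0, hn⟩ <;> simp [w, hi]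
  · have hw0 : w = 0 := (congrArg Subtype.val h).symm
    rw [hw0, norm_zero] at hnorm
    norm_num at hnorm

theorem factor_origin_im (hn : 2 ≤ n) (hg : g ∈ realStabilizer n) :
    (factor g (origin n)).im = 0 := by
  obtain ⟨w, hw, hne⟩ := exists_mem_lieBallReal_ne_origin (zero_lt_two.trans_le hn)
  have h0 := origin_mem_lieBallReal n
  exact im_eq_zero_of_mul_pos_of_mul_conj_pos (factor_mul_factor_pos hg h0 hw hne)
    (factor_mul_conj_factor_pos hn hg h0 hw)

theorem factor_origin_pos (hn : 2 ≤ n) (hg : g ∈ groupH n) : 0 < factor g (origin n) := by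
  obtain ⟨g, hg', rfl⟩ := Subgroup.mem_map.1 hg
  let f (g : realStabilizer n) : ℝ := (factor g.1 (origin n)).re
  have hcont : Continuous f :=
    continuous_re.comp ((continuous_factor.comp (Continuous.prodMk_left _)).comp
      continuous_subtype_val)
  have hne (g : realStabilizer n) : f g ≠ 0 := fun h =>
    factor_ne_zero g.2.1 (origin n).2 (Complex.ext h (factor_origin_im hn g.2))
  have hone : 0 < f 1 := by
    rw [show f 1 = 1 from congrArg re (factor_one _)]
    exact one_pos
  exact pos_iff.2 ⟨pos_of_isPreconnected isPreconnected_connectedComponent hcont.continuousOn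
    (fun g _ => hne g) mem_connectedComponent hone hg', (factor_origin_im hn g.2).symm⟩

theorem factor_pos (hn : 2 ≤ n) (hg : g ∈ groupH n) (hz : z ∈ lieBallReal n) : 0 < factor g z := by
  obtain ⟨g', rfl⟩ := exists_smul_origin_eq hz
  have hmul := factor_mul g (groupH_le_groupG n g'.2) (origin n)
  have hgg' := factor_origin_pos hn (mul_mem hg g'.2)
  rw [hmul] at hgg'
  exact (pos_iff_pos_of_mul_pos hgg').2 (factor_origin_pos hn g'.2)

theorem factor_mem_slitPlane (hn : 2 ≤ n) (hg : g ∈ groupH n) (z : lieBall n) :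
    factor g z ∈ slitPlane := by
  set w := g⁻¹ • origin n with hw
  have hwReal := (groupH_le_realStabilizer n (inv_mem hg)).2 _ (origin_mem_lieBallReal n)
  obtain ⟨r, hr, hfactor⟩ : ∃ r : ℝ, 0 < r ∧ (r : ℂ) = factor g w :=
    RCLike.pos_iff_exists_ofReal.1 (factor_pos hn hg hwReal)
  have hmul : factor g z * r = hPoly z.1 w.1 := by
    rw [← hPoly_smul (groupH_le_groupG n hg) z w, ← hfactor, conj_ofReal, hw, smul_inv_smul]
    simp [hPoly, quadForm]
  have hslit := hPoly_mem_slitPlane hn z.2 w.2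
  rwa [← hmul, mem_slitPlane_iff, re_mul_ofReal, im_mul_ofReal, mul_pos_iff_of_pos_right hr,
    mul_ne_zero_iff_right hr.ne', ← mem_slitPlane_iff] at hslit

end FactorPositivity

noncomputable section LieBall
open Complex

theorem isOpen_lieBall (n : ℕ) : IsOpen (lieBall n) := by
  have hq := continuous_quadForm (n := n)
  have hcont : Continuous fun z : EuclideanSpace ℂ (Fin n) =>
      1 - 2 * ‖z‖ ^ 2 + ‖quadForm z‖ ^ 2 := by fun_prop
  exact (isOpen_lt continuous_const hcont).inter (isOpen_lt continuous_norm continuous_const)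

theorem starConvex_lieBall (n : ℕ) : StarConvex ℝ 0 (lieBall n) :=
  starConvex_zero_iff.2 fun z hz t ht₀ ht₁ => by
    rw [← Complex.coe_smul]
    exact smul_mem_lieBall_of_mem_Icc hz ⟨ht₀, ht₁⟩

instance preconnectedSpace_lieBall (n : ℕ) : PreconnectedSpace (lieBall n) :=
  isPreconnected_iff_preconnectedSpace.1
    ((starConvex_lieBall n).isPathConnected (zero_mem_lieBall n)).isConnected.isPreconnected

end LieBall

noncomputable section Jacobian
open Complex Matrix Filter Topology

variable {n : ℕ} {g : indefiniteSO n}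

theorem contDiff_quadForm {m : WithTop ℕ∞} : ContDiff ℂ m (quadForm (n := n)) := by
  unfold quadForm
  fun_prop

theorem contDiff_isotropicLift {m : WithTop ℕ∞} : ContDiff ℂ m (isotropicLift (n := n)) := by
  have hq := contDiff_quadForm (n := n) (m := m)
  refine contDiff_pi.2 fun i => ?_
  rcases i with i | k
  · fin_cases i <;>
      simp only [isotropicLift, Sum.elim_inl, Fin.zero_eta, Fin.mk_one, cons_val_zero,
        cons_val_one] <;> fun_prop
  · simp only [isotropicLift_inr]
    fun_prop

theorem contDiffAt_isotropicPoint_mulVec {m : WithTop ℕ∞}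
    {p : (Fin 2 ⊕ Fin n → Fin 2 ⊕ Fin n → ℂ) × EuclideanSpace ℂ (Fin n)}
    (hp : nullCoord (of p.1 *ᵥ isotropicLift p.2) ≠ 0) :
    ContDiffAt ℂ m (fun p : (Fin 2 ⊕ Fin n → Fin 2 ⊕ Fin n → ℂ) × EuclideanSpace ℂ (Fin n) =>
      isotropicPoint (of p.1 *ᵥ isotropicLift p.2)) p := by
  have hmulVec (i : Fin 2 ⊕ Fin n) : ContDiff ℂ m
      fun p : (Fin 2 ⊕ Fin n → Fin 2 ⊕ Fin n → ℂ) × EuclideanSpace ℂ (Fin n) =>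
        (of p.1 *ᵥ isotropicLift p.2) i := by
    have hlift (j : Fin 2 ⊕ Fin n) := contDiff_pi.1 (contDiff_isotropicLift (m := m)) j
    simp only [mulVec, dotProduct, of_apply]
    fun_prop
  refine contDiffAt_euclidean.2 fun k => ((hmulVec (.inr k)).contDiffAt).div ?_ hp
  exact ((hmulVec (.inl 0)).add (contDiff_const.mul (hmulVec (.inl 1)))).contDiffAt

theorem transformation_apply (g : indefiniteSO n) (z : lieBall n) :
    transformation g z = (g • z).1 :=
  Subtype.val_injective.extend_apply _ _ z

theorem transformation_eventuallyEq (hg : g ∈ groupG n) (z : lieBall n) :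
    transformation g =ᶠ[𝓝 z.1] fun w => isotropicPoint (complexify g *ᵥ isotropicLift w) := by
  filter_upwards [(isOpen_lieBall n).mem_nhds z.2] with w hw
  rw [← coe_smul_eq_isotropicPoint hg ⟨w, hw⟩]
  exact transformation_apply g ⟨w, hw⟩

theorem differentiableAt_transformation (hg : g ∈ groupG n) (z : lieBall n) :
    DifferentiableAt ℂ (transformation g) z := by
  refine DifferentiableAt.congr_of_eventuallyEq ?_ (transformation_eventuallyEq hg z)
  exact (contDiffAt_isotropicPoint_mulVec (m := 1) (factor_ne_zero hg z.2)
    (p := (complexify g, z.1))).differentiableAt one_ne_zero |>.comp z.1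
    ((differentiableAt_const _).prodMk differentiableAt_id)

theorem continuousOn_jacobian (z : lieBall n) :
    ContinuousOn (fun g => jacobian g z) (groupG n : Set (indefiniteSO n)) := by
  intro g hg
  have hfderiv := (ContDiffAt.fderiv (E := Fin 2 ⊕ Fin n → Fin 2 ⊕ Fin n → ℂ) (m := 0) (n := 1)
    (f := fun M w => isotropicPoint (of M *ᵥ isotropicLift w)) (g := fun _ => z.1)
    (x₀ := complexify g) (contDiffAt_isotropicPoint_mulVec (factor_ne_zero hg z.2))
    contDiffAt_const le_rfl).continuousAt
  refine ((ContinuousLinearMap.continuous_det.continuousAt.comp hfderiv).comp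
    continuous_complexify.continuousAt).continuousWithinAt.congr (fun g' hg' => ?_) ?_
  · exact congrArg ContinuousLinearMap.det (transformation_eventuallyEq hg' z).fderiv_eq
  · exact congrArg ContinuousLinearMap.det (transformation_eventuallyEq hg z).fderiv_eq

theorem jacobian_one (z : lieBall n) : jacobian 1 z = 1 := by
  have hone : transformation 1 =ᶠ[𝓝 z.1] id := by
    filter_upwards [(isOpen_lieBall n).mem_nhds z.2] with w hw
    rw [transformation_apply 1 ⟨w, hw⟩, one_smul, id_eq]
  rw [jacobian, hone.fderiv_eq, fderiv_id]
  exact LinearMap.det_id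

-- Let `w → z` along `v` in `quadForm_smul_sub`.
theorem factor_sq_mul_quadForm_fderiv (hg : g ∈ groupG n) (z : lieBall n)
    (v : EuclideanSpace ℂ (Fin n)) :
    factor g z ^ 2 * quadForm (fderiv ℂ (transformation g) z v) = quadForm v := by
  have hline : Continuous fun t : ℂ => z.1 + t • v := by fun_prop
  have hline0 : z.1 + (0 : ℂ) • v = z := by rw [zero_smul, add_zero]
  have hslope :=
    ((differentiableAt_transformation hg z).hasFDerivAt.hasLineDerivAt v).tendsto_slope_zero
  have hfactor : Tendsto (fun t : ℂ => factor g (z.1 + t • v)) (𝓝[≠] 0) (𝓝 (factor g z)) := by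
    have hcont := continuous_factor.comp ((Continuous.prodMk_right g).comp hline)
    have := hcont.tendsto 0
    simp only [Function.comp_def, hline0] at this
    exact this.mono_left nhdsWithin_le_nhds
  have hlim := (hfactor.mul_const (factor g z)).mul ((continuous_quadForm.tendsto _).comp hslope)
  rw [sq]
  refine tendsto_nhds_unique hlim (tendsto_const_nhds.congr' ?_)
  have hmem : ∀ᶠ t : ℂ in 𝓝[≠] 0, z.1 + t • v ∈ lieBall n :=
    nhdsWithin_le_nhds (hline.continuousAt.eventually
      ((isOpen_lieBall n).mem_nhds (by simpa only [hline0] using z.2)))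
  filter_upwards [hmem, self_mem_nhdsWithin] with t ht ht0
  have h := quadForm_smul_sub hg ⟨_, ht⟩ z
  rw [← transformation_apply, ← transformation_apply, add_sub_cancel_left, quadForm_smul] at h
  rw [Function.comp_apply, quadForm_smul]
  have := inv_mul_cancel₀ ht0
  linear_combination (-(t⁻¹ ^ 2)) * h - (t⁻¹ * t + 1) * quadForm v * this

theorem det_sq_of_quadForm_apply {c : ℂ}
    {A : EuclideanSpace ℂ (Fin n) →L[ℂ] EuclideanSpace ℂ (Fin n)}
    (hA : ∀ v, c ^ 2 * quadForm (A v) = quadForm v) : (A.det * c ^ n) ^ 2 = 1 := by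
  set b := (EuclideanSpace.basisFun (Fin n) ℂ).toBasis
  set M := LinearMap.toMatrix b b A
  have hpolar (u v : EuclideanSpace ℂ (Fin n)) :
      c ^ 2 * ∑ k, A u k * A v k = ∑ k, u k * v k := by
    have h := hA (u - v)
    rw [map_sub, quadForm_sub, quadForm_sub] at h
    linear_combination (hA u + hA v - h) / 2
  have hM : c ^ 2 • (Mᵀ * M) = 1 := by
    ext i j
    have h := hpolar (b i) (b j)
    simp only [b, OrthonormalBasis.coe_toBasis, EuclideanSpace.basisFun_apply] at h
    simpa [M, b, mul_apply, LinearMap.toMatrix_apply, one_apply, eq_comm (a := i)] using h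
  have hdet : A.det = M.det := (LinearMap.det_toMatrix b _).symm
  have h := congrArg det hM
  rw [det_smul, det_mul, det_transpose, det_one, Fintype.card_fin, ← hdet] at h
  linear_combination h

theorem jacobian_mul_factor_pow (hg : g ∈ groupG n) (z : lieBall n) :
    jacobian g z * factor g z ^ n = 1 := by
  have hcont : ContinuousOn (fun g => jacobian g z * factor g z ^ n)
      (groupG n : Set (indefiniteSO n)) :=
    (continuousOn_jacobian z).mul
      ((continuous_factor.comp (Continuous.prodMk_left z.1)).pow n).continuousOn
  refine isPreconnected_connectedComponent.eq_of_sq_eq hcont continuousOn_const (g := 1)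
    (fun g hg => ?_) (fun _ => one_ne_zero) mem_connectedComponent ?_ hg
  · rw [Pi.pow_apply, one_pow]
    exact det_sq_of_quadForm_apply (factor_sq_mul_quadForm_fderiv hg z)
  · rw [jacobian_one, factor_one, one_pow, one_mul, Pi.one_apply]

end Jacobian

section ComplexPower
open Complex
open scoped ComplexOrder

theorem prod_cpow_of_mem_slitPlane {ι X : Type*} [Fintype ι] [TopologicalSpace X]
    [PreconnectedSpace X] {a : ι → X → ℂ} (hcont : ∀ i, Continuous (a i))
    (hslit : ∀ i x, a i x ∈ slitPlane) (hprod : ∀ x, ∏ i, a i x ∈ slitPlane) {x₀ : X}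
    (hx₀ : ∀ i, 0 < a i x₀) (c : ℂ) (x : X) :
    (∏ i, a i x) ^ c = ∏ i, a i x ^ c := by
  have hlog : (fun x => log (∏ i, a i x)) = fun x => ∑ i, log (a i x) := by
    refine eq_of_exp_comp_eq ((continuous_finsetProd _ fun i _ => hcont i).clog hprod)
      (continuous_finsetSum _ fun i _ => (hcont i).clog (hslit i)) (fun x => ?_) (x₀ := x₀) ?_
    · rw [exp_log (slitPlane_ne_zero (hprod x)), exp_sum]
      exact Finset.prod_congr rfl fun i _ => (exp_log (slitPlane_ne_zero (hslit i x))).symm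
    · choose r hr hra using fun i => RCLike.pos_iff_exists_ofReal.1 (hx₀ i)
      simp only [← hra, coe_algebraMap, ← ofReal_prod, ← ofReal_log, (hr _).le, ← ofReal_sum,
        Real.log_prod fun i _ => (hr i).ne', (Finset.prod_pos fun i _ => hr i).le]
  have hcpow (i : ι) : a i x ^ c = exp (log (a i x) * c) :=
    cpow_def_of_ne_zero (slitPlane_ne_zero (hslit i x)) c
  simp only [cpow_def_of_ne_zero (slitPlane_ne_zero (hprod x)), hcpow, congrFun hlog x,
    Finset.sum_mul, exp_sum]

end ComplexPower

noncomputable section Representation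
open Complex Matrix
open scoped InnerProductSpace ComplexOrder

variable {n : ℕ} {g : indefiniteSO n}

theorem logJacobian_eq (hn : 2 ≤ n) (hg : g ∈ groupH n) (z : lieBall n) :
    logJacobian g z = -n * log (factor g z) := by
  have hgG := groupH_le_groupG n hg
  have hcont : Continuous fun z : lieBall n => -n * log (factor g z) :=
    continuous_const.mul ((continuous_factor_right g).clog (factor_mem_slitPlane hn hg))
  have hexp (z : lieBall n) : cexp (-n * log (factor g z)) = jacobian g z := by
    rw [neg_mul, exp_neg, exp_nat_mul, exp_log (factor_ne_zero hgG z.2)]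
    exact (eq_inv_of_mul_eq_one_left (jacobian_mul_factor_pow hgG z)).symm
  have horigin : -n * log (factor g (origin n)) = log (jacobian g (origin n)) := by
    obtain ⟨r, hr, hfactor⟩ : ∃ r : ℝ, 0 < r ∧ (r : ℂ) = factor g (origin n) :=
      RCLike.pos_iff_exists_ofReal.1 (factor_pos hn hg (origin_mem_lieBallReal n))
    rw [eq_inv_of_mul_eq_one_left (jacobian_mul_factor_pow hgG (origin n)), ← hfactor,
      ← ofReal_log hr.le, ← ofReal_pow, ← ofReal_inv, ← ofReal_log (by positivity), Real.log_inv,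
      Real.log_pow]
    push_cast
    ring
  have hspec := Classical.epsilon_spec (p := fun l : lieBall n → ℂ => Continuous l ∧
    (∀ z, cexp (l z) = jacobian g z) ∧ l (origin n) = log (jacobian g (origin n)))
    ⟨_, hcont, hexp, horigin⟩
  exact congrFun (eq_of_exp_comp_eq hspec.1 hcont (fun z => (hspec.2.1 z).trans (hexp z).symm)
    (hspec.2.2.trans horigin.symm)) z

theorem factor_mul_cpow (hn : 2 ≤ n) {g' : indefiniteSO n} (hg : g ∈ groupH n)
    (hg' : g' ∈ groupH n) (c : ℂ) (z : lieBall n) :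
    factor (g * g') z ^ c = factor g (g' • z).1 ^ c * factor g' z ^ c := by
  have hg'G := groupH_le_groupG n hg'
  have hsmul : Continuous fun z : lieBall n => g' • z :=
    continuous_const_smul (⟨g', hg'G⟩ : groupG n)
  have h := prod_cpow_of_mem_slitPlane (x₀ := origin n)
    (a := ![fun z : lieBall n => factor g (g' • z).1, fun z => factor g' z])
    (Fin.forall_fin_two.2 ⟨(continuous_factor_right g).comp hsmul, continuous_factor_right g'⟩)
    (Fin.forall_fin_two.2 ⟨fun z => factor_mem_slitPlane hn hg _, factor_mem_slitPlane hn hg'⟩)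
    (fun z => by
      rw [Fin.prod_univ_two]
      exact factor_mul g hg'G z ▸ factor_mem_slitPlane hn (mul_mem hg hg') z)
    (Fin.forall_fin_two.2 ⟨factor_pos hn hg ((groupH_le_realStabilizer n hg').2 _
      (origin_mem_lieBallReal n)), factor_pos hn hg' (origin_mem_lieBallReal n)⟩) c z
  rw [Fin.prod_univ_two, Fin.prod_univ_two] at h
  rw [factor_mul g hg'G]
  exact h

theorem hPoly_smul_cpow (hn : 2 ≤ n) (hg : g ∈ groupH n) (c : ℂ) (z w : lieBall n) :
    factor g z ^ c * conj (factor g w) ^ c * hPoly (g • z).1 (g • w).1 ^ c = hPoly z.1 w.1 ^ c := by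
  have hgG := groupH_le_groupG n hg
  have hfactor := continuous_factor_right g
  have hslit := factor_mem_slitPlane hn hg
  have h0 := origin_mem_lieBallReal n
  have hpos := factor_pos hn hg h0
  have hg0 := (groupH_le_realStabilizer n hg).2 _ h0
  have hprod (p : lieBall n × lieBall n) := hPoly_smul hgG p.1 p.2
  have hconj : Continuous fun p : lieBall n × lieBall n => conj (factor g p.2) :=
    continuous_conj.comp (hfactor.comp continuous_snd)
  have hsmul : Continuous fun z : lieBall n => (g • z).1 :=
    continuous_subtype_val.comp (continuous_const_smul (⟨g, hgG⟩ : groupG n))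
  have hhPoly := continuous_hPoly.comp (hsmul.prodMap hsmul)
  have h := prod_cpow_of_mem_slitPlane (x₀ := (origin n, origin n))
    (a := ![fun p : lieBall n × lieBall n => factor g p.1, fun p => conj (factor g p.2),
      fun p => hPoly (g • p.1).1 (g • p.2).1])
    (by simpa only [Fin.forall_fin_succ, IsEmpty.forall_iff, and_true]
      using ⟨hfactor.comp continuous_fst, hconj, hhPoly⟩)
    (by simpa only [Fin.forall_fin_succ, IsEmpty.forall_iff, and_true]
      using ⟨fun p => hslit p.1, fun p => conj_mem_slitPlane (hslit p.2),
        fun p => hPoly_mem_slitPlane hn (g • p.1).2 (g • p.2).2⟩)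
    (fun p => by
      rw [Fin.prod_univ_three]
      exact hprod p ▸ hPoly_mem_slitPlane hn p.1.2 p.2.2)
    (by simpa only [Fin.forall_fin_succ, IsEmpty.forall_iff, and_true]
      using ⟨hpos, star_pos_iff.2 hpos, hPoly_pos hn hg0 hg0⟩)
    c (z, w)
  rw [Fin.prod_univ_three, Fin.prod_univ_three] at h
  exact h.symm.trans (congrArg (· ^ c) (hprod (z, w)))

theorem conj_cpow_ofReal {x : ℂ} (hx : x ∈ slitPlane) (r : ℝ) :
    conj (x ^ (r : ℂ)) = conj x ^ (r : ℂ) := by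
  rw [conj_cpow _ _ (slitPlane_arg_ne_pi hx), conj_ofReal]

theorem factor_origin_of_mem_groupL (hn : 2 ≤ n) (hg : g ∈ groupL n) : factor g (origin n) = 1 := by
  obtain ⟨r, hr, hfactor⟩ : ∃ r : ℝ, 0 < r ∧ (r : ℂ) = factor g (origin n) :=
    RCLike.pos_iff_exists_ofReal.1 (factor_origin_pos hn hg.1)
  have hsq := hPoly_smul (groupH_le_groupG n hg.1) (origin n) (origin n)
  have horigin : hPoly (origin n).1 (origin n).1 = 1 := by simp [hPoly, quadForm]
  have hfix : g • origin n = origin n := hg.2.2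
  rw [hfix, horigin, mul_one, ← hfactor, conj_ofReal] at hsq
  rw [← hfactor, ofReal_eq_one]
  exact (mul_self_eq_one_iff.1 (by exact_mod_cast hsq)).resolve_right (by linarith)

theorem continuous_factor_left (z : EuclideanSpace ℂ (Fin n)) :
    Continuous fun g : groupH n => factor (g : indefiniteSO n) z := by
  have h := continuous_factor.comp (Continuous.prodMk_left z)
  exact h.comp continuous_subtype_val

theorem continuous_groupH_smul (z : lieBall n) : Continuous fun g : groupH n => g • z := by
  have h : Continuous fun g : groupH n => (⟨g, groupH_le_groupG n g.2⟩ : groupG n) :=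
    continuous_subtype_val.subtype_mk _
  exact h.smul continuous_const

theorem gateauxHolomorphicOn_hPoly_cpow (hn : 2 ≤ n) (c : ℂ) {w : EuclideanSpace ℂ (Fin n)}
    (hw : w ∈ lieBall n) : GateauxHolomorphicOn (fun z => hPoly z w ^ c) (lieBall n) := by
  intro a b s hs
  have hline : Differentiable ℂ fun s : ℂ => hPoly (a + s • b) w := by
    unfold hPoly quadForm
    simp only [PiLp.add_apply, PiLp.smul_apply]
    fun_prop
  exact ((hline s).cpow_const (hPoly_mem_slitPlane hn hs hw)).differentiableWithinAt

variable (n) (ν : ℝ) [Fact (lieBallKernel n ν).PosSemidef]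

theorem kernelVec_apply (z w : lieBall n) :
    kernelVec (RKHS.OfKernel (lieBallKernel n ν)) w z = hPoly z.1 w.1 ^ (-(ν : ℂ)) := by
  rw [kernelVec, RKHS.kerFun_apply, RKHS.OfKernel.kernel_ofKernel]
  simp [lieBallKernel]

theorem inner_kernelVec_kernelVec (z w : lieBall n) :
    ⟪kernelVec (RKHS.OfKernel (lieBallKernel n ν)) z,
      kernelVec (RKHS.OfKernel (lieBallKernel n ν)) w⟫_ℂ = hPoly z.1 w.1 ^ (-(ν : ℂ)) := by
  rw [inner_kernelVec, kernelVec_apply]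

theorem kernelVec_origin_apply (z : lieBall n) :
    kernelVec (RKHS.OfKernel (lieBallKernel n ν)) (origin n) z = 1 := by
  rw [kernelVec_apply]
  simp [hPoly, quadForm]

variable {n}

theorem continuous_kernelVec (hn : 2 ≤ n) :
    Continuous (kernelVec (𝕜 := ℂ) (X := lieBall n) (RKHS.OfKernel (lieBallKernel n ν))) := by
  refine continuous_of_continuous_inner (𝕜 := ℂ) ?_
  simp only [inner_kernelVec_kernelVec]
  have hval : Continuous (Subtype.val : lieBall n → EuclideanSpace ℂ (Fin n)) :=
    continuous_subtype_val
  have h := continuous_hPoly.comp (hval.prodMap hval)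
  exact h.cpow continuous_const fun p => hPoly_mem_slitPlane hn p.1.2 p.2.2

theorem eq_zero_of_forall_lieBallReal (hn : 2 ≤ n) {f : RKHS.OfKernel (lieBallKernel n ν)}
    (hf : ∀ z ∈ lieBallReal n, f z = 0) : f = 0 := by
  have hval (f : RKHS.OfKernel (lieBallKernel n ν)) (z : lieBall n) :
      Function.extend Subtype.val f 0 z.1 = f z := Subtype.val_injective.extend_apply f 0 z
  have hhol : GateauxHolomorphicOn (Function.extend Subtype.val f 0) (lieBall n) :=
    gateauxHolomorphicOn_of_kernelVec (isOpen_lieBall n) (continuous_kernelVec ν hn)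
      (fun w a b => (gateauxHolomorphicOn_hPoly_cpow hn _ w.2 a b).congr fun s hs =>
        (hval _ ⟨a + s • b, hs⟩).trans (kernelVec_apply n ν _ w)) f
  have hzero := hhol.eqOn_zero_of_realPoints (isOpen_lieBall n) (starConvex_lieBall n)
    fun z hz => (hval f ⟨z, hz.1⟩).trans (hf ⟨z, hz.1⟩ hz.2)
  refine RKHS.ext fun z => ?_
  rw [← hval, hzero z.2, RKHS.coe_zero, Pi.zero_apply, Pi.zero_apply]

/-- The multiplier `J_g(z)^(ν/n)` of `π_ν`, expressed through the automorphy factor. -/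
def lieBallMultiplier (hn : 2 ≤ n) :
    KernelMultiplier (groupH n) (RKHS.OfKernel (lieBallKernel n ν)) where
  toFun g z := factor (g : indefiniteSO n) z.1 ^ (-(ν : ℂ))
  one_apply z := by rw [Subgroup.coe_one, factor_one, one_cpow]
  mul_apply g g' z := factor_mul_cpow hn g.2 g'.2 (-(ν : ℂ)) z
  inner_smul g z w := by
    have hconj := conj_cpow_ofReal (factor_mem_slitPlane hn g.2 w) (-ν)
    rw [ofReal_neg] at hconj
    rw [inner_kernelVec_kernelVec, inner_kernelVec_kernelVec, hconj]
    exact hPoly_smul_cpow hn g.2 _ z w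

theorem lieBallMultiplier_apply (hn : 2 ≤ n) (g : groupH n) (z : lieBall n) :
    lieBallMultiplier ν hn g z = cexp (ν / n * logJacobian (g : indefiniteSO n) z) := by
  have hn0 : (n : ℂ) ≠ 0 := by exact_mod_cast (by omega : n ≠ 0)
  rw [logJacobian_eq hn g.2]
  refine (cpow_def_of_ne_zero (factor_ne_zero (groupH_le_groupG n g.2) z.2) _).trans ?_
  congr 1
  field_simp

theorem unitaryRep_apply_eq_piNu (hn : 2 ≤ n) (g : groupH n)
    (f : RKHS.OfKernel (lieBallKernel n ν)) (z : lieBall n) :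
    (lieBallMultiplier ν hn).unitaryRep g f z = piNu ν (g : indefiniteSO n) f z := by
  rw [KernelMultiplier.unitaryRep_apply, lieBallMultiplier_apply]
  rfl

theorem continuous_lieBallMultiplier (hn : 2 ≤ n) (z : lieBall n) :
    Continuous fun g : groupH n => lieBallMultiplier ν hn g z :=
  (continuous_factor_left z.1).cpow continuous_const fun g => factor_mem_slitPlane hn g.2 z

theorem unitaryRep_kernelVec_origin (hn : 2 ≤ n) {l : groupH n}
    (hl : (l : indefiniteSO n) ∈ groupL n) :
    (lieBallMultiplier ν hn).unitaryRep l (kernelVec _ (origin n)) = kernelVec _ (origin n) := by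
  have hfix : l • origin n = origin n := hl.2.2
  have hm : lieBallMultiplier ν hn l (origin n) = 1 := by
    change factor (l : indefiniteSO n) (origin n).1 ^ (-(ν : ℂ)) = 1
    rw [factor_origin_of_mem_groupL hn hl, one_cpow]
  rw [KernelMultiplier.unitaryRep_kernelVec, hfix, hm, map_one, one_smul]

end Representation

theorem mainTheorem9_general {n : ℕ} (hn : 2 ≤ n) (ν : ℝ) [Fact (lieBallKernel n ν).PosSemidef] :
    ∃ one : RKHS.OfKernel (lieBallKernel n ν), (∀ z : lieBall n, one z = 1) ∧
      ∃ π : groupH n →*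
          (RKHS.OfKernel (lieBallKernel n ν) ≃ₗᵢ[ℂ] RKHS.OfKernel (lieBallKernel n ν)),
        (∀ (h : groupH n) (f : RKHS.OfKernel (lieBallKernel n ν)) (z : lieBall n),
          π h f z = piNu ν h f z) ∧
        (∀ f : RKHS.OfKernel (lieBallKernel n ν), Continuous fun h : groupH n => π h f) ∧
        (∀ l : groupH n, (l : indefiniteSO n) ∈ groupL n → π l one = one) ∧
        (Submodule.span ℂ (Set.range fun h : groupH n => π h one)).topologicalClosure = ⊤ := by
  refine ⟨kernelVec _ (origin n), kernelVec_origin_apply n ν, (lieBallMultiplier ν hn).unitaryRep,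
    unitaryRep_apply_eq_piNu ν hn, fun f => ?_, fun l hl => unitaryRep_kernelVec_origin ν hn hl, ?_⟩
  · exact KernelMultiplier.continuous_unitaryRep_apply _ (continuous_kernelVec ν hn)
      continuous_groupH_smul (continuous_lieBallMultiplier ν hn) f
  · refine KernelMultiplier.span_range_unitaryRep_kernelVec _ (origin n) fun f hf => ?_
    refine eq_zero_of_forall_lieBallReal ν hn fun z hz => ?_
    obtain ⟨g, rfl⟩ := exists_smul_origin_eq hz
    exact hf g

theorem mainTheorem9 (n : ℕ) [Fact (2 < n)] (ν : ℝ) [Fact (ν ∈ wallachSet n)] :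
    ∃ one : HilbertNu n ν, (∀ z : lieBall n, one z = 1) ∧
      ∃ π : groupH n →* (HilbertNu n ν ≃ₗᵢ[ℂ] HilbertNu n ν),
        (∀ (h : groupH n) (f : HilbertNu n ν) (z : lieBall n), π h f z = piNu ν h f z) ∧
        (∀ f : HilbertNu n ν, Continuous fun h : groupH n => π h f) ∧
        (∀ l : groupH n, (l : indefiniteSO n) ∈ groupL n → π l one = one) ∧
        (Submodule.span ℂ (Set.range fun h : groupH n => π h one)).topologicalClosure = ⊤ :=
  mainTheorem9_general (Fact.out : 2 < n).le ν
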